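/- Let $p,q:\mathbb{R}\to\mathbb{C}$ be $\pi$-periodic functions that are of bounded variation on $[0,\pi]$, let $$Q=\begin{pmatrix}p&q\\ q&-p\end{pmatrix},\qquad J=\begin{pmatrix}0&1\\-1&0\end{pmatrix},\qquad l(\mathbf y)=J\mathbf y'+Q\mathbf y .$$ Let $L(Q)$ be the operator generated by $l$ in $L_2(\mathbb{R};\mathbb{C}^2)$ with its maximal domain (locally absolutely continuous $\mathbf y\in L_2$ with $l(\mathbf y)\in L_2$), and, for real $t$, let $L_t(Q)$ be the operator generated by $l$ in $L_2([0,\pi];\mathbb{C}^2)$ on the absolutely continuous $\mathbf y$ with $l(\mathbf y)\in L_2$ and $\mathbf y(\pi)=e^{i\pi t}\mathbf y(0)$. The eigenvalues of the operators $L_t(Q)$, $t\in(-1,1]$, are called Bloch eigenvalues. Eigenvalues are counted with algebraic multiplicity; an eigenvalue is multiple if its multiplicity is at least $2$. A point $\lambda\in\sigma(L(Q))$ is a *spectral singularity* of $L(Q)$ if for every $\varepsilon>0$ there is a sequence of simple closed, positively oriented, piecewise $C^1$ contours $\gamma_n\subset\{z\in\mathbb{C}:|z-\lambda|<\varepsilon\}$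 such that, for each $n$ and every $t\in(-1,1]$, $\gamma_n$ encloses at most one eigenvalue (counting multiplicity) of $L_t(Q)$, and $$\lim_{n\to\infty}\ \sup_t\Big\|\int_{\gamma_n}(L_t(Q)-zI)^{-1}\,dz\Big\|=\infty ,$$ where the supremum is over all $t\in(-1,1]$ for which $\gamma_n$ lies in the resolvent set of $L_t(Q)$. A point $\lambda_0\in\mathbb{C}$ is an *essential spectral singularity* (ESS) of $L(Q)$ if there are $t_0\in(-1,1]$ and a continuous branch $\lambda(t)$ of eigenvalues of $L_t(Q)$, defined for $t$ in a real neighbourhood of $t_0$, with $\lambda(t_0)=\lambda_0$, such that $1/|\alpha|$ is not integrable on $(t_0-\varepsilon,t_0+\varepsilon)$ for any $\varepsilon>0$. Here $\alpha(t)=(\Psi_t,\Psi_t^*)$, where $\Psi_t$ and $\Psi_t^*$ are eigenfunctions of norm $1$ of $L_t(Q)$ and of its adjoint $L_t(Q)^*$ for the eigenvalues $\lambda(t)$ and $\overline{\lambda(t)}$, respectively. Then: 1. every spectral singularity of $L(Q)$ is a multiple Bloch eigenvalue, that is, a multiple eigenvalue of $L_t(Q)$ for some $t\in(-1,1]$;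 2. every ESS of $L(Q)$ is a spectral singularity of $L(Q)$; 3. every ESS of $L(Q)$ is a multiple eigenvalue of $L_0(Q)$ or of $L_1(Q)$. -/

import Mathlib

open MeasureTheory Set Filter Topology
open scoped ENNReal

noncomputable section

/-! ### Closed linear operators through their graphs

An unbounded operator `T` in a Hilbert space `H` is represented by its graph
`{(f, T f) | f ∈ D(T)}`, a linear subspace of `H × H`. -/

section Operators

variable {H : Type*} [NormedAddCommGroup H] [InnerProductSpace ℂ H]

/-- `R` is the (bounded, everywhere defined) inverse of `T - z`. -/
def IsResolventAt (T : Submodule ℂ (H × H)) (z : ℂ) (R : H →L[ℂ] H) : Prop :=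
  ∀ f g : H, R g = f ↔ (f, g + z • f) ∈ T

/-- The resolvent set of `T`. -/
def opResolventSet (T : Submodule ℂ (H × H)) : Set ℂ :=
  {z | ∃ R : H →L[ℂ] H, IsResolventAt T z R}

/-- The spectrum of `T`. -/
def opSpectrum (T : Submodule ℂ (H × H)) : Set ℂ := (opResolventSet T)ᶜ

open Classical in
/-- The resolvent `(T - z)⁻¹` for `z` in the resolvent set (and `0` elsewhere). -/
def opResolvent (T : Submodule ℂ (H × H)) (z : ℂ) : H →L[ℂ] H :=
  if h : ∃ R : H →L[ℂ] H, IsResolventAt T z R then h.choose else 0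

/-- `f` is an eigenvector of `T` with eigenvalue `z`. -/
def IsEigenvector (T : Submodule ℂ (H × H)) (z : ℂ) (f : H) : Prop :=
  f ≠ 0 ∧ (f, z • f) ∈ T

/-- `z` is an eigenvalue of `T`. -/
def IsEigenvalue (T : Submodule ℂ (H × H)) (z : ℂ) : Prop :=
  ∃ f : H, IsEigenvector T z f

/-- `ker (T - z)^k`: the vectors `f` with `(T - z)^k f = 0`. -/
def rootKer (T : Submodule ℂ (H × H)) (z : ℂ) : ℕ → Submodule ℂ H
  | 0 => ⊥
  | k + 1 =>
    { carrier := {f | ∃ g ∈ rootKer T z k, (f, z • f + g) ∈ T}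
      zero_mem' := ⟨0, Submodule.zero_mem _, by rw [smul_zero, add_zero]; exact T.zero_mem⟩
      add_mem' := by
        rintro f₁ f₂ ⟨g₁, hg₁, h₁⟩ ⟨g₂, hg₂, h₂⟩
        refine ⟨g₁ + g₂, Submodule.add_mem _ hg₁ hg₂, ?_⟩
        have h := Submodule.add_mem _ h₁ h₂
        rw [Prod.mk_add_mk] at h
        rwa [smul_add, add_add_add_comm]
      smul_mem' := by
        rintro c f ⟨g, hg, h⟩
        refine ⟨c • g, Submodule.smul_mem _ c hg, ?_⟩
        have h' := Submodule.smul_mem _ c h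
        rw [Prod.smul_mk] at h'
        rwa [smul_comm z c f, ← smul_add] }

/-- The algebraic multiplicity of `z` as an eigenvalue of `T`: the dimension of the space of all
root vectors (eigenvectors and associated vectors); it is `0` if `z` is not an eigenvalue. -/
def algMultiplicity (T : Submodule ℂ (H × H)) (z : ℂ) : ℕ∞ :=
  Cardinal.toENat (Module.rank ℂ ↥(⨆ k, rootKer T z k))

/-- `z` is a multiple eigenvalue of `T`. -/
def IsMultipleEigenvalue (T : Submodule ℂ (H × H)) (z : ℂ) : Prop :=
  IsEigenvalue T z ∧ 2 ≤ algMultiplicity T z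

end Operators

/-! ### The Dirac operators -/

/-- The value `J v + Q(x) y` of the differential expression at `x`, where `y` and `v` are the
values of the function and of its derivative at `x`. -/
def diracExpr (p q : ℝ → ℂ) (x : ℝ) (y v : EuclideanSpace ℂ (Fin 2)) :
    EuclideanSpace ℂ (Fin 2) :=
  WithLp.toLp 2 (Matrix.mulVec !![0, 1; -1, 0] v.ofLp + Matrix.mulVec !![p x, q x; q x, -p x] y.ofLp)

theorem diracExpr_zero (p q : ℝ → ℂ) (x : ℝ) : diracExpr p q x 0 0 = 0 := by
  simp [diracExpr]

theorem diracExpr_add (p q : ℝ → ℂ) (x : ℝ) (y₁ v₁ y₂ v₂ : EuclideanSpace ℂ (Fin 2)) :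
    diracExpr p q x (y₁ + y₂) (v₁ + v₂) = diracExpr p q x y₁ v₁ + diracExpr p q x y₂ v₂ := by
  simp only [diracExpr, WithLp.ofLp_add, Matrix.mulVec_add, ← WithLp.toLp_add]
  congr 1
  abel

theorem diracExpr_smul (p q : ℝ → ℂ) (x : ℝ) (c : ℂ) (y v : EuclideanSpace ℂ (Fin 2)) :
    diracExpr p q x (c • y) (c • v) = c • diracExpr p q x y v := by
  simp only [diracExpr, WithLp.ofLp_smul, Matrix.mulVec_smul, ← WithLp.toLp_smul, smul_add]

/-- The space `L₂²[0, π]`. -/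
abbrev L2Period : Type :=
  Lp (EuclideanSpace ℂ (Fin 2)) 2 (volume.restrict (Icc (0 : ℝ) Real.pi))

/-- The space `L₂²(-∞, ∞)`. -/
abbrev L2Line : Type := Lp (EuclideanSpace ℂ (Fin 2)) 2 (volume : Measure ℝ)

/-- The operator `L_t(Q)` in `L₂²[0, π]` (its graph): the domain consists of the absolutely
continuous functions `y` (with almost everywhere derivative `v`) such that `J y' + Q y` is in
`L₂²[0, π]` and `y(π) = exp(iπt) y(0)`. -/
def blochOp (p q : ℝ → ℂ) (t : ℝ) : Submodule ℂ (L2Period × L2Period) where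
  carrier := {u | ∃ y v : ℝ → EuclideanSpace ℂ (Fin 2),
    IntervalIntegrable v volume 0 Real.pi ∧
    (∀ x ∈ Icc 0 Real.pi, y x = y 0 + ∫ s in (0 : ℝ)..x, v s) ∧
    y Real.pi = Complex.exp (Complex.I * Real.pi * t) • y 0 ∧
    u.1 =ᵐ[volume.restrict (Icc (0 : ℝ) Real.pi)] y ∧
    u.2 =ᵐ[volume.restrict (Icc (0 : ℝ) Real.pi)] fun x => diracExpr p q x (y x) (v x)}
  zero_mem' := by
    refine ⟨0, 0, ?_, ?_, ?_, ?_, ?_⟩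
    · exact intervalIntegrable_const (c := (0 : EuclideanSpace ℂ (Fin 2)))
    · intro x _; simp
    · simp
    · exact Lp.coeFn_zero _ _ _
    · filter_upwards [Lp.coeFn_zero (EuclideanSpace ℂ (Fin 2)) 2
        (volume.restrict (Icc (0 : ℝ) Real.pi))] with x hx
      simpa [diracExpr_zero] using hx
  add_mem' := by
    rintro a b ⟨y₁, v₁, hi₁, hy₁, hb₁, ha₁, hc₁⟩ ⟨y₂, v₂, hi₂, hy₂, hb₂, ha₂, hc₂⟩
    refine ⟨y₁ + y₂, v₁ + v₂, hi₁.add hi₂, ?_, ?_, ?_, ?_⟩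
    · intro x hx
      have hsub : uIcc 0 x ⊆ uIcc 0 Real.pi := by
        rw [uIcc_of_le hx.1, uIcc_of_le Real.pi_pos.le]
        exact Icc_subset_Icc_right hx.2
      have h := intervalIntegral.integral_add (hi₁.mono_set hsub) (hi₂.mono_set hsub)
      simp only [Pi.add_apply]
      rw [h, hy₁ x hx, hy₂ x hx]
      abel
    · simp only [Pi.add_apply, hb₁, hb₂, smul_add]
    · filter_upwards [Lp.coeFn_add a.1 b.1, ha₁, ha₂] with x h h₁ h₂
      rw [Prod.fst_add, h, Pi.add_apply, Pi.add_apply, h₁, h₂]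
    · filter_upwards [Lp.coeFn_add a.2 b.2, hc₁, hc₂] with x h h₁ h₂
      rw [Prod.snd_add, h, Pi.add_apply, h₁, h₂, Pi.add_apply, Pi.add_apply, diracExpr_add]
  smul_mem' := by
    rintro c a ⟨y, v, hi, hy, hb, ha, hc⟩
    refine ⟨c • y, c • v, hi.smul c, ?_, ?_, ?_, ?_⟩
    · intro x hx
      simp only [Pi.smul_apply]
      rw [intervalIntegral.integral_smul, hy x hx, smul_add]
    · simp only [Pi.smul_apply, hb]
      rw [smul_comm]
    · filter_upwards [Lp.coeFn_smul c a.1, ha] with x h h₁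
      rw [Prod.smul_fst, h, Pi.smul_apply, Pi.smul_apply, h₁]
    · filter_upwards [Lp.coeFn_smul c a.2, hc] with x h h₁
      rw [Prod.smul_snd, h, Pi.smul_apply, h₁, Pi.smul_apply, Pi.smul_apply, diracExpr_smul]

/-- The operator `L(Q)` in `L₂²(-∞, ∞)` (its graph): the domain consists of the locally absolutely
continuous functions `y` (with almost everywhere derivative `v`) such that `y` and `J y' + Q y`
are in `L₂²(-∞, ∞)`. -/
def diracOp (p q : ℝ → ℂ) : Submodule ℂ (L2Line × L2Line) where
  carrier := {u | ∃ y v : ℝ → EuclideanSpace ℂ (Fin 2),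
    LocallyIntegrable v volume ∧
    (∀ x : ℝ, y x = y 0 + ∫ s in (0 : ℝ)..x, v s) ∧
    u.1 =ᵐ[volume] y ∧
    u.2 =ᵐ[volume] fun x => diracExpr p q x (y x) (v x)}
  zero_mem' := by
    refine ⟨0, 0, locallyIntegrable_zero, ?_, ?_, ?_⟩
    · intro x; simp
    · exact Lp.coeFn_zero _ _ _
    · filter_upwards [Lp.coeFn_zero (EuclideanSpace ℂ (Fin 2)) 2
        (volume : Measure ℝ)] with x hx
      simpa only [Prod.snd_zero, Pi.zero_apply, diracExpr_zero] using hx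
  add_mem' := by
    rintro a b ⟨y₁, v₁, hi₁, hy₁, ha₁, hc₁⟩ ⟨y₂, v₂, hi₂, hy₂, ha₂, hc₂⟩
    refine ⟨y₁ + y₂, v₁ + v₂, hi₁.add hi₂, ?_, ?_, ?_⟩
    · intro x
      have h := intervalIntegral.integral_add ((hi₁.integrableOn_isCompact isCompact_uIcc).intervalIntegrable (a := 0) (b := x))
        ((hi₂.integrableOn_isCompact isCompact_uIcc).intervalIntegrable (a := 0) (b := x))
      simp only [Pi.add_apply]
      rw [h, hy₁ x, hy₂ x]
      abel
    · filter_upwards [Lp.coeFn_add a.1 b.1, ha₁, ha₂] with x h h₁ h₂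
      rw [Prod.fst_add, h, Pi.add_apply, Pi.add_apply, h₁, h₂]
    · filter_upwards [Lp.coeFn_add a.2 b.2, hc₁, hc₂] with x h h₁ h₂
      rw [Prod.snd_add, h, Pi.add_apply, h₁, h₂, Pi.add_apply, Pi.add_apply, diracExpr_add]
  smul_mem' := by
    rintro c a ⟨y, v, hi, hy, ha, hc⟩
    refine ⟨c • y, c • v, hi.smul c, ?_, ?_, ?_⟩
    · intro x
      simp only [Pi.smul_apply]
      rw [intervalIntegral.integral_smul, hy x, smul_add]
    · filter_upwards [Lp.coeFn_smul c a.1, ha] with x h h₁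
      rw [Prod.smul_fst, h, Pi.smul_apply, Pi.smul_apply, h₁]
    · filter_upwards [Lp.coeFn_smul c a.2, hc] with x h h₁
      rw [Prod.smul_snd, h, Pi.smul_apply, h₁, Pi.smul_apply, Pi.smul_apply, diracExpr_smul]

/-! ### Contours -/

/-- The winding number of the closed path `γ : [0, 1] → ℂ` about `z`. -/
def windingNumber (γ : ℝ → ℂ) (z : ℂ) : ℂ :=
  (2 * Real.pi * Complex.I)⁻¹ * ∫ s in (0 : ℝ)..1, deriv γ s / (γ s - z)

/-- `γ` is piecewise continuously differentiable on `[0, 1]`: it is `C¹` on every closed subinterval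
with no point of some finite set `S` in its interior. -/
def IsPiecewiseC1 (γ : ℝ → ℂ) : Prop :=
  ∃ S : Finset ℝ, ∀ a b : ℝ, 0 ≤ a → a < b → b ≤ 1 → (∀ s ∈ S, s ∉ Ioo a b) →
    ContDiffOn ℝ 1 γ (Icc a b)

/-- `γ` (on `[0, 1]`) is a positively oriented, simple closed, piecewise `C¹` contour.
By the Jordan curve theorem a simple closed contour has winding number `0` about the points
outside it and `1` (positive orientation) or `-1` about the points inside it. -/
structure IsContour (γ : ℝ → ℂ) : Prop where
  continuousOn : ContinuousOn γ (Icc 0 1)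
  piecewiseC1 : IsPiecewiseC1 γ
  closed : γ 0 = γ 1
  simple : InjOn γ (Ico 0 1)
  positive : ∀ z ∉ γ '' Icc 0 1, windingNumber γ z = 0 ∨ windingNumber γ z = 1

/-- The contour `γ` encloses the point `z`. -/
def Encloses (γ : ℝ → ℂ) (z : ℂ) : Prop :=
  z ∉ γ '' Icc 0 1 ∧ windingNumber γ z = 1

/-- The operator `e(t, γ) = ∫_γ (L_t(Q) - z)⁻¹ dz`. -/
def contourProjection (p q : ℝ → ℂ) (t : ℝ) (γ : ℝ → ℂ) : L2Period →L[ℂ] L2Period :=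
  ∫ s in (0 : ℝ)..1, deriv γ s • opResolvent (blochOp p q t) (γ s)

/-! ### Spectral singularities -/

/-- `γ` encloses at most one eigenvalue of `L_t(Q)`, counted with multiplicity. -/
def EnclosesAtMostOne (p q : ℝ → ℂ) (t : ℝ) (γ : ℝ → ℂ) : Prop :=
  (∀ z w : ℂ, Encloses γ z → Encloses γ w →
    IsEigenvalue (blochOp p q t) z → IsEigenvalue (blochOp p q t) w → z = w) ∧
  ∀ z : ℂ, Encloses γ z → algMultiplicity (blochOp p q t) z ≤ 1

/-- `lam` is a spectral singularity of `L(Q)`. -/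
def IsSpectralSingularity (p q : ℝ → ℂ) (lam : ℂ) : Prop :=
  lam ∈ opSpectrum (diracOp p q) ∧
  ∀ ε : ℝ, 0 < ε → ∃ γ : ℕ → ℝ → ℂ,
    (∀ n, IsContour (γ n) ∧ (∀ s ∈ Icc (0 : ℝ) 1, γ n s ∈ Metric.ball lam ε) ∧
      ∀ t ∈ Ioc (-1 : ℝ) 1, EnclosesAtMostOne p q t (γ n)) ∧
    Tendsto (fun n => ⨆ (t : ℝ) (_ : t ∈ Ioc (-1 : ℝ) 1)
        (_ : ∀ s ∈ Icc (0 : ℝ) 1, γ n s ∈ opResolventSet (blochOp p q t)),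
        ‖contourProjection p q t (γ n)‖ₑ) atTop (𝓝 (⊤ : ℝ≥0∞))

/-- `lam` is an essential spectral singularity of `L(Q)`: for some `t₀ ∈ (-1, 1]` we have
`lam = μ(t₀)` for a continuous branch `μ(t)` of eigenvalues of `L_t(Q)` near `t₀`, with normalized
eigenfunctions `Ψ_t` of `L_t(Q)` and `Ψ*_t` of the adjoint `L_t(Q)*`, such that `1/α`, where
`α(t) = (Ψ_t, Ψ*_t)`, is not integrable on any interval `(t₀ - ε, t₀ + ε)`. The modulus of `α(t)`
does not depend on the choice of the eigenfunctions if `μ(t)` is a simple eigenvalue;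
the integrability is that of the modulus `1/|α|`. -/
def IsEssentialSpectralSingularity (p q : ℝ → ℂ) (lam : ℂ) : Prop :=
  ∃ t₀ ∈ Ioc (-1 : ℝ) 1, ∃ (μ : ℝ → ℂ) (Ψ Ψs : ℝ → L2Period),
    μ t₀ = lam ∧
    (∃ δ > 0, ContinuousOn μ (Ioo (t₀ - δ) (t₀ + δ)) ∧
      ∀ t ∈ Ioo (t₀ - δ) (t₀ + δ),
        IsEigenvector (blochOp p q t) (μ t) (Ψ t) ∧ ‖Ψ t‖ = 1 ∧
        IsEigenvector ((blochOp p q t).adjoint) (starRingEnd ℂ (μ t)) (Ψs t) ∧ ‖Ψs t‖ = 1) ∧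
    ∀ ε > 0, ¬ IntegrableOn (fun t => 1 / ‖inner ℂ (Ψs t) (Ψ t)‖) (Ioo (t₀ - ε) (t₀ + ε))

end

/-!
Let `Δ` be the discriminant, the trace of the monodromy matrix of `l(y) = z y`; it is entire. The
monodromy matrix has determinant one, so the eigenvalues of `L_t(Q)` are the zeros of
`2 cos πt - Δ`, and the resolvent of `L_t(Q)` is `N_t / (2 cos πt - Δ)` with `N_t` entire. At a
simple zero its residue has norm `‖N_t‖ / |Δ'| = 1 / |α|`, and the spectral projection of a contour
around that zero is a multiple of this residue.

If `Δ'(λ) ≠ 0`, these norms stay bounded near `λ`, so that `λ` is not a spectral singularity; a zero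
of `2 cos πt - Δ` at which `Δ'` vanishes is a multiple eigenvalue. Along the branch of an essential
spectral singularity the norms are not integrable, hence unbounded, and small circles around the
eigenvalues of the branch show that `λ` is a spectral singularity; it belongs to the spectrum
because bounded Bloch solutions times slowly decaying cutoffs are approximate eigenvectors of
`L(Q)`. Finally, `Δ(λ(t)) = 2 cos πt` and Łojasiewicz' inequality for `Δ` bound `1 / |α(t)|` by a
constant times `|cos πt - cos πt₀| ^ (-r)` for some `r < 1`. If `sin πt₀ ≠ 0`, this is integrable;
hence `sin πt₀` vanishes at an essential spectral singularity, and `t₀` is `0` or `1`.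
-/

/-! ### Operators whose resolvent is a quotient of entire functions -/

section ResolventPencil

variable {H : Type*} [NormedAddCommGroup H] [InnerProductSpace ℂ H] {T : Submodule ℂ (H × H)}

theorem IsResolventAt.unique {z : ℂ} {R R' : H →L[ℂ] H} (h : IsResolventAt T z R)
    (h' : IsResolventAt T z R') : R = R' :=
  ContinuousLinearMap.ext fun g => (h _ g).2 ((h' _ g).1 rfl)

theorem IsResolventAt.opResolvent_eq {z : ℂ} {R : H →L[ℂ] H} (h : IsResolventAt T z R) :
    opResolvent T z = R := by
  have hex : ∃ R : H →L[ℂ] H, IsResolventAt T z R := ⟨R, h⟩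
  rw [opResolvent, dif_pos hex]
  exact hex.choose_spec.unique h

theorem IsEigenvalue.notMem_opResolventSet {z : ℂ} (h : IsEigenvalue T z) :
    z ∉ opResolventSet T := by
  rintro ⟨R, hR⟩
  obtain ⟨f, hf, hT⟩ := h
  have hRf : R 0 = f := (hR f 0).2 (by rwa [zero_add])
  exact hf (by rw [← hRf, map_zero])

theorem mem_rootKer_one {z : ℂ} {f : H} : f ∈ rootKer T z 1 ↔ (f, z • f) ∈ T := by
  change (∃ g ∈ (⊥ : Submodule ℂ H), (f, z • f + g) ∈ T) ↔ _
  simp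

theorem two_le_algMultiplicity {z : ℂ} {k : ℕ} {f g : H} (hf : f ∈ rootKer T z k)
    (hg : g ∈ rootKer T z k) (hfg : LinearIndependent ℂ ![f, g]) : 2 ≤ algMultiplicity T z := by
  have hle : Submodule.span ℂ (range ![f, g]) ≤ ⨆ k, rootKer T z k := by
    rw [Submodule.span_le, Matrix.range_cons, Matrix.range_cons, Matrix.range_empty, union_empty,
      singleton_union, Set.pair_subset_iff]
    exact ⟨le_iSup (rootKer T z) k hf, le_iSup (rootKer T z) k hg⟩
  have hrank : (2 : Cardinal) ≤ Module.rank ℂ ↥(⨆ k, rootKer T z k) := by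
    have hcard := Cardinal.mk_range_eq_of_injective hfg.injective
    rw [Cardinal.mk_fin, ← rank_span hfg, Cardinal.lift_natCast, Cardinal.lift_id'.{0}] at hcard
    exact_mod_cast hcard.symm.le.trans (Submodule.rank_mono hle)
  have htwo : Cardinal.toENat 2 ≤ algMultiplicity T z := Cardinal.toENat.monotone' hrank
  simpa using htwo

/-- The operator with graph `T` has the resolvent `(T - z)⁻¹ = N z / Δ z`, where `N` and `Δ` are
entire functions; the identities `(T - z) (N z) = Δ z` and `(N z) (T - z) = Δ z` also hold at the
zeros of `Δ`. -/
structure IsResolventPencil (T : Submodule ℂ (H × H)) (N : ℂ → H →L[ℂ] H) (Δ : ℂ → ℂ) : Prop where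
  differentiable_num : Differentiable ℂ N
  differentiable_den : Differentiable ℂ Δ
  right_inv : ∀ z g, (N z g, Δ z • g + z • N z g) ∈ T
  left_inv : ∀ z f h, (f, h) ∈ T → N z (h - z • f) = Δ z • f

namespace IsResolventPencil

variable {N : ℂ → H →L[ℂ] H} {Δ : ℂ → ℂ}

theorem isResolventAt (P : IsResolventPencil T N Δ) {z : ℂ} (hz : Δ z ≠ 0) :
    IsResolventAt T z ((Δ z)⁻¹ • N z) := by
  refine fun f g => ⟨?_, fun h => ?_⟩
  · rintro rfl
    have hmem := T.smul_mem (Δ z)⁻¹ (P.right_inv z g)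
    rwa [Prod.smul_mk, smul_add, inv_smul_smul₀ hz, smul_comm] at hmem
  · have hN := P.left_inv z _ _ h
    rw [add_sub_cancel_right] at hN
    rw [_root_.smul_apply, hN, inv_smul_smul₀ hz]

theorem den_eq_zero (P : IsResolventPencil T N Δ) {z : ℂ} (h : IsEigenvalue T z) : Δ z = 0 := by
  by_contra hz
  exact h.notMem_opResolventSet ⟨_, P.isResolventAt hz⟩

theorem mem_of_den_eq_zero (P : IsResolventPencil T N Δ) {z : ℂ} (hz : Δ z = 0) (g : H) :
    (N z g, z • N z g) ∈ T := by
  simpa only [hz, zero_smul, zero_add] using P.right_inv z g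

theorem hasDerivAt_num_apply (P : IsResolventPencil T N Δ) (z : ℂ) (g : H) :
    HasDerivAt (fun z => N z g) (deriv N z g) z :=
  (ContinuousLinearMap.apply ℂ H g).hasFDerivAt.comp_hasDerivAt z
    (P.differentiable_num z).hasDerivAt

theorem isClosed (P : IsResolventPencil T N Δ) {z : ℂ} (hz : Δ z ≠ 0) :
    IsClosed (T : Set (H × H)) := by
  have hT : (T : Set (H × H)) = {u | ((Δ z)⁻¹ • N z) (u.2 - z • u.1) = u.1} := by
    ext ⟨f, h⟩
    rw [Set.mem_ofPred_eq, P.isResolventAt hz f (h - z • f), sub_add_cancel, SetLike.mem_coe]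
  rw [hT]
  exact isClosed_eq (by fun_prop) (by fun_prop)

theorem num_apply_eigenvector (P : IsResolventPencil T N Δ) {z₀ : ℂ} {f : H}
    (hf : (f, z₀ • f) ∈ T) : N z₀ f = -deriv Δ z₀ • f := by
  have hleft : HasDerivAt (fun z => (z₀ - z) • N z f) (-N z₀ f) z₀ := by
    simpa using ((hasDerivAt_id z₀).const_sub z₀).fun_smul (P.hasDerivAt_num_apply z₀ f)
  have hright : HasDerivAt (fun z => Δ z • f) (deriv Δ z₀ • f) z₀ :=
    (P.differentiable_den z₀).hasDerivAt.smul_const f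
  have heq : (fun z => (z₀ - z) • N z f) = fun z => Δ z • f := by
    ext z
    rw [← P.left_inv z _ _ hf, ← sub_smul, map_smul]
  rw [heq] at hleft
  rw [neg_smul, hright.unique hleft, neg_neg]

theorem inner_num_apply (P : IsResolventPencil T N Δ) {z₀ : ℂ} {f : H}
    (hf : (f, starRingEnd ℂ z₀ • f) ∈ T.adjoint) (g : H) :
    inner ℂ f (N z₀ g) = -deriv Δ z₀ * inner ℂ f g := by
  have hN : HasDerivAt (fun z => inner ℂ f (N z g)) (inner ℂ f (deriv N z₀ g)) z₀ :=
    (innerSL ℂ f).hasFDerivAt.comp_hasDerivAt z₀ (P.hasDerivAt_num_apply z₀ g)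
  have hleft : HasDerivAt (fun z => (z₀ - z) * inner ℂ f (N z g)) (-inner ℂ f (N z₀ g)) z₀ := by
    simpa using ((hasDerivAt_id z₀).const_sub z₀).fun_mul hN
  have hright : HasDerivAt (fun z => Δ z * inner ℂ f g) (deriv Δ z₀ * inner ℂ f g) z₀ :=
    (P.differentiable_den z₀).hasDerivAt.mul_const _
  have heq : (fun z => (z₀ - z) * inner ℂ f (N z g)) = fun z => Δ z * inner ℂ f g := by
    ext z
    have hadj := (Submodule.mem_adjoint_iff _ _).1 hf _ _ (P.right_inv z g)
    have hconj := congrArg (starRingEnd ℂ) hadj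
    simp only [map_sub, map_mul, inner_conj_symm, inner_add_right, inner_smul_right, map_zero,
      Complex.conj_conj] at hconj
    linear_combination -hconj
  rw [heq] at hleft
  rw [neg_mul, hright.unique hleft, neg_neg]

theorem eq_zero_of_isSimpleZero_of_mem (P : IsResolventPencil T N Δ) {z₀ : ℂ} (h0 : Δ z₀ = 0)
    (h1 : deriv Δ z₀ ≠ 0) {f g : H} (hg : (g, z₀ • g) ∈ T) (hf : (f, z₀ • f + g) ∈ T) : g = 0 := by
  have hN := P.left_inv z₀ _ _ hf
  rw [add_sub_cancel_left, P.num_apply_eigenvector hg, h0, zero_smul, neg_smul, neg_eq_zero,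
    smul_eq_zero] at hN
  exact hN.resolve_left h1

theorem rootKer_le_rootKer_one (P : IsResolventPencil T N Δ) {z₀ : ℂ} (h0 : Δ z₀ = 0)
    (h1 : deriv Δ z₀ ≠ 0) (k : ℕ) : rootKer T z₀ k ≤ rootKer T z₀ 1 := by
  induction k with
  | zero => exact bot_le
  | succ k ih =>
    rintro f ⟨g, hg, hf⟩
    have hg0 := P.eq_zero_of_isSimpleZero_of_mem h0 h1 (mem_rootKer_one.1 (ih hg)) hf
    rw [hg0, add_zero] at hf
    exact mem_rootKer_one.2 hf

theorem algMultiplicity_le_one (P : IsResolventPencil T N Δ) {z₀ : ℂ} (h0 : Δ z₀ = 0)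
    (h1 : deriv Δ z₀ ≠ 0) {Ψ : H} (hker : rootKer T z₀ 1 ≤ Submodule.span ℂ {Ψ}) :
    algMultiplicity T z₀ ≤ 1 := by
  have hle : ⨆ k, rootKer T z₀ k ≤ Submodule.span ℂ {Ψ} :=
    iSup_le fun k => (P.rootKer_le_rootKer_one h0 h1 k).trans hker
  have hrank : Module.rank ℂ ↥(⨆ k, rootKer T z₀ k) ≤ 1 :=
    (Submodule.rank_mono hle).trans (by simpa using rank_span_le (R := ℂ) ({Ψ} : Set H))
  have hone : algMultiplicity T z₀ ≤ Cardinal.toENat 1 := Cardinal.toENat.monotone' hrank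
  simpa using hone

theorem algMultiplicity_eq_zero (P : IsResolventPencil T N Δ) {z₀ : ℂ} (h0 : Δ z₀ ≠ 0) :
    algMultiplicity T z₀ = 0 := by
  have hbot : ∀ k, rootKer T z₀ k = ⊥ := by
    intro k
    induction k with
    | zero => rfl
    | succ k ih =>
      refine (Submodule.eq_bot_iff _).2 ?_
      rintro f ⟨g, hg, hf⟩
      rw [ih, Submodule.mem_bot] at hg
      rw [hg, add_zero] at hf
      by_contra hne
      exact h0 (P.den_eq_zero ⟨f, hne, hf⟩)
  have hsup : ⨆ k, rootKer T z₀ k = ⊥ := by simp only [hbot, iSup_bot]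
  rw [algMultiplicity, hsup, rank_bot, map_zero]

/-- Differentiating `(T - z) (N z g) = Δ z • g` at a double zero of `Δ` shows that `N' z₀ g` is
associated with the eigenvector `N z₀ g`. -/
theorem deriv_num_mem_of_deriv_den_eq_zero (P : IsResolventPencil T N Δ) {z₀ z₁ : ℂ}
    (h1 : deriv Δ z₀ = 0) (hz₁ : Δ z₁ ≠ 0) (g : H) :
    (deriv N z₀ g, z₀ • deriv N z₀ g + N z₀ g) ∈ T := by
  have hN := P.hasDerivAt_num_apply z₀ g
  have hTN : HasDerivAt (fun z => Δ z • g + z • N z g) (z₀ • deriv N z₀ g + N z₀ g) z₀ := by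
    simpa [h1] using ((P.differentiable_den z₀).hasDerivAt.smul_const g).fun_add
      ((hasDerivAt_id z₀).fun_smul hN)
  refine (P.isClosed hz₁).mem_of_tendsto (hN.prodMk hTN).tendsto_slope
    (Eventually.of_forall fun z => ?_)
  rw [slope_def_module]
  exact T.smul_mem _ (T.sub_mem (P.right_inv z g) (P.right_inv z₀ g))

theorem isMultipleEigenvalue (P : IsResolventPencil T N Δ) {z₀ z₁ : ℂ} (h0 : Δ z₀ = 0)
    (h1 : deriv Δ z₀ = 0) (hz₁ : Δ z₁ ≠ 0) (hN : N z₀ ≠ 0) (hT₀ : ∀ h, (0, h) ∈ T → h = 0) :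
    IsMultipleEigenvalue T z₀ := by
  obtain ⟨g, hg⟩ : ∃ g, N z₀ g ≠ 0 := DFunLike.ne_iff.1 hN
  have hT := P.mem_of_den_eq_zero h0 g
  have hassoc := P.deriv_num_mem_of_deriv_den_eq_zero h1 hz₁ g
  refine ⟨⟨N z₀ g, hg, hT⟩, two_le_algMultiplicity (k := 2) (f := N z₀ g) (g := deriv N z₀ g)
    ⟨0, Submodule.zero_mem _, by rwa [add_zero]⟩ ⟨_, mem_rootKer_one.2 hT, hassoc⟩ ?_⟩
  rw [LinearIndependent.pair_iff' hg]
  intro a ha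
  have hdiff := T.sub_mem hassoc (T.smul_mem a hT)
  rw [← ha, Prod.smul_mk, Prod.mk_sub_mk, sub_self, smul_comm z₀ a, add_sub_cancel_left] at hdiff
  exact hg (hT₀ _ hdiff)

theorem inner_ne_zero (P : IsResolventPencil T N Δ) {z₀ : ℂ} (h0 : Δ z₀ = 0)
    (h1 : deriv Δ z₀ ≠ 0) {Ψ Ψs : H} (hΨs : (Ψs, starRingEnd ℂ z₀ • Ψs) ∈ T.adjoint)
    (hs : Ψs ≠ 0) (hker : rootKer T z₀ 1 ≤ Submodule.span ℂ {Ψ}) : inner ℂ Ψs Ψ ≠ 0 := by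
  intro h
  obtain ⟨c, hc⟩ := Submodule.mem_span_singleton.1
    (hker (mem_rootKer_one.2 (P.mem_of_den_eq_zero h0 Ψs)))
  have hinner := P.inner_num_apply hΨs Ψs
  rw [← hc, inner_smul_right, h, mul_zero, eq_comm, mul_eq_zero, neg_eq_zero,
    inner_self_eq_zero] at hinner
  exact hinner.elim h1 hs

theorem norm_num_apply_mul (P : IsResolventPencil T N Δ) {z₀ : ℂ} (h0 : Δ z₀ = 0) {Ψ Ψs : H}
    (hn : ‖Ψ‖ = 1) (hΨs : (Ψs, starRingEnd ℂ z₀ • Ψs) ∈ T.adjoint)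
    (hker : rootKer T z₀ 1 ≤ Submodule.span ℂ {Ψ}) (g : H) :
    ‖N z₀ g‖ * ‖inner ℂ Ψs Ψ‖ = ‖deriv Δ z₀‖ * ‖inner ℂ Ψs g‖ := by
  obtain ⟨c, hc⟩ := Submodule.mem_span_singleton.1
    (hker (mem_rootKer_one.2 (P.mem_of_den_eq_zero h0 g)))
  have hinner := congrArg norm (P.inner_num_apply hΨs g)
  rw [norm_mul, norm_neg, ← hc, inner_smul_right, norm_mul] at hinner
  rw [← hinner, ← hc, norm_smul, hn, mul_one]

theorem one_div_norm_inner_eq [CompleteSpace H] (P : IsResolventPencil T N Δ) {z₀ : ℂ}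
    (h0 : Δ z₀ = 0) (h1 : deriv Δ z₀ ≠ 0) {Ψ Ψs : H} (hn : ‖Ψ‖ = 1)
    (hΨs : (Ψs, starRingEnd ℂ z₀ • Ψs) ∈ T.adjoint) (hns : ‖Ψs‖ = 1)
    (hker : rootKer T z₀ 1 ≤ Submodule.span ℂ {Ψ}) :
    1 / ‖inner ℂ Ψs Ψ‖ = ‖N z₀‖ / ‖deriv Δ z₀‖ := by
  have hα : ‖inner ℂ Ψs Ψ‖ ≠ 0 := norm_ne_zero_iff.2
    (P.inner_ne_zero h0 h1 hΨs (norm_ne_zero_iff.1 (hns ▸ one_ne_zero)) hker)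
  have happly : ∀ g, ‖N z₀ g‖ = ‖deriv Δ z₀‖ / ‖inner ℂ Ψs Ψ‖ * ‖inner ℂ Ψs g‖ := fun g => by
    rw [div_mul_eq_mul_div, ← P.norm_num_apply_mul h0 hn hΨs hker g, mul_div_cancel_right₀ _ hα]
  have hnorm : ‖N z₀‖ = ‖deriv Δ z₀‖ / ‖inner ℂ Ψs Ψ‖ := by
    refine ContinuousLinearMap.opNorm_eq_of_bounds (by positivity) (fun g => ?_) fun C _ h => ?_
    · rw [happly]
      gcongr
      simpa only [hns, one_mul] using norm_inner_le_norm (𝕜 := ℂ) Ψs g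
    · have hC := h Ψs
      rw [happly, inner_self_eq_norm_sq_to_K, hns] at hC
      simpa using hC
  have hd := norm_ne_zero_iff.2 h1
  rw [hnorm]
  field_simp

end IsResolventPencil

end ResolventPencil

/-! ### Contour integrals -/

section Contours

namespace IsPiecewiseC1

variable {γ : ℝ → ℂ}

theorem exists_finset_differentiableAt (hγ : IsPiecewiseC1 γ) :
    ∃ S : Finset ℝ, ∀ s ∈ Ioo (0 : ℝ) 1, s ∉ S → DifferentiableAt ℝ γ s := by
  obtain ⟨S, hS⟩ := hγ
  refine ⟨S, fun s hs hsS => ?_⟩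
  have hnhds : Ioo (0 : ℝ) 1 ∩ (S : Set ℝ)ᶜ ∈ 𝓝 s :=
    inter_mem (isOpen_Ioo.mem_nhds hs) (S.finite_toSet.isClosed.isOpen_compl.mem_nhds hsS)
  obtain ⟨δ, hδ, hsub⟩ := Metric.nhds_basis_closedBall.mem_iff.1 hnhds
  rw [Real.closedBall_eq_Icc] at hsub
  have hl := (hsub (left_mem_Icc.2 (by linarith))).1
  have hr := (hsub (right_mem_Icc.2 (by linarith))).1
  have hC1 : ContDiffOn ℝ 1 γ (Icc (s - δ) (s + δ)) :=
    hS _ _ hl.1.le (by linarith) hr.2.le fun x hx hxI => (hsub (Ioo_subset_Icc_self hxI)).2 hx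
  exact (hC1.differentiableOn one_ne_zero).differentiableAt
    (Icc_mem_nhds (by linarith) (by linarith))

end IsPiecewiseC1

theorem integrableOn_deriv_Icc {γ : ℝ → ℂ} {a b : ℝ}
    (h : a < b → ContDiffOn ℝ 1 γ (Icc a b)) : IntegrableOn (deriv γ) (Icc a b) := by
  rcases lt_or_ge a b with hab | hba
  · have hint : IntegrableOn (derivWithin γ (Icc a b)) (Icc a b) :=
      ((h hab).continuousOn_derivWithin (uniqueDiffOn_Icc hab) le_rfl).integrableOn_compact
        isCompact_Icc
    rw [integrableOn_Icc_iff_integrableOn_Ioo] at hint ⊢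
    exact hint.congr_fun (fun x hx => derivWithin_of_mem_nhds (Icc_mem_nhds hx.1 hx.2))
      measurableSet_Ioo
  · rw [integrableOn_Icc_iff_integrableOn_Ioo, Ioo_eq_empty hba.not_gt]
    exact integrableOn_empty

namespace IsPiecewiseC1

variable {γ : ℝ → ℂ}

theorem integrableAtFilter_deriv (hγ : IsPiecewiseC1 γ) {x : ℝ} (hx : x ∈ Icc (0 : ℝ) 1) :
    IntegrableAtFilter (deriv γ) (𝓝[Icc 0 1] x) := by
  obtain ⟨S, hS⟩ := hγ
  have hnhds : ((S.erase x : Finset ℝ) : Set ℝ)ᶜ ∈ 𝓝 x :=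
    (S.erase x).finite_toSet.isClosed.isOpen_compl.mem_nhds (by simp)
  obtain ⟨δ, hδ, hsub⟩ := Metric.nhds_basis_ball.mem_iff.1 hnhds
  rw [Real.ball_eq_Ioo] at hsub
  have heq : ∀ s ∈ S, s ∈ Ioo (x - δ) (x + δ) → s = x := fun s hs hsI => by
    by_contra hne
    exact hsub hsI (by simpa [hne] using hs)
  have hleft : IntegrableOn (deriv γ) (Icc (max 0 (x - δ)) x) :=
    integrableOn_deriv_Icc fun h => hS _ _ (le_max_left _ _) h hx.2 fun s hs hsI =>
      hsI.2.ne (heq s hs ⟨(le_max_right _ _).trans_lt hsI.1, hsI.2.trans (by linarith)⟩)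
  have hright : IntegrableOn (deriv γ) (Icc x (min 1 (x + δ))) :=
    integrableOn_deriv_Icc fun h => hS _ _ hx.1 h (min_le_left _ _) fun s hs hsI =>
      hsI.1.ne' (heq s hs ⟨lt_trans (by linarith) hsI.1, hsI.2.trans_le (min_le_right _ _)⟩)
  refine ⟨_, ?_, hleft.union hright⟩
  filter_upwards [self_mem_nhdsWithin, mem_nhdsWithin_of_mem_nhds
    (Ioo_mem_nhds (by linarith : x - δ < x) (by linarith : x < x + δ))] with y hy hy'
  exact (le_total y x).imp (fun h => ⟨max_le hy.1 hy'.1.le, h⟩) fun h => ⟨h, le_min hy.2 hy'.2.le⟩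

theorem intervalIntegrable_deriv (hγ : IsPiecewiseC1 γ) :
    IntervalIntegrable (deriv γ) volume 0 1 := by
  rw [intervalIntegrable_iff_integrableOn_Icc_of_le zero_le_one]
  have hloc : LocallyIntegrableOn (deriv γ) (Icc 0 1) := fun _ hx => hγ.integrableAtFilter_deriv hx
  exact hloc.integrableOn_isCompact isCompact_Icc

variable {E : Type*} [NormedAddCommGroup E] [NormedSpace ℂ E]

theorem intervalIntegrable_deriv_smul (hγ : IsPiecewiseC1 γ) (hc : ContinuousOn γ (Icc 0 1))
    {U : Set ℂ} (hU : MapsTo γ (Icc 0 1) U) {f : ℂ → E} (hf : ContinuousOn f U) :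
    IntervalIntegrable (fun s => deriv γ s • f (γ s)) volume 0 1 := by
  refine hγ.intervalIntegrable_deriv.smul_continuousOn ?_
  rw [uIcc_of_le zero_le_one]
  exact hf.comp hc hU

theorem intervalIntegrable_deriv_div_sub (hγ : IsPiecewiseC1 γ) (hc : ContinuousOn γ (Icc 0 1))
    {z : ℂ} (hz : ∀ s ∈ Icc (0 : ℝ) 1, γ s ≠ z) :
    IntervalIntegrable (fun s => deriv γ s / (γ s - z)) volume 0 1 :=
  hγ.intervalIntegrable_deriv_smul hc (U := {z}ᶜ) hz (f := fun w => (w - z)⁻¹) <|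
    (continuousOn_id.sub continuousOn_const).inv₀ fun _ hw => sub_ne_zero.2 hw

variable [CompleteSpace E]

theorem integral_eq_zero (hγ : IsPiecewiseC1 γ) (hc : ContinuousOn γ (Icc 0 1))
    (hclosed : γ 0 = γ 1) {c : ℂ} {r : ℝ} (hball : MapsTo γ (Icc 0 1) (Metric.ball c r))
    {f : ℂ → E} (hf : DifferentiableOn ℂ f (Metric.ball c r)) :
    ∫ s in (0 : ℝ)..1, deriv γ s • f (γ s) = 0 := by
  obtain ⟨g, hg⟩ := hf.isExactOn_ball
  obtain ⟨S, hS⟩ := hγ.exists_finset_differentiableAt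
  have hgc : ContinuousOn g (Metric.ball c r) :=
    fun z hz => (hg z hz).continuousAt.continuousWithinAt
  rw [MeasureTheory.integral_eq_of_hasDerivAt_off_countable (fun s => g (γ s)) _
    S.finite_toSet.countable, hclosed, sub_self]
  · rw [uIcc_of_le zero_le_one]
    exact hgc.comp hc hball
  · rintro s ⟨hs, hsS⟩
    rw [min_eq_left zero_le_one, max_eq_right zero_le_one] at hs
    exact (hg _ (hball (Ioo_subset_Icc_self hs))).scomp s (hS s hs hsS).hasDerivAt
  · exact hγ.intervalIntegrable_deriv_smul hc hball hf.continuousOn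

theorem integral_sub_inv_smul (hγ : IsPiecewiseC1 γ) (hc : ContinuousOn γ (Icc 0 1))
    (hclosed : γ 0 = γ 1) {c : ℂ} {r : ℝ} (hball : MapsTo γ (Icc 0 1) (Metric.ball c r))
    {f : ℂ → E} (hf : DifferentiableOn ℂ f (Metric.ball c r)) {z : ℂ} (hz : z ∈ Metric.ball c r)
    (hzγ : ∀ s ∈ Icc (0 : ℝ) 1, γ s ≠ z) :
    ∫ s in (0 : ℝ)..1, deriv γ s • ((γ s - z)⁻¹ • f (γ s)) =
      (2 * Real.pi * Complex.I * windingNumber γ z) • f z := by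
  have hd : DifferentiableOn ℂ (dslope f z) (Metric.ball c r) :=
    (Complex.differentiableOn_dslope (Metric.isOpen_ball.mem_nhds hz)).2 hf
  have hinv := (hγ.intervalIntegrable_deriv_div_sub hc hzγ).smul_continuousOn
    (continuousOn_const (c := f z))
  have heq : ∀ s ∈ uIcc (0 : ℝ) 1, deriv γ s • ((γ s - z)⁻¹ • f (γ s)) =
      deriv γ s • dslope f z (γ s) + (deriv γ s / (γ s - z)) • f z := by
    intro s hs
    rw [uIcc_of_le zero_le_one] at hs
    rw [dslope_of_ne _ (hzγ s hs), slope_def_module, div_eq_mul_inv, mul_smul, ← smul_add,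
      ← smul_add, sub_add_cancel]
  rw [intervalIntegral.integral_congr heq, intervalIntegral.integral_add
    (hγ.intervalIntegrable_deriv_smul hc hball hd.continuousOn) hinv,
    hγ.integral_eq_zero hc hclosed hball hd, zero_add, intervalIntegral.integral_smul_const,
    windingNumber, mul_inv_cancel_left₀ Complex.two_pi_I_ne_zero]

end IsPiecewiseC1

namespace IsResolventPencil

variable {H : Type*} [NormedAddCommGroup H] [InnerProductSpace ℂ H] [CompleteSpace H]
  {T : Submodule ℂ (H × H)} {N : ℂ → H →L[ℂ] H} {Δ : ℂ → ℂ} {γ : ℝ → ℂ} {c : ℂ} {r : ℝ}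

theorem integral_opResolvent_eq_zero (P : IsResolventPencil T N Δ) (hγ : IsPiecewiseC1 γ)
    (hc : ContinuousOn γ (Icc 0 1)) (hclosed : γ 0 = γ 1)
    (hball : MapsTo γ (Icc 0 1) (Metric.ball c r)) (hΔ : ∀ z ∈ Metric.ball c r, Δ z ≠ 0) :
    ∫ s in (0 : ℝ)..1, deriv γ s • opResolvent T (γ s) = 0 := by
  rw [← hγ.integral_eq_zero hc hclosed hball ((P.differentiable_den.differentiableOn.inv hΔ).smul
    P.differentiable_num.differentiableOn)]
  refine intervalIntegral.integral_congr fun s hs => ?_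
  rw [uIcc_of_le zero_le_one] at hs
  rw [(P.isResolventAt (hΔ _ (hball hs))).opResolvent_eq]
  rfl

theorem integral_opResolvent (P : IsResolventPencil T N Δ) (hγ : IsPiecewiseC1 γ)
    (hc : ContinuousOn γ (Icc 0 1)) (hclosed : γ 0 = γ 1)
    (hball : MapsTo γ (Icc 0 1) (Metric.ball c r)) {z₀ : ℂ} (hz₀ : z₀ ∈ Metric.ball c r)
    (h0 : Δ z₀ = 0) (h1 : deriv Δ z₀ ≠ 0) (hΔ : ∀ z ∈ Metric.ball c r, Δ z = 0 → z = z₀)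
    (hz₀γ : ∀ s ∈ Icc (0 : ℝ) 1, γ s ≠ z₀) :
    ∫ s in (0 : ℝ)..1, deriv γ s • opResolvent T (γ s) =
      (2 * Real.pi * Complex.I * windingNumber γ z₀) • ((deriv Δ z₀)⁻¹ • N z₀) := by
  have hfactor : ∀ w, (w - z₀) * dslope Δ z₀ w = Δ w := fun w => by
    rw [← smul_eq_mul, sub_smul_dslope, h0, sub_zero]
  have hslope : ∀ w ∈ Metric.ball c r, dslope Δ z₀ w ≠ 0 := by
    intro w hw hdw
    have hwz : w = z₀ := hΔ w hw (by rw [← hfactor, hdw, mul_zero])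
    rw [hwz, dslope_same] at hdw
    exact h1 hdw
  have hdiff : DifferentiableOn ℂ (dslope Δ z₀) (Metric.ball c r) :=
    (Complex.differentiableOn_dslope (Metric.isOpen_ball.mem_nhds hz₀)).2
      P.differentiable_den.differentiableOn
  have hformula := hγ.integral_sub_inv_smul hc hclosed hball
    (f := fun w => (dslope Δ z₀ w)⁻¹ • N w)
    ((hdiff.inv hslope).smul P.differentiable_num.differentiableOn) hz₀ hz₀γ
  rw [dslope_same] at hformula
  rw [← hformula]
  refine intervalIntegral.integral_congr fun s hs => ?_
  rw [uIcc_of_le zero_le_one] at hs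
  have hne : Δ (γ s) ≠ 0 := mt (hΔ _ (hball hs)) (hz₀γ s hs)
  rw [(P.isResolventAt hne).opResolvent_eq, smul_smul (γ s - z₀)⁻¹, ← mul_inv, hfactor]

end IsResolventPencil

/-- The positively oriented circle with centre `c` and radius `r`, parametrized over `[0, 1]`. -/
noncomputable def circlePath (c : ℂ) (r : ℝ) (s : ℝ) : ℂ := circleMap c r (2 * Real.pi * s)

theorem hasDerivAt_circlePath (c : ℂ) (r s : ℝ) :
    HasDerivAt (circlePath c r)
      ((2 * Real.pi : ℝ) • deriv (circleMap c r) (2 * Real.pi * s)) s := by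
  have hmul : HasDerivAt (fun s => 2 * Real.pi * s) (2 * Real.pi) s := by
    simpa using (hasDerivAt_id s).const_mul (2 * Real.pi)
  exact (differentiable_circleMap c r (2 * Real.pi * s)).hasDerivAt.scomp s hmul

theorem integral_circlePath (c : ℂ) (r : ℝ) (f : ℂ → ℂ) :
    ∫ s in (0 : ℝ)..1, deriv (circlePath c r) s * f (circlePath c r s) = ∮ z in C(c, r), f z := by
  have h := intervalIntegral.smul_integral_comp_mul_left (a := 0) (b := 1)
    (fun θ => deriv (circleMap c r) θ • f (circleMap c r θ)) (2 * Real.pi)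
  rw [mul_zero, mul_one] at h
  rw [circleIntegral, ← h, ← intervalIntegral.integral_smul]
  congr 1
  ext s
  rw [(hasDerivAt_circlePath c r s).deriv, smul_eq_mul, circlePath, smul_mul_assoc]

theorem windingNumber_circlePath (c : ℂ) (r : ℝ) (z : ℂ) :
    windingNumber (circlePath c r) z =
      (2 * Real.pi * Complex.I)⁻¹ * ∮ w in C(c, r), (w - z)⁻¹ := by
  simp only [windingNumber, ← integral_circlePath, div_eq_mul_inv]

theorem windingNumber_circlePath_of_mem_ball {c z : ℂ} {r : ℝ} (hz : z ∈ Metric.ball c r) :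
    windingNumber (circlePath c r) z = 1 := by
  rw [windingNumber_circlePath, circleIntegral.integral_sub_inv_of_mem_ball hz,
    inv_mul_cancel₀ Complex.two_pi_I_ne_zero]

theorem windingNumber_circlePath_of_notMem_closedBall {c z : ℂ} {r : ℝ} (hr : 0 ≤ r)
    (hz : z ∉ Metric.closedBall c r) : windingNumber (circlePath c r) z = 0 := by
  have hd : DifferentiableOn ℂ (fun w => (w - z)⁻¹) (Metric.closedBall c r) :=
    (differentiableOn_id.sub_const z).inv fun w hw =>
      sub_ne_zero.2 (ne_of_mem_of_not_mem hw hz)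
  rw [windingNumber_circlePath, DiffContOnCl.circleIntegral_eq_zero hr
    (hd.mono Metric.closure_ball_subset_closedBall).diffContOnCl, mul_zero]

theorem circlePath_mem_sphere (c : ℂ) {r : ℝ} (hr : 0 ≤ r) (s : ℝ) :
    circlePath c r s ∈ Metric.sphere c r :=
  circleMap_mem_sphere c hr _

theorem image_circlePath (c : ℂ) {r : ℝ} (hr : 0 ≤ r) :
    circlePath c r '' Icc 0 1 = Metric.sphere c r := by
  refine Subset.antisymm (image_subset_iff.2 fun s _ => circlePath_mem_sphere c hr s) ?_
  rw [← abs_of_nonneg hr, ← image_circleMap_Ioc c r, abs_of_nonneg hr]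
  rintro _ ⟨θ, hθ, rfl⟩
  have hpi := Real.two_pi_pos
  refine ⟨θ / (2 * Real.pi), ⟨div_nonneg hθ.1.le hpi.le, (div_le_one hpi).2 hθ.2⟩, ?_⟩
  rw [circlePath, mul_div_cancel₀ _ hpi.ne']

theorem windingNumber_circlePath_eq_one_iff {c z : ℂ} {r : ℝ} (hr : 0 ≤ r)
    (hz : z ∉ Metric.sphere c r) : windingNumber (circlePath c r) z = 1 ↔ z ∈ Metric.ball c r := by
  refine ⟨fun h => ?_, windingNumber_circlePath_of_mem_ball⟩
  by_contra hball
  have hclosed : z ∉ Metric.closedBall c r := by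
    rw [← Metric.ball_union_sphere]
    exact fun h => h.elim hball hz
  exact zero_ne_one ((windingNumber_circlePath_of_notMem_closedBall hr hclosed).symm.trans h)

theorem injOn_circlePath (c : ℂ) {r : ℝ} (hr : r ≠ 0) : InjOn (circlePath c r) (Ico 0 1) := by
  have hpi := Real.two_pi_pos
  have hmem : ∀ s ∈ Ico (0 : ℝ) 1, 2 * Real.pi * s ∈ Ico 0 (2 * Real.pi) := fun s hs =>
    ⟨mul_nonneg hpi.le hs.1, mul_lt_of_lt_one_right hpi hs.2⟩
  intro s hs t ht h
  exact mul_left_cancel₀ hpi.ne' (injOn_circleMap_of_abs_sub_le' (a := 0) (b := 2 * Real.pi)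
    hr (by simp) (hmem s hs) (hmem t ht) h)

theorem isContour_circlePath (c : ℂ) {r : ℝ} (hr : 0 < r) : IsContour (circlePath c r) where
  continuousOn := fun s _ => (hasDerivAt_circlePath c r s).continuousAt.continuousWithinAt
  piecewiseC1 := ⟨∅, fun a b _ _ _ _ =>
    ((contDiff_circleMap c r).comp (contDiff_const.mul contDiff_id)).contDiffOn⟩
  closed := by simp [circlePath, circleMap]
  simple := injOn_circlePath c hr.ne'
  positive := by
    intro z hz
    rw [image_circlePath c hr.le] at hz
    by_cases hball : z ∈ Metric.ball c r
    · exact Or.inr (windingNumber_circlePath_of_mem_ball hball)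
    · refine Or.inl (windingNumber_circlePath_of_notMem_closedBall hr.le fun h => ?_)
      rw [← Metric.ball_union_sphere] at h
      exact h.elim hball hz

theorem Encloses.mem_ball {c z : ℂ} {r : ℝ} (hr : 0 ≤ r) (h : Encloses (circlePath c r) z) :
    z ∈ Metric.ball c r :=
  (windingNumber_circlePath_eq_one_iff hr (image_circlePath c hr ▸ h.1)).1 h.2

end Contours

/-! ### The Volterra operator -/

section Volterra

/-- The space `L₂([a, b]; E)`. -/
abbrev L2Icc (a b : ℝ) (E : Type*) [NormedAddCommGroup E] : Type _ :=
  Lp E 2 (volume.restrict (Icc a b))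

/-- The space `L_∞([a, b]; End E)` of bounded operator-valued coefficients. -/
abbrev LInftyEnd (a b : ℝ) (E : Type*) [NormedAddCommGroup E] [NormedSpace ℂ E] : Type _ :=
  Lp (E →L[ℂ] E) ∞ (volume.restrict (Icc a b))

variable {a b : ℝ} {E : Type*} [NormedAddCommGroup E]

theorem integrableOn_Icc_of_memLp_two {f : ℝ → E} (hf : MemLp f 2 (volume.restrict (Icc a b))) :
    IntegrableOn f (Icc a b) :=
  hf.integrable one_le_two

theorem integrableOn_coeFn (f : L2Icc a b E) : IntegrableOn f (Icc a b) :=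
  integrableOn_Icc_of_memLp_two (Lp.memLp f)

theorem Ioc_subset_Icc_of_mem {x : ℝ} (hx : x ∈ Icc a b) : Ioc a x ⊆ Icc a b :=
  Ioc_subset_Icc_self.trans (Icc_subset_Icc_right hx.2)

theorem intervalIntegrable_of_mem_Icc {f : ℝ → E} (hf : IntegrableOn f (Icc a b)) {x : ℝ}
    (hx : x ∈ Icc a b) : IntervalIntegrable f volume a x :=
  (intervalIntegrable_iff_integrableOn_Ioc_of_le hx.1).2 (hf.mono_set (Ioc_subset_Icc_of_mem hx))

theorem integral_norm_le_norm (f : L2Icc a b E) :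
    ∫ x in Icc a b, ‖f x‖ ≤ √(volume.real (Icc a b)) * ‖f‖ := by
  have h := eLpNorm_le_eLpNorm_mul_rpow_measure_univ (one_le_two (α := ℝ≥0∞))
    (Lp.aestronglyMeasurable f)
  rw [eLpNorm_one_eq_lintegral_enorm, Measure.restrict_apply_univ] at h
  rw [integral_norm_eq_lintegral_enorm (Lp.aestronglyMeasurable f), mul_comm, Lp.norm_def,
    Real.sqrt_eq_rpow, measureReal_def, ENNReal.toReal_rpow, ← ENNReal.toReal_mul]
  convert ENNReal.toReal_mono (ENNReal.mul_ne_top (Lp.eLpNorm_ne_top f)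
    (ENNReal.rpow_ne_top_of_nonneg (by norm_num) measure_Icc_lt_top.ne)) h using 4
  norm_num

theorem norm_le_sqrt_mul_of_ae_le {f : L2Icc a b E} {C : ℝ} (hC : 0 ≤ C)
    (h : ∀ᵐ x ∂volume.restrict (Icc a b), ‖f x‖ ≤ C) : ‖f‖ ≤ √(volume.real (Icc a b)) * C := by
  convert Lp.norm_le_of_ae_bound hC h using 2
  simp [measureUnivNNReal, Real.sqrt_eq_rpow, ENNReal.coe_toNNReal_eq_toReal, measureReal_def]

theorem ae_norm_le_norm_top {α : Type*} [MeasurableSpace α] {μ : Measure α} (A : Lp E ∞ μ) :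
    ∀ᵐ x ∂μ, ‖A x‖ ≤ ‖A‖ := by
  filter_upwards [ae_le_eLpNormEssSup (f := A) (μ := μ)] with x hx
  rw [Lp.norm_def, eLpNorm_exponent_top, ← toReal_enorm]
  exact ENNReal.toReal_mono (eLpNorm_exponent_top (f := A) ▸ Lp.eLpNorm_ne_top A) hx

theorem memLp_of_continuousOn_Icc {y : ℝ → E} (hy : ContinuousOn y (Icc a b)) (r : ℝ≥0∞) :
    MemLp y r (volume.restrict (Icc a b)) := by
  obtain ⟨C, hC⟩ := isCompact_Icc.exists_bound_of_continuousOn hy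
  exact MemLp.of_bound (hy.aestronglyMeasurable measurableSet_Icc) C
    (ae_restrict_of_forall_mem measurableSet_Icc hC)

variable [NormedSpace ℂ E]

theorem norm_intervalIntegral_le_setIntegral_norm {f : ℝ → E} (hf : IntegrableOn f (Icc a b))
    {x : ℝ} (hx : x ∈ Icc a b) : ‖∫ s in a..x, f s‖ ≤ ∫ s in Icc a b, ‖f s‖ := by
  refine (intervalIntegral.norm_integral_le_integral_norm hx.1).trans ?_
  rw [intervalIntegral.integral_of_le hx.1]
  exact setIntegral_mono_set hf.norm (Eventually.of_forall fun _ => norm_nonneg _)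
    (Ioc_subset_Icc_of_mem hx).eventuallyLE

theorem continuousOn_intervalIntegral {f : ℝ → E} (hf : IntegrableOn f (Icc a b)) :
    ContinuousOn (fun x => ∫ s in a..x, f s) (Icc a b) := by
  rcases le_total a b with hab | hba
  · rw [← uIcc_of_le hab] at hf ⊢
    exact intervalIntegral.continuousOn_primitive_interval hf
  · exact (subsingleton_Icc_of_ge hba).continuousOn _

theorem memLp_intervalIntegral (f : L2Icc a b E) :
    MemLp (fun x => ∫ s in a..x, f s) 2 (volume.restrict (Icc a b)) :=
  memLp_of_continuousOn_Icc (continuousOn_intervalIntegral (integrableOn_coeFn f)) 2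

theorem intervalIntegral_congr_ae_Icc {f g : ℝ → E} (h : f =ᵐ[volume.restrict (Icc a b)] g)
    {x : ℝ} (hx : x ∈ Icc a b) : ∫ s in a..x, f s = ∫ s in a..x, g s := by
  rw [intervalIntegral.integral_of_le hx.1, intervalIntegral.integral_of_le hx.1]
  exact integral_congr_ae (ae_restrict_of_ae_restrict_of_subset (Ioc_subset_Icc_of_mem hx) h)

variable (a b E) in
/-- The Volterra operator `(W f)(x) = ∫ₐˣ f` on `L₂([a, b]; E)`. -/
noncomputable def volterra : L2Icc a b E →L[ℂ] L2Icc a b E :=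
  LinearMap.mkContinuous
    { toFun := fun f => (memLp_intervalIntegral f).toLp
      map_add' := fun f g => by
        rw [← MemLp.toLp_add (memLp_intervalIntegral f) (memLp_intervalIntegral g)]
        refine MemLp.toLp_congr _ _ (ae_restrict_of_forall_mem measurableSet_Icc fun x hx => ?_)
        refine (intervalIntegral_congr_ae_Icc (Lp.coeFn_add f g) hx).trans ?_
        exact intervalIntegral.integral_add
          (intervalIntegrable_of_mem_Icc (integrableOn_coeFn f) hx)
          (intervalIntegrable_of_mem_Icc (integrableOn_coeFn g) hx)
      map_smul' := fun c f => by
        rw [RingHom.id_apply, ← MemLp.toLp_const_smul c (memLp_intervalIntegral f)]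
        refine MemLp.toLp_congr _ _ (ae_restrict_of_forall_mem measurableSet_Icc fun x hx => ?_)
        refine (intervalIntegral_congr_ae_Icc (Lp.coeFn_smul c f) hx).trans ?_
        exact intervalIntegral.integral_smul c _ }
    (volume.real (Icc a b)) fun f => by
      have h : ∀ᵐ x ∂volume.restrict (Icc a b),
          ‖(memLp_intervalIntegral f).toLp _ x‖ ≤ √(volume.real (Icc a b)) * ‖f‖ := by
        filter_upwards [(memLp_intervalIntegral f).coeFn_toLp, ae_restrict_mem measurableSet_Icc]
          with x hx hxI
        rw [hx]
        exact (norm_intervalIntegral_le_setIntegral_norm (integrableOn_coeFn f) hxI).trans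
          (integral_norm_le_norm f)
      refine (norm_le_sqrt_mul_of_ae_le (by positivity) h).trans_eq ?_
      rw [← mul_assoc, Real.mul_self_sqrt measureReal_nonneg]

theorem coeFn_volterra (f : L2Icc a b E) :
    volterra a b E f =ᵐ[volume.restrict (Icc a b)] fun x => ∫ s in a..x, f s :=
  (memLp_intervalIntegral f).coeFn_toLp

theorem volterra_injective [CompleteSpace E] (hab : a < b) :
    Function.Injective (volterra a b E) := by
  rw [injective_iff_map_eq_zero]
  intro f hf
  have hzero : ∀ x ∈ Icc a b, ∫ s in a..x, f s = 0 := by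
    have hae : (fun x => ∫ s in a..x, f s) =ᵐ[volume.restrict (Icc a b)] fun _ => (0 : E) := by
      filter_upwards [coeFn_volterra f, Lp.coeFn_zero E 2 (volume.restrict (Icc a b))]
        with x h1 h2
      rw [← h1, hf, h2, Pi.zero_apply]
    exact Measure.eqOn_Icc_of_ae_eq volume hab.ne hae
      (continuousOn_intervalIntegral (integrableOn_coeFn f)) continuousOn_const
  rw [Lp.eq_zero_iff_ae_eq_zero]
  have hderiv := (intervalIntegrable_of_mem_Icc (integrableOn_coeFn f)
    (right_mem_Icc.2 hab.le)).ae_hasDerivAt_integral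
  have hIoo : ∀ᵐ x ∂volume.restrict (Icc a b), x ∈ Ioo a b := by
    rw [← Measure.restrict_congr_set Ioo_ae_eq_Icc]
    exact ae_restrict_mem measurableSet_Ioo
  filter_upwards [ae_restrict_of_ae hderiv, hIoo] with x hx hxI
  rw [uIcc_of_le hab.le] at hx
  refine (hx (Ioo_subset_Icc_self hxI) a (left_mem_Icc.2 hab.le)).unique
    ((hasDerivAt_const x (0 : E)).congr_of_eventuallyEq ?_)
  filter_upwards [isOpen_Ioo.mem_nhds hxI] with y hy
  exact hzero y (Ioo_subset_Icc_self hy)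

variable (a b E) in
/-- The functional `f ↦ ∫ₐᵇ f` on `L₂([a, b]; E)`. -/
noncomputable def integralIcc [CompleteSpace E] : L2Icc a b E →L[ℂ] E :=
  (ContinuousLinearMap.lsmul ℂ ℂ).lpPairing (volume.restrict (Icc a b)) 2 2 (Lp.const 2 _ 1)

theorem integralIcc_apply [CompleteSpace E] (f : L2Icc a b E) :
    integralIcc a b E f = ∫ x in Icc a b, f x := by
  rw [integralIcc, ContinuousLinearMap.lpPairing_eq_integral]
  refine integral_congr_ae ?_
  filter_upwards [Lp.coeFn_const 2 (volume.restrict (Icc a b)) (1 : ℂ)] with x hx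
  rw [hx, Function.const_apply, ContinuousLinearMap.lsmul_apply, one_smul]

variable (a b E) in
/-- The embedding of `E` into `L₂([a, b]; E)` as constant functions. -/
noncomputable def constIcc : E →L[ℂ] L2Icc a b E :=
  Lp.constL 2 (volume.restrict (Icc a b)) ℂ

theorem coeFn_constIcc (c : E) : constIcc a b E c =ᵐ[volume.restrict (Icc a b)] fun _ => c :=
  Lp.coeFn_const ..

theorem constIcc_injective (hab : a < b) : Function.Injective (constIcc a b E) := by
  intro c d h
  have hae : (fun _ : ℝ => c) =ᵐ[volume.restrict (Icc a b)] fun _ => d := by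
    filter_upwards [coeFn_constIcc (a := a) (b := b) c, coeFn_constIcc (a := a) (b := b) d]
      with x hc hd
    rw [← hc, ← hd, h]
  exact Measure.eqOn_Icc_of_ae_eq volume hab.ne hae continuousOn_const continuousOn_const
    (left_mem_Icc.2 hab.le)

variable (a b E) in
/-- The operator `f ↦ A f` of pointwise application of a bounded coefficient `A`. -/
noncomputable def mulOp : LInftyEnd a b E →L[ℂ] L2Icc a b E →L[ℂ] L2Icc a b E :=
  (ContinuousLinearMap.id ℂ (E →L[ℂ] E)).holderL (volume.restrict (Icc a b)) ∞ 2 2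

theorem coeFn_mulOp (A : LInftyEnd a b E) (f : L2Icc a b E) :
    mulOp a b E A f =ᵐ[volume.restrict (Icc a b)] fun x => A x (f x) :=
  (ContinuousLinearMap.id ℂ (E →L[ℂ] E)).coeFn_holder A f

theorem ae_norm_volterra_mulOp_le (A : LInftyEnd a b E) {f : L2Icc a b E} {β : ℝ → ℝ}
    (hfβ : ∀ᵐ x ∂volume.restrict (Icc a b), ‖f x‖ ≤ β x) (hβ : IntegrableOn β (Icc a b)) :
    ∀ᵐ x ∂volume.restrict (Icc a b),
      ‖volterra a b E (mulOp a b E A f) x‖ ≤ ‖A‖ * ∫ s in a..x, β s := by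
  filter_upwards [coeFn_volterra (mulOp a b E A f), ae_restrict_mem measurableSet_Icc] with x hx hxI
  have hsub := Ioc_subset_Icc_of_mem hxI
  rw [hx, ← intervalIntegral.integral_const_mul]
  refine (intervalIntegral.norm_integral_le_integral_norm hxI.1).trans ?_
  rw [intervalIntegral.integral_of_le hxI.1, intervalIntegral.integral_of_le hxI.1]
  refine integral_mono_ae ((integrableOn_coeFn _).mono_set hsub).norm
    ((hβ.mono_set hsub).const_mul _) (ae_restrict_of_ae_restrict_of_subset hsub ?_)
  filter_upwards [coeFn_mulOp A f, hfβ, ae_norm_le_norm_top A] with s hs hfs hAs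
  rw [hs]
  exact (ContinuousLinearMap.le_opNorm _ _).trans
    (mul_le_mul hAs hfs (norm_nonneg _) (norm_nonneg _))

theorem ae_norm_volterra_mulOp_pow_le (A : LInftyEnd a b E) (f : L2Icc a b E) (n : ℕ) :
    ∀ᵐ x ∂volume.restrict (Icc a b), ‖((volterra a b E ∘L mulOp a b E A) ^ (n + 1)) f x‖ ≤
      ‖A‖ ^ (n + 1) * (√(volume.real (Icc a b)) * ‖f‖) * ((x - a) ^ n / n.factorial) := by
  induction n with
  | zero =>
    filter_upwards [ae_norm_volterra_mulOp_le A (Eventually.of_forall fun x => le_refl ‖f x‖)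
      (integrableOn_coeFn f).norm, ae_restrict_mem measurableSet_Icc] with x hx hxI
    have hmono : ∫ s in a..x, ‖f s‖ ≤ √(volume.real (Icc a b)) * ‖f‖ := by
      rw [intervalIntegral.integral_of_le hxI.1]
      exact (setIntegral_mono_set (integrableOn_coeFn f).norm
        (Eventually.of_forall fun _ => norm_nonneg _)
        (Ioc_subset_Icc_of_mem hxI).eventuallyLE).trans (integral_norm_le_norm f)
    simpa using hx.trans (mul_le_mul_of_nonneg_left hmono (norm_nonneg A))
  | succ n ih =>
    filter_upwards [ae_norm_volterra_mulOp_le A ih (Continuous.integrableOn_Icc (by fun_prop))]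
      with x hx
    rw [pow_succ', mul_apply_eq_comp]
    refine hx.trans_eq ?_
    rw [intervalIntegral.integral_const_mul, intervalIntegral.integral_div,
      intervalIntegral.integral_comp_sub_right fun s => s ^ n, integral_pow, Nat.factorial_succ]
    have : (n : ℝ) + 1 ≠ 0 := by positivity
    push_cast
    field_simp
    ring

theorem norm_volterra_mulOp_pow_le (A : LInftyEnd a b E) (n : ℕ) :
    ‖(volterra a b E ∘L mulOp a b E A) ^ (n + 1)‖ ≤ ‖A‖ * volume.real (Icc a b) *
      ((‖A‖ * volume.real (Icc a b)) ^ n / n.factorial) := by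
  refine ContinuousLinearMap.opNorm_le_bound _ (by positivity) fun f => ?_
  have hbound : ∀ᵐ x ∂volume.restrict (Icc a b),
      ‖((volterra a b E ∘L mulOp a b E A) ^ (n + 1)) f x‖ ≤
        ‖A‖ ^ (n + 1) * (√(volume.real (Icc a b)) * ‖f‖) *
          (volume.real (Icc a b) ^ n / n.factorial) := by
    filter_upwards [ae_norm_volterra_mulOp_pow_le A f n, ae_restrict_mem measurableSet_Icc]
      with x hx hxI
    have hx0 : 0 ≤ x - a := sub_nonneg.2 hxI.1
    refine hx.trans ?_
    rw [Real.volume_real_Icc_of_le (hxI.1.trans hxI.2)]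
    gcongr
    exact hxI.2
  refine (norm_le_sqrt_mul_of_ae_le (by positivity) hbound).trans_eq ?_
  linear_combination (‖A‖ ^ (n + 1) * ‖f‖ * (volume.real (Icc a b) ^ n / n.factorial)) *
    Real.mul_self_sqrt (measureReal_nonneg (μ := volume) (s := Icc a b))

theorem isUnit_one_sub_volterra_mulOp [CompleteSpace E] (A : LInftyEnd a b E) :
    IsUnit (1 - volterra a b E ∘L mulOp a b E A) := by
  set L := volterra a b E ∘L mulOp a b E A
  set C := ‖A‖ * volume.real (Icc a b)
  have hlim : Tendsto (fun n : ℕ => C * (C ^ n / n.factorial)) atTop (𝓝 0) := by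
    simpa using (FloorSemiring.tendsto_pow_div_factorial_atTop C).const_mul C
  obtain ⟨n, hn⟩ := (hlim.eventually_lt_const zero_lt_one).exists
  have hunit : IsUnit (1 - L ^ (n + 1)) :=
    isUnit_one_sub_of_norm_lt_one ((norm_volterra_mulOp_pow_le A n).trans_lt hn)
  have hcomm : Commute (1 - L) (∑ i ∈ Finset.range (n + 1), L ^ i) :=
    (mul_neg_geom_sum L (n + 1)).trans (geom_sum_mul_neg L (n + 1)).symm
  rw [← mul_neg_geom_sum] at hunit
  exact (hcomm.isUnit_mul_iff.1 hunit).1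

end Volterra

/-! ### First order systems -/

section FirstOrderSystem

variable {a b : ℝ} {E : Type*} [NormedAddCommGroup E] [NormedSpace ℂ E]
  (A B : LInftyEnd a b E)

/-- The coefficient operator `f ↦ (A - z B) f` of the system `y' = (A - z B) y`. -/
noncomputable def coeffOp (z : ℂ) : L2Icc a b E →L[ℂ] L2Icc a b E :=
  mulOp a b E A - z • mulOp a b E B

theorem differentiable_coeffOp : Differentiable ℂ (coeffOp A B) := by
  unfold coeffOp
  fun_prop

variable [CompleteSpace E]

/-- The operator `g ↦ f` solving the Volterra equation `f = g + ∫ₐˣ (A - z B) f`. -/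
noncomputable def solutionOp (z : ℂ) : L2Icc a b E →L[ℂ] L2Icc a b E :=
  Ring.inverse (1 - volterra a b E ∘L coeffOp A B z)

theorem isUnit_one_sub_volterra_coeffOp (z : ℂ) :
    IsUnit (1 - volterra a b E ∘L coeffOp A B z) := by
  rw [coeffOp, ← map_smul, ← map_sub]
  exact isUnit_one_sub_volterra_mulOp (A - z • B)

theorem eq_solutionOp_iff {z : ℂ} {f g : L2Icc a b E} :
    f = solutionOp A B z g ↔ f = g + volterra a b E (coeffOp A B z f) := by
  have hunit := isUnit_one_sub_volterra_coeffOp A B z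
  constructor
  · rintro rfl
    exact sub_eq_iff_eq_add.1 (DFunLike.congr_fun (Ring.mul_inverse_cancel _ hunit) g)
  · intro h
    have hf : f = solutionOp A B z ((1 - volterra a b E ∘L coeffOp A B z) f) :=
      (DFunLike.congr_fun (Ring.inverse_mul_cancel _ hunit) f).symm
    rwa [show (1 - volterra a b E ∘L coeffOp A B z) f = g from sub_eq_iff_eq_add.2 h] at hf

/-- The monodromy operator `y(a) ↦ y(b)` of the system `y' = (A - z B) y`. -/
noncomputable def monodromy (z : ℂ) : E →L[ℂ] E :=
  1 + integralIcc a b E ∘L coeffOp A B z ∘L solutionOp A B z ∘L constIcc a b E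

/-- The operator `g ↦ -y(b)`, where `y' = (A - z B) y - B g` and `y(a) = 0`. -/
noncomputable def inhomBoundary (z : ℂ) : L2Icc a b E →L[ℂ] E :=
  integralIcc a b E ∘L
    (coeffOp A B z ∘L solutionOp A B z ∘L volterra a b E ∘L mulOp a b E B + mulOp a b E B)

theorem differentiable_solutionOp : Differentiable ℂ (solutionOp A B) := by
  have hcoeff := differentiable_coeffOp A B
  have hdiff : Differentiable ℂ fun z => 1 - volterra a b E ∘L coeffOp A B z := by fun_prop
  exact fun z => (hdiff z).inverse (isUnit_one_sub_volterra_coeffOp A B z)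

theorem differentiable_monodromy : Differentiable ℂ (monodromy A B) := by
  have h1 := differentiable_coeffOp A B
  have h2 := differentiable_solutionOp A B
  unfold monodromy
  fun_prop

theorem differentiable_inhomBoundary : Differentiable ℂ (inhomBoundary A B) := by
  have h1 := differentiable_coeffOp A B
  have h2 := differentiable_solutionOp A B
  unfold inhomBoundary
  fun_prop

/-- The integrated form of the problem `f' = A f - B h`, `f(a) = c`, `f(b) = w f(a)`. -/
def IsQuasiPeriodicSolution (w : ℂ) (c : E) (f h : L2Icc a b E) : Prop :=
  f = constIcc a b E c + volterra a b E (mulOp a b E A f - mulOp a b E B h) ∧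
    integralIcc a b E (mulOp a b E A f - mulOp a b E B h) = (w - 1) • c

theorem isQuasiPeriodicSolution_smul_add_iff {w z : ℂ} {c : E} {f g : L2Icc a b E} :
    IsQuasiPeriodicSolution A B w c f (z • f + g) ↔
      f = solutionOp A B z (constIcc a b E c - volterra a b E (mulOp a b E B g)) ∧
        monodromy A B z c - w • c = inhomBoundary A B z g := by
  have hderiv : mulOp a b E A f - mulOp a b E B (z • f + g) =
      coeffOp A B z f - mulOp a b E B g := by
    simp only [coeffOp, map_add, map_smul, _root_.sub_apply, _root_.smul_apply]
    abel
  rw [IsQuasiPeriodicSolution, hderiv, eq_solutionOp_iff, map_sub (volterra a b E),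
    add_sub_left_comm, add_comm (volterra a b E _)]
  refine and_congr_right fun hf => ?_
  have hbdry : integralIcc a b E (coeffOp A B z f - mulOp a b E B g) =
      monodromy A B z c - c - inhomBoundary A B z g := by
    conv_lhs => rw [(eq_solutionOp_iff A B).2 hf]
    simp only [monodromy, inhomBoundary, map_sub, _root_.add_apply, map_add,
      ContinuousLinearMap.comp_apply, one_apply_eq_self]
    abel
  rw [hbdry, sub_smul, one_smul, sub_right_comm, sub_left_inj, sub_eq_iff_eq_add, sub_eq_iff_eq_add,
    add_comm]

theorem isQuasiPeriodicSolution_smul_iff {w z : ℂ} {c : E} {f : L2Icc a b E} :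
    IsQuasiPeriodicSolution A B w c f (z • f) ↔
      f = solutionOp A B z (constIcc a b E c) ∧ monodromy A B z c = w • c := by
  simpa [sub_eq_zero] using isQuasiPeriodicSolution_smul_add_iff A B (w := w) (z := z) (c := c)
    (f := f) (g := 0)

theorem solutionOp_injective (z : ℂ) : Function.Injective (solutionOp A B z) := fun f g h => by
  have hf := (eq_solutionOp_iff A B).1 (rfl : solutionOp A B z f = _)
  have hg := (eq_solutionOp_iff A B).1 (rfl : solutionOp A B z g = _)
  rw [h] at hf
  exact add_right_cancel (hf.symm.trans hg)

theorem inhomBoundary_surjective (hab : a < b) (hB : Function.Surjective (mulOp a b E B)) (z : ℂ) :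
    Function.Surjective (inhomBoundary A B z) := by
  intro e
  -- `f(x) = -(x - a) e / (b - a)` runs from `0` to `-e`; choose `g` so that it solves the system.
  let v := constIcc a b E (-(b - a : ℝ)⁻¹ • e)
  let f := volterra a b E v
  obtain ⟨g, hg⟩ := hB (coeffOp A B z f - v)
  have hf : f = solutionOp A B z (-volterra a b E (mulOp a b E B g)) := by
    rw [eq_solutionOp_iff, hg, map_sub]
    abel
  have hv : integralIcc a b E v = -e := by
    rw [integralIcc_apply, integral_congr_ae (coeFn_constIcc _), setIntegral_const,
      Real.volume_real_Icc_of_le hab.le, neg_smul, smul_neg, smul_inv_smul₀ (sub_pos.2 hab).ne']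
  refine ⟨g, ?_⟩
  rw [map_neg, eq_neg_iff_add_eq_zero] at hf
  simp only [inhomBoundary, ContinuousLinearMap.comp_apply, _root_.add_apply]
  rw [eq_neg_of_add_eq_zero_right hf, hg, map_neg, neg_add_eq_sub, sub_sub_cancel_left, map_neg, hv,
    neg_neg]

theorem eq_zero_of_isQuasiPeriodicSolution_zero (hab : a < b)
    (hB : Function.Injective (mulOp a b E B)) {w : ℂ} {c : E} {h : L2Icc a b E}
    (hh : IsQuasiPeriodicSolution A B w c 0 h) : h = 0 := by
  obtain ⟨hf, -⟩ := hh
  set v := mulOp a b E A 0 - mulOp a b E B h with hv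
  have hae : (fun x => c + ∫ s in a..x, v s) =ᵐ[volume.restrict (Icc a b)] fun _ => (0 : E) := by
    filter_upwards [Lp.coeFn_add (constIcc a b E c) (volterra a b E v),
      coeFn_constIcc (a := a) (b := b) c, coeFn_volterra v,
      Lp.coeFn_zero E 2 (volume.restrict (Icc a b))] with x h1 h2 h3 h4
    rw [← h2, ← h3, ← Pi.add_apply, ← h1, ← hf, h4, Pi.zero_apply]
  have hc : c = 0 := by
    simpa using Measure.eqOn_Icc_of_ae_eq volume hab.ne hae
      (continuousOn_const.add (continuousOn_intervalIntegral (integrableOn_coeFn v)))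
      continuousOn_const (left_mem_Icc.2 hab.le)
  rw [hc, map_zero, zero_add, ← map_zero (volterra a b E)] at hf
  have hv0 := volterra_injective hab hf
  rw [hv, map_zero, zero_sub, zero_eq_neg] at hv0
  exact hB (hv0.trans (map_zero _).symm)

end FirstOrderSystem

section QuasiPeriodicPencil

variable {a b : ℝ} {ι : Type*} [Fintype ι] [DecidableEq ι]
  (A B : LInftyEnd a b (EuclideanSpace ℂ ι))

/-- The matrix `M(z) - w`, where `M(z)` is the monodromy matrix of the system `y' = (A - z B) y`. -/
noncomputable def monodromySub (w z : ℂ) : Matrix ι ι ℂ :=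
  (Matrix.toEuclideanCLM (𝕜 := ℂ)).symm (monodromy A B z - w • 1)

/-- The numerator of the resolvent of the problem `y' = A y - B h`, `y(b) = w y(a)`, whose
denominator is `det (M(z) - w)`. -/
noncomputable def quasiPeriodicNum (w z : ℂ) :
    L2Icc a b (EuclideanSpace ℂ ι) →L[ℂ] L2Icc a b (EuclideanSpace ℂ ι) :=
  solutionOp A B z ∘L
    (constIcc a b _ ∘L Matrix.toEuclideanCLM (𝕜 := ℂ) (monodromySub A B w z).adjugate ∘L
        inhomBoundary A B z -
      (monodromySub A B w z).det • volterra a b _ ∘L mulOp a b _ B)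

theorem toEuclideanCLM_monodromySub (w z : ℂ) :
    Matrix.toEuclideanCLM (𝕜 := ℂ) (monodromySub A B w z) = monodromy A B z - w • 1 :=
  StarAlgEquiv.apply_symm_apply _ _

theorem monodromySub_apply (w z : ℂ) (i j : ι) : monodromySub A B w z i j =
    monodromy A B z (EuclideanSpace.single j 1) i - w * (1 : Matrix ι ι ℂ) i j := by
  have h := congrArg (fun L => L (EuclideanSpace.single j 1) i)
    (toEuclideanCLM_monodromySub A B w z)
  simpa [Matrix.ofLp_toEuclideanCLM, Pi.single_apply, Matrix.one_apply] using h

theorem differentiable_monodromySub_apply (w : ℂ) (i j : ι) :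
    Differentiable ℂ fun z => monodromySub A B w z i j := by
  have h := differentiable_monodromy A B
  simp only [monodromySub_apply]
  fun_prop

theorem continuous_monodromySub : Continuous fun x : ℂ × ℂ => monodromySub A B x.1 x.2 := by
  have h := (differentiable_monodromy A B).continuous
  refine continuous_pi fun i => continuous_pi fun j => ?_
  simp only [monodromySub_apply]
  fun_prop

theorem differentiable_matrix_det {X : ℂ → Matrix ι ι ℂ}
    (hX : ∀ i j, Differentiable ℂ fun z => X z i j) : Differentiable ℂ fun z => (X z).det := by
  simp only [Matrix.det_apply]
  fun_prop

theorem differentiable_matrix_adjugate_apply {X : ℂ → Matrix ι ι ℂ}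
    (hX : ∀ i j, Differentiable ℂ fun z => X z i j) (i j : ι) :
    Differentiable ℂ fun z => (X z).adjugate i j := by
  simp only [Matrix.adjugate_apply]
  refine differentiable_matrix_det fun k l => ?_
  simp only [Matrix.updateRow_apply]
  split_ifs
  · exact differentiable_const _
  · exact hX k l

theorem differentiable_toEuclideanCLM {X : ℂ → Matrix ι ι ℂ}
    (hX : ∀ i j, Differentiable ℂ fun z => X z i j) :
    Differentiable ℂ fun z => Matrix.toEuclideanCLM (𝕜 := ℂ) (X z) := by
  have hsum (z : ℂ) : Matrix.toEuclideanCLM (𝕜 := ℂ) (X z) =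
      ∑ i, ∑ j, X z i j • Matrix.toEuclideanCLM (𝕜 := ℂ) (Matrix.single i j 1) := by
    conv_lhs => rw [Matrix.matrix_eq_sum_single (X z)]
    simp only [map_sum, ← map_smul, Matrix.smul_single, smul_eq_mul, mul_one]
  simp only [hsum]
  fun_prop

theorem differentiable_quasiPeriodicNum (w : ℂ) : Differentiable ℂ (quasiPeriodicNum A B w) := by
  have hM := differentiable_monodromySub_apply A B w
  have hadj := differentiable_toEuclideanCLM (differentiable_matrix_adjugate_apply hM)
  have hdet := differentiable_matrix_det hM
  have hsol := differentiable_solutionOp A B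
  have hinhom := differentiable_inhomBoundary A B
  unfold quasiPeriodicNum
  fun_prop

theorem continuous_quasiPeriodicNum :
    Continuous fun x : ℂ × ℂ => quasiPeriodicNum A B x.1 x.2 := by
  have hM := continuous_monodromySub A B
  have hadj : Continuous fun x : ℂ × ℂ =>
      Matrix.toEuclideanCLM (𝕜 := ℂ) (monodromySub A B x.1 x.2).adjugate :=
    (LinearMap.continuous_of_finiteDimensional
      (Matrix.toEuclideanCLM (𝕜 := ℂ) (n := ι)).toAlgEquiv.toLinearMap).comp hM.matrix_adjugate
  have hsol := (differentiable_solutionOp A B).continuous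
  have hinhom := (differentiable_inhomBoundary A B).continuous
  unfold quasiPeriodicNum
  fun_prop

theorem quasiPeriodicNum_apply (w z : ℂ) (g : L2Icc a b (EuclideanSpace ℂ ι)) :
    quasiPeriodicNum A B w z g = solutionOp A B z
      (constIcc a b _ (Matrix.toEuclideanCLM (𝕜 := ℂ) (monodromySub A B w z).adjugate
          (inhomBoundary A B z g)) -
        volterra a b _ (mulOp a b _ B ((monodromySub A B w z).det • g))) := by
  simp only [map_smul]
  rfl

theorem toEuclideanCLM_mul_adjugate_apply (X : Matrix ι ι ℂ) (c : EuclideanSpace ℂ ι) :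
    Matrix.toEuclideanCLM (𝕜 := ℂ) X (Matrix.toEuclideanCLM (𝕜 := ℂ) X.adjugate c) = X.det • c := by
  rw [← mul_apply_eq_comp, ← map_mul, Matrix.mul_adjugate, map_smul, map_one]
  rfl

theorem toEuclideanCLM_adjugate_mul_apply (X : Matrix ι ι ℂ) (c : EuclideanSpace ℂ ι) :
    Matrix.toEuclideanCLM (𝕜 := ℂ) X.adjugate (Matrix.toEuclideanCLM (𝕜 := ℂ) X c) = X.det • c := by
  rw [← mul_apply_eq_comp, ← map_mul, Matrix.adjugate_mul, map_smul, map_one]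
  rfl

variable {A B} {w : ℂ}
  {T : Submodule ℂ (L2Icc a b (EuclideanSpace ℂ ι) × L2Icc a b (EuclideanSpace ℂ ι))}

theorem isResolventPencil_quasiPeriodic
    (hT : ∀ f h, (f, h) ∈ T ↔ ∃ c, IsQuasiPeriodicSolution A B w c f h) :
    IsResolventPencil T (quasiPeriodicNum A B w) (fun z => (monodromySub A B w z).det) where
  differentiable_num := differentiable_quasiPeriodicNum A B w
  differentiable_den := differentiable_matrix_det (differentiable_monodromySub_apply A B w)
  right_inv z g := by
    refine (hT _ _).2 ⟨Matrix.toEuclideanCLM (𝕜 := ℂ) (monodromySub A B w z).adjugate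
      (inhomBoundary A B z g), ?_⟩
    rw [add_comm, isQuasiPeriodicSolution_smul_add_iff]
    refine ⟨quasiPeriodicNum_apply A B w z g, ?_⟩
    rw [map_smul, ← toEuclideanCLM_mul_adjugate_apply, toEuclideanCLM_monodromySub]
    rfl
  left_inv z f h hfh := by
    obtain ⟨c, hc⟩ := (hT f h).1 hfh
    obtain ⟨g, rfl⟩ : ∃ g, h = z • f + g := ⟨h - z • f, (add_sub_cancel _ _).symm⟩
    obtain ⟨hf, hbdry⟩ := (isQuasiPeriodicSolution_smul_add_iff A B).1 hc
    have hMc : monodromy A B z c - w • c =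
        Matrix.toEuclideanCLM (𝕜 := ℂ) (monodromySub A B w z) c := by
      rw [toEuclideanCLM_monodromySub]
      rfl
    rw [add_sub_cancel_left, quasiPeriodicNum_apply, ← hbdry, hMc,
      toEuclideanCLM_adjugate_mul_apply]
    simp only [map_smul, ← smul_sub]
    rw [← hf]

theorem isEigenvalue_iff_det_monodromySub_eq_zero (hab : a < b)
    (hT : ∀ f h, (f, h) ∈ T ↔ ∃ c, IsQuasiPeriodicSolution A B w c f h) {z : ℂ} :
    IsEigenvalue T z ↔ (monodromySub A B w z).det = 0 := by
  refine ⟨(isResolventPencil_quasiPeriodic hT).den_eq_zero, fun hdet => ?_⟩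
  obtain ⟨v, hv, hMv⟩ := Matrix.exists_mulVec_eq_zero_iff.2 hdet
  have hc : monodromy A B z (WithLp.toLp 2 v) = w • WithLp.toLp 2 v := by
    have h : Matrix.toEuclideanCLM (𝕜 := ℂ) (monodromySub A B w z) (WithLp.toLp 2 v) = 0 := by
      rw [Matrix.toEuclideanCLM_toLp, hMv, WithLp.toLp_zero]
    rw [toEuclideanCLM_monodromySub] at h
    exact sub_eq_zero.1 h
  refine ⟨_, ?_, (hT _ _).2 ⟨_, (isQuasiPeriodicSolution_smul_iff A B).2 ⟨rfl, hc⟩⟩⟩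
  rw [Ne, map_eq_zero_iff _ (solutionOp_injective A B z),
    map_eq_zero_iff _ (constIcc_injective hab), WithLp.toLp_eq_zero]
  exact hv

theorem quasiPeriodicNum_ne_zero (hab : a < b)
    (hB : Function.Surjective (mulOp a b (EuclideanSpace ℂ ι) B)) {z : ℂ}
    (hdet : (monodromySub A B w z).det = 0) (hadj : (monodromySub A B w z).adjugate ≠ 0) :
    quasiPeriodicNum A B w z ≠ 0 := by
  intro hN
  refine hadj ((Matrix.toEuclideanCLM (𝕜 := ℂ)).injective (ContinuousLinearMap.ext fun c => ?_))
  obtain ⟨g, rfl⟩ := inhomBoundary_surjective A B hab hB z c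
  have h := quasiPeriodicNum_apply A B w z g
  rw [hN, hdet, zero_smul, map_zero, map_zero, sub_zero] at h
  rw [map_zero, _root_.zero_apply]
  exact (map_eq_zero_iff _ (constIcc_injective hab)).1
    ((map_eq_zero_iff _ (solutionOp_injective A B z)).1 h.symm)

end QuasiPeriodicPencil

/-! ### Integration by parts -/

section IntegrationByParts

variable {a b : ℝ}

theorem absolutelyContinuousOnInterval_of_dist_le {X Y Z : Type*} [PseudoMetricSpace X]
    [PseudoMetricSpace Y] [PseudoMetricSpace Z] {f : ℝ → X} {g : ℝ → Y} {h : ℝ → Z}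
    (hg : AbsolutelyContinuousOnInterval g a b) (hh : AbsolutelyContinuousOnInterval h a b)
    {C D : ℝ} (hf : ∀ x ∈ uIcc a b, ∀ y ∈ uIcc a b,
      dist (f x) (f y) ≤ C * dist (g x) (g y) + D * dist (h x) (h y)) :
    AbsolutelyContinuousOnInterval f a b := by
  refine squeeze_zero' (Eventually.of_forall fun _ => Finset.sum_nonneg fun _ _ => dist_nonneg) ?_
    (by simpa using (Tendsto.const_mul C hg).add (Tendsto.const_mul D hh))
  filter_upwards [mem_inf_of_right (mem_principal_self _)] with I hI
  simp only [Finset.mul_sum, ← Finset.sum_add_distrib]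
  exact Finset.sum_le_sum fun i hi => hf _ (hI.1 i hi).1 _ (hI.1 i hi).2

variable {E F G : Type*} [NormedAddCommGroup E] [NormedSpace ℝ E]
  [NormedAddCommGroup F] [NormedSpace ℝ F] [NormedAddCommGroup G] [NormedSpace ℝ G]

theorem absolutelyContinuousOnInterval_primitive {u : ℝ → E}
    (hu : IntervalIntegrable u volume a b) (c : E) :
    AbsolutelyContinuousOnInterval (fun x => c + ∫ s in a..x, u s) a b := by
  have hnorm := hu.norm.absolutelyContinuousOnInterval_intervalIntegral left_mem_uIcc
  refine absolutelyContinuousOnInterval_of_dist_le hnorm hnorm (C := 1) (D := 0)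
    fun x hx y hy => ?_
  have hsub {z : ℝ} (hz : z ∈ uIcc a b) : IntervalIntegrable u volume a z :=
    hu.mono_set (uIcc_subset_uIcc left_mem_uIcc hz)
  rw [dist_add_left, one_mul, zero_mul, add_zero, dist_comm, dist_comm (∫ s in a..x, ‖u s‖),
    dist_eq_norm, dist_eq_norm, intervalIntegral.integral_interval_sub_left (hsub hy) (hsub hx),
    intervalIntegral.integral_interval_sub_left (hsub hy).norm (hsub hx).norm]
  exact intervalIntegral.norm_integral_le_abs_integral_norm

theorem absolutelyContinuousOnInterval_bilin (L : E →L[ℝ] F →L[ℝ] G) {f : ℝ → E} {g : ℝ → F}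
    (hf : AbsolutelyContinuousOnInterval f a b) (hg : AbsolutelyContinuousOnInterval g a b) :
    AbsolutelyContinuousOnInterval (fun x => L (f x) (g x)) a b := by
  obtain ⟨C, hC⟩ := hf.exists_bound
  obtain ⟨D, hD⟩ := hg.exists_bound
  refine absolutelyContinuousOnInterval_of_dist_le hf hg (C := ‖L‖ * D) (D := ‖L‖ * C)
    fun x hx y hy => ?_
  simp only [dist_eq_norm]
  calc ‖L (f x) (g x) - L (f y) (g y)‖
      = ‖L (f x - f y) (g x) + L (f y) (g x - g y)‖ := by
        simp only [map_sub, _root_.sub_apply, sub_add_sub_cancel]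
    _ ≤ ‖L‖ * ‖f x - f y‖ * ‖g x‖ + ‖L‖ * ‖f y‖ * ‖g x - g y‖ :=
        (norm_add_le _ _).trans (add_le_add (L.le_opNorm₂ _ _) (L.le_opNorm₂ _ _))
    _ ≤ ‖L‖ * ‖f x - f y‖ * D + ‖L‖ * C * ‖g x - g y‖ := by
        gcongr
        exacts [hD x hx, hC y hy]
    _ = ‖L‖ * D * ‖f x - f y‖ + ‖L‖ * C * ‖g x - g y‖ := by ring

theorem intervalIntegrable_bilin_left (L : E →L[ℝ] F →L[ℝ] G) {u : ℝ → E} {g : ℝ → F}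
    (hu : IntervalIntegrable u volume a b) (hg : ContinuousOn g (uIcc a b)) :
    IntervalIntegrable (fun x => L (u x) (g x)) volume a b := by
  rw [intervalIntegrable_iff] at hu ⊢
  obtain ⟨C, hC⟩ := isCompact_uIcc.exists_bound_of_continuousOn hg
  exact L.integrable_of_bilin_of_bdd_right C hu
    ((hg.mono uIoc_subset_uIcc).aestronglyMeasurable measurableSet_uIoc)
    (ae_restrict_of_forall_mem measurableSet_uIoc fun x hx => hC x (uIoc_subset_uIcc hx))

variable [CompleteSpace E] [CompleteSpace F] [CompleteSpace G]

theorem integral_bilin_primitive (L : E →L[ℝ] F →L[ℝ] G) {u : ℝ → E} {v : ℝ → F}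
    (hu : IntervalIntegrable u volume a b) (hv : IntervalIntegrable v volume a b) (c : E) (d : F) :
    ∫ s in a..b, (L (c + ∫ r in a..s, u r) (v s) + L (u s) (d + ∫ r in a..s, v r)) =
      L (c + ∫ s in a..b, u s) (d + ∫ s in a..b, v s) - L c d := by
  have hU := absolutelyContinuousOnInterval_primitive hu c
  have hV := absolutelyContinuousOnInterval_primitive hv d
  have hw := (intervalIntegrable_bilin_left L.flip hv hU.continuousOn).add
    (intervalIntegrable_bilin_left L hu hV.continuousOn)
  have hW := absolutelyContinuousOnInterval_primitive hw 0
  obtain ⟨C, hC⟩ := ((absolutelyContinuousOnInterval_bilin L hU hV).sub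
    hW).const_of_ae_hasDerivAt_zero (by
      filter_upwards [hu.ae_hasDerivAt_integral, hv.ae_hasDerivAt_integral,
        hw.ae_hasDerivAt_integral] with x h1 h2 h3 hx
      have hLUV := L.hasDerivAt_of_bilinear
        (fun _ => (h1 hx a left_mem_uIcc).const_add c)
        (fun _ => (h2 hx a left_mem_uIcc).const_add d)
      have h := hLUV.fun_sub ((h3 hx a left_mem_uIcc).const_add 0)
      rwa [ContinuousLinearMap.flip_apply, sub_self] at h)
  have h := (hC b right_mem_uIcc).trans (hC a left_mem_uIcc).symm
  simp only [Pi.sub_apply, intervalIntegral.integral_same, add_zero, zero_add, sub_zero] at h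
  rw [← h, sub_sub_cancel]
  rfl

end IntegrationByParts

section Boundary

variable {a b : ℝ} {E F G : Type*} [NormedAddCommGroup E] [NormedSpace ℂ E]
  [NormedAddCommGroup F] [NormedSpace ℂ F] [NormedAddCommGroup G] [NormedSpace ℝ G]

theorem setIntegral_Icc_eq_intervalIntegral (hab : a ≤ b) (f : ℝ → G) :
    ∫ x in Icc a b, f x = ∫ x in a..b, f x := by
  rw [intervalIntegral.integral_of_le hab, integral_Icc_eq_integral_Ioc]

theorem coeFn_const_add_volterra (c : E) (v : L2Icc a b E) :
    (constIcc a b E c + volterra a b E v : L2Icc a b E) =ᵐ[volume.restrict (Icc a b)]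
      fun x => c + ∫ s in a..x, v s := by
  filter_upwards [Lp.coeFn_add (constIcc a b E c) (volterra a b E v),
    coeFn_constIcc (a := a) (b := b) c, coeFn_volterra v] with x h1 h2 h3
  rw [h1, Pi.add_apply, h2, h3]

variable [CompleteSpace E] [CompleteSpace F] [CompleteSpace G]

theorem integral_bilin_of_eq_const_add_volterra (hab : a ≤ b) (L : E →L[ℝ] F →L[ℝ] G)
    {c : E} {d : F} {f u : L2Icc a b E} {g v : L2Icc a b F}
    (hf : f = constIcc a b E c + volterra a b E u) (hg : g = constIcc a b F d + volterra a b F v) :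
    ∫ x in Icc a b, (L (f x) (v x) + L (u x) (g x)) =
      L (c + integralIcc a b E u) (d + integralIcc a b F v) - L c d := by
  have hb := right_mem_Icc.2 hab
  rw [integralIcc_apply, integralIcc_apply, setIntegral_Icc_eq_intervalIntegral hab u,
    setIntegral_Icc_eq_intervalIntegral hab v, ← integral_bilin_primitive L
      (intervalIntegrable_of_mem_Icc (integrableOn_coeFn u) hb)
      (intervalIntegrable_of_mem_Icc (integrableOn_coeFn v) hb),
    ← setIntegral_Icc_eq_intervalIntegral hab]
  refine integral_congr_ae ?_
  filter_upwards [coeFn_const_add_volterra c u, coeFn_const_add_volterra d v] with x hfx hgx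
  rw [← hfx, ← hgx, ← hf, ← hg]

end Boundary

section Liouville

variable {a b : ℝ}

theorem coeFn_coeffOp {E : Type*} [NormedAddCommGroup E] [NormedSpace ℂ E]
    (A B : LInftyEnd a b E) (z : ℂ) (f : L2Icc a b E) :
    coeffOp A B z f =ᵐ[volume.restrict (Icc a b)] fun x => (A x - z • B x) (f x) := by
  filter_upwards [Lp.coeFn_sub (mulOp a b E A f) (z • mulOp a b E B f), coeFn_mulOp A f,
    Lp.coeFn_smul z (mulOp a b E B f), coeFn_mulOp B f] with x h1 h2 h3 h4
  rw [coeffOp, _root_.sub_apply, _root_.smul_apply, h1, Pi.sub_apply, h2, h3, Pi.smul_apply, h4]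
  rfl

/-- The determinant `(x, y) ↦ x₀ y₁ - x₁ y₀` of two columns, as a continuous real-bilinear map. -/
noncomputable def detBilin :
    EuclideanSpace ℂ (Fin 2) →L[ℝ] EuclideanSpace ℂ (Fin 2) →L[ℝ] ℂ :=
  let π (i : Fin 2) : EuclideanSpace ℂ (Fin 2) →L[ℝ] ℂ :=
    (EuclideanSpace.proj i : EuclideanSpace ℂ (Fin 2) →L[ℂ] ℂ).restrictScalars ℝ
  (ContinuousLinearMap.mul ℝ ℂ).bilinearComp (π 0) (π 1) -
    (ContinuousLinearMap.mul ℝ ℂ).bilinearComp (π 1) (π 0)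

theorem detBilin_apply (x y : EuclideanSpace ℂ (Fin 2)) :
    detBilin x y = x 0 * y 1 - x 1 * y 0 := rfl

theorem detBilin_apply_add_apply
    (X : EuclideanSpace ℂ (Fin 2) →L[ℂ] EuclideanSpace ℂ (Fin 2)) (x y : EuclideanSpace ℂ (Fin 2)) :
    detBilin x (X y) + detBilin (X x) y =
      ((Matrix.toEuclideanCLM (𝕜 := ℂ)).symm X).trace * detBilin x y := by
  obtain ⟨X, rfl⟩ : ∃ M, Matrix.toEuclideanCLM (𝕜 := ℂ) M = X :=
    ⟨_, StarAlgEquiv.apply_symm_apply _ X⟩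
  rw [StarAlgEquiv.symm_apply_apply, Matrix.trace_fin_two]
  simp only [detBilin_apply, Matrix.ofLp_toEuclideanCLM, Matrix.mulVec, dotProduct,
    Fin.sum_univ_two]
  ring

theorem detBilin_monodromy (hab : a ≤ b) {A B : LInftyEnd a b (EuclideanSpace ℂ (Fin 2))} {z : ℂ}
    (htr : ∀ᵐ x ∂volume.restrict (Icc a b),
      ((Matrix.toEuclideanCLM (𝕜 := ℂ)).symm (A x - z • B x)).trace = 0)
    (c d : EuclideanSpace ℂ (Fin 2)) :
    detBilin (monodromy A B z c) (monodromy A B z d) = detBilin c d := by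
  have hsol (e : EuclideanSpace ℂ (Fin 2)) :=
    (eq_solutionOp_iff A B).1 (rfl : solutionOp A B z (constIcc a b _ e) = _)
  have h := integral_bilin_of_eq_const_add_volterra hab detBilin (hsol c) (hsol d)
  have hzero : ∫ x in Icc a b,
      (detBilin (solutionOp A B z (constIcc a b _ c) x)
          (coeffOp A B z (solutionOp A B z (constIcc a b _ d)) x) +
        detBilin (coeffOp A B z (solutionOp A B z (constIcc a b _ c)) x)
          (solutionOp A B z (constIcc a b _ d) x)) = 0 := by
    refine integral_eq_zero_of_ae ?_
    filter_upwards [htr, coeFn_coeffOp A B z (solutionOp A B z (constIcc a b _ c)),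
      coeFn_coeffOp A B z (solutionOp A B z (constIcc a b _ d))] with x hx hc hd
    rw [hc, hd, detBilin_apply_add_apply, hx, zero_mul, Pi.zero_apply]
  exact sub_eq_zero.1 (h.symm.trans hzero)

/-- Liouville's formula: the Wronskian of a trace-free system is constant. -/
theorem det_monodromy_eq_one (hab : a ≤ b) {A B : LInftyEnd a b (EuclideanSpace ℂ (Fin 2))} {z : ℂ}
    (htr : ∀ᵐ x ∂volume.restrict (Icc a b),
      ((Matrix.toEuclideanCLM (𝕜 := ℂ)).symm (A x - z • B x)).trace = 0) :
    (monodromySub A B 0 z).det = 1 := by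
  have h := detBilin_monodromy hab htr (EuclideanSpace.single 0 1) (EuclideanSpace.single 1 1)
  simp only [detBilin_apply, PiLp.single_apply] at h
  simpa [Matrix.det_fin_two, monodromySub_apply, mul_comm] using h

end Liouville

section ConstCoefficient

variable {a b : ℝ} {E : Type*} [NormedAddCommGroup E] [NormedSpace ℂ E] {J : E →L[ℂ] E}

theorem coeFn_mulOp_const (v : L2Icc a b E) :
    mulOp a b E (Lp.const ∞ _ J) v =ᵐ[volume.restrict (Icc a b)] fun x => J (v x) := by
  filter_upwards [coeFn_mulOp (Lp.const ∞ (volume.restrict (Icc a b)) J) v,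
    Lp.coeFn_const ∞ (volume.restrict (Icc a b)) J] with x hx hJx
  rw [hx, hJx, Function.const_apply]

theorem mulOp_const_mulOp_const (hJJ : ∀ x, J (J x) = -x) (v : L2Icc a b E) :
    mulOp a b E (Lp.const ∞ _ J) (mulOp a b E (Lp.const ∞ _ J) v) = -v := by
  refine Lp.ext ?_
  filter_upwards [coeFn_mulOp_const v,
    coeFn_mulOp_const (mulOp a b E (Lp.const ∞ _ J) v), Lp.coeFn_neg v] with x h1 h2 h3
  rw [h2, h1, h3, hJJ, Pi.neg_apply]

theorem bijective_mulOp_const (hJJ : ∀ x, J (J x) = -x) :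
    Function.Bijective (mulOp a b E (Lp.const ∞ _ J)) := by
  refine ⟨fun u v huv => ?_, fun v => ⟨-mulOp a b E (Lp.const ∞ _ J) v, ?_⟩⟩
  · rw [← neg_inj, ← mulOp_const_mulOp_const hJJ, huv, mulOp_const_mulOp_const hJJ]
  · rw [map_neg, mulOp_const_mulOp_const hJJ, neg_neg]

end ConstCoefficient

section SkewAdjoint

variable {a b : ℝ} {E : Type*} [NormedAddCommGroup E] [InnerProductSpace ℂ E]
  {J : E →L[ℂ] E}

theorem inner_apply_add_inner_apply_eq (hJ : ∀ x y, inner ℂ (J x) y = -inner ℂ x (J y)) (x y : E) :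
    inner ℂ x (J y) + inner ℂ y (J x) = 2 * Complex.I * (inner ℂ x (J y)).im := by
  have h : inner ℂ y (J x) = -starRingEnd ℂ (inner ℂ x (J y)) := by
    rw [inner_conj_symm, hJ, neg_neg]
  rw [h, ← sub_eq_add_neg, Complex.sub_conj]
  push_cast
  ring

variable [CompleteSpace E]

/-- The Lagrange identity for quasi-periodic functions with a unimodular multiplier. -/
theorem im_inner_mulOp_const_eq_zero (hab : a ≤ b)
    (hJ : ∀ x y, inner ℂ (J x) y = -inner ℂ x (J y)) {w : ℂ} (hw : ‖w‖ = 1) {c : E}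
    {f v : L2Icc a b E} (hf : f = constIcc a b E c + volterra a b E v)
    (hv : integralIcc a b E v = (w - 1) • c) :
    (inner ℂ f (mulOp a b E (Lp.const ∞ _ J) v)).im = 0 := by
  let L : E →L[ℝ] E →L[ℝ] ℂ :=
    (isBoundedBilinearMap_inner (𝕜 := ℂ)).toContinuousLinearMap.bilinearComp (.id ℝ E)
      (J.restrictScalars ℝ)
  have hL (x y : E) : L x y = inner ℂ x (J y) := rfl
  have hbdry : L (w • c) (w • c) - L c c = 0 := by
    rw [hL, hL, map_smul, inner_smul_left, inner_smul_right, ← mul_assoc, Complex.conj_mul', hw]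
    simp
  have h := integral_bilin_of_eq_const_add_volterra hab L hf hf
  rw [hv, sub_smul, one_smul, add_sub_cancel, hbdry] at h
  have hintegrand : (fun x => L (f x) (v x) + L (v x) (f x)) =ᵐ[volume.restrict (Icc a b)]
      fun x => 2 * Complex.I * ((inner ℂ (f x) (mulOp a b E (Lp.const ∞ _ J) v x)).im : ℂ) := by
    filter_upwards [coeFn_mulOp_const v] with x hx
    rw [hL, hL, inner_apply_add_inner_apply_eq hJ, hx]
  rw [integral_congr_ae hintegrand, integral_const_mul, integral_complex_ofReal] at h
  rw [L2.inner_def, ← Complex.imCLM_apply,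
    ← Complex.imCLM.integral_comp_comm (L2.integrable_inner f _)]
  simpa using h

theorem im_le_of_isQuasiPeriodicSolution (hab : a ≤ b)
    (hJ : ∀ x y, inner ℂ (J x) y = -inner ℂ x (J y)) (hJJ : ∀ x, J (J x) = -x)
    {A : LInftyEnd a b E} {w z : ℂ} (hw : ‖w‖ = 1) {c : E} {f : L2Icc a b E} (hf0 : f ≠ 0)
    (hf : IsQuasiPeriodicSolution A (Lp.const ∞ _ J) w c f (z • f)) :
    z.im ≤ ‖mulOp a b E (Lp.const ∞ _ J) ∘L mulOp a b E A‖ := by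
  set S := mulOp a b E (Lp.const ∞ _ J)
  have hSS : S (S f) = -f := mulOp_const_mulOp_const hJJ f
  have him := im_inner_mulOp_const_eq_zero hab hJ hw hf.1 hf.2
  have hsq : (z * (‖f‖ : ℂ) ^ 2).im = z.im * ‖f‖ ^ 2 := by
    rw [← Complex.ofReal_pow, Complex.im_mul_ofReal]
  rw [map_sub, map_smul, map_smul, hSS, smul_neg, sub_neg_eq_add, inner_add_right,
    inner_smul_right, inner_self_eq_norm_sq_to_K, Complex.add_im, RCLike.ofReal_eq_complex_ofReal,
    hsq] at him
  refine le_of_mul_le_mul_right ?_ (pow_pos (norm_pos_iff.2 hf0) 2)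
  calc z.im * ‖f‖ ^ 2 = -(inner ℂ f (S (mulOp a b E A f))).im := eq_neg_of_add_eq_zero_right him
    _ ≤ ‖inner ℂ f (S (mulOp a b E A f))‖ := (neg_le_abs _).trans (Complex.abs_im_le_norm _)
    _ ≤ ‖f‖ * (‖S ∘L mulOp a b E A‖ * ‖f‖) := (norm_inner_le_norm _ _).trans
        (mul_le_mul_of_nonneg_left ((S ∘L mulOp a b E A).le_opNorm f) (norm_nonneg f))
    _ = ‖S ∘L mulOp a b E A‖ * ‖f‖ ^ 2 := by ring

end SkewAdjoint

/-! ### Planar systems -/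

section Planar

theorem adjugate_fin_two_eq_zero_iff {R : Type*} [CommRing R] {X : Matrix (Fin 2) (Fin 2) R} :
    X.adjugate = 0 ↔ X = 0 := by
  refine ⟨fun h => ?_, fun h => by rw [h, Matrix.adjugate_zero]⟩
  simpa [h] using (Matrix.adjugate_adjugate' X).symm

theorem deriv_det_fin_two_eq_zero {𝕜 : Type*} [NontriviallyNormedField 𝕜]
    {X : 𝕜 → Matrix (Fin 2) (Fin 2) 𝕜} {z : 𝕜}
    (hX : ∀ i j, DifferentiableAt 𝕜 (fun z => X z i j) z) (hz : X z = 0) :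
    deriv (fun z => (X z).det) z = 0 := by
  simp only [Matrix.det_fin_two]
  have h := ((hX 0 0).hasDerivAt.fun_mul (hX 1 1).hasDerivAt).fun_sub
    ((hX 0 1).hasDerivAt.fun_mul (hX 1 0).hasDerivAt)
  simpa [hz] using h.deriv

theorem ker_le_span_singleton_of_finrank_eq_two {K V W : Type*} [Field K] [AddCommGroup V]
    [Module K V] [AddCommGroup W] [Module K W] (hV : Module.finrank K V = 2) {X : V →ₗ[K] W}
    (hX : X ≠ 0) {c : V} (hc : c ≠ 0) (hXc : X c = 0) : X.ker ≤ K ∙ c := by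
  have : FiniteDimensional K V := .of_finrank_eq_succ hV
  have hle : K ∙ c ≤ X.ker := (Submodule.span_singleton_le_iff_mem _ _).2 hXc
  have hlt : Module.finrank K X.ker < 2 :=
    hV ▸ Submodule.finrank_lt fun h => hX (LinearMap.ker_eq_top.1 h)
  refine (Submodule.eq_of_le_of_finrank_le hle ?_).ge
  rw [finrank_span_singleton hc]
  exact Nat.le_of_lt_succ hlt

variable {a b : ℝ} {A B : LInftyEnd a b (EuclideanSpace ℂ (Fin 2))} {w z : ℂ}
  {T : Submodule ℂ (L2Icc a b (EuclideanSpace ℂ (Fin 2)) × L2Icc a b (EuclideanSpace ℂ (Fin 2)))}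

theorem rootKer_one_le_span_singleton
    (hT : ∀ f h, (f, h) ∈ T ↔ ∃ c, IsQuasiPeriodicSolution A B w c f h)
    (hM : monodromySub A B w z ≠ 0) {Ψ : L2Icc a b (EuclideanSpace ℂ (Fin 2))}
    (hΨ : IsEigenvector T z Ψ) : rootKer T z 1 ≤ ℂ ∙ Ψ := by
  have mem_iff (f : L2Icc a b (EuclideanSpace ℂ (Fin 2))) : (f, z • f) ∈ T ↔
      ∃ c ∈ (Matrix.toEuclideanCLM (𝕜 := ℂ) (monodromySub A B w z)).ker,
        f = solutionOp A B z (constIcc a b _ c) := by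
    simp only [hT, isQuasiPeriodicSolution_smul_iff, toEuclideanCLM_monodromySub, LinearMap.mem_ker,
      and_comm (a := f = _)]
    exact exists_congr fun c => and_congr_left' sub_eq_zero.symm
  obtain ⟨c, hMc, hc⟩ := (mem_iff Ψ).1 hΨ.2
  have hc0 : c ≠ 0 := by
    rintro rfl
    exact hΨ.1 (by rw [hc, map_zero, map_zero])
  intro f hf
  obtain ⟨d, hd, rfl⟩ := (mem_iff f).1 (mem_rootKer_one.1 hf)
  obtain ⟨k, rfl⟩ := Submodule.mem_span_singleton.1 <|
    ker_le_span_singleton_of_finrank_eq_two finrank_euclideanSpace_fin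
      (fun h => hM ((Matrix.toEuclideanCLM (𝕜 := ℂ)).injective
        (ContinuousLinearMap.coe_injective (h.trans (by simp))))) hc0 hMc hd
  rw [map_smul, map_smul, ← hc]
  exact Submodule.smul_mem _ k (Submodule.mem_span_singleton_self Ψ)

theorem monodromySub_ne_zero_of_deriv_det_ne_zero
    (h1 : deriv (fun z => (monodromySub A B w z).det) z ≠ 0) : monodromySub A B w z ≠ 0 :=
  fun h => h1 <| deriv_det_fin_two_eq_zero
    (fun i j => (differentiable_monodromySub_apply A B w i j) z) h

theorem isMultipleEigenvalue_of_monodromySub_eq_zero (hab : a < b)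
    (hT : ∀ f h, (f, h) ∈ T ↔ ∃ c, IsQuasiPeriodicSolution A B w c f h)
    (hM : monodromySub A B w z = 0) : IsMultipleEigenvalue T z := by
  let S : EuclideanSpace ℂ (Fin 2) →L[ℂ] L2Icc a b (EuclideanSpace ℂ (Fin 2)) :=
    solutionOp A B z ∘L constIcc a b _
  have hS : Function.Injective S := (solutionOp_injective A B z).comp (constIcc_injective hab)
  have hmem (c : EuclideanSpace ℂ (Fin 2)) : S c ∈ rootKer T z 1 := by
    refine mem_rootKer_one.2 ((hT _ _).2 ⟨c, (isQuasiPeriodicSolution_smul_iff A B).2 ⟨rfl, ?_⟩⟩)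
    have h := toEuclideanCLM_monodromySub A B w z
    rw [hM, map_zero, eq_comm, sub_eq_zero] at h
    rw [h]
    rfl
  let e := EuclideanSpace.basisFun (Fin 2) ℂ
  refine ⟨(isEigenvalue_iff_det_monodromySub_eq_zero hab hT).2 (by simp [hM]),
    two_le_algMultiplicity (hmem (e 0)) (hmem (e 1)) ?_⟩
  rw [show ![S (e 0), S (e 1)] = S ∘ e from List.ofFn_inj.1 rfl]
  exact e.orthonormal.linearIndependent.map' S.toLinearMap (LinearMap.ker_eq_bot.2 hS)

theorem isMultipleEigenvalue_of_deriv_det_eq_zero (hab : a < b)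
    (hB : Function.Bijective (mulOp a b (EuclideanSpace ℂ (Fin 2)) B))
    (hT : ∀ f h, (f, h) ∈ T ↔ ∃ c, IsQuasiPeriodicSolution A B w c f h) {z₁ : ℂ}
    (hz₁ : (monodromySub A B w z₁).det ≠ 0) (h0 : (monodromySub A B w z).det = 0)
    (h1 : deriv (fun z => (monodromySub A B w z).det) z = 0) : IsMultipleEigenvalue T z := by
  by_cases hM : monodromySub A B w z = 0
  · exact isMultipleEigenvalue_of_monodromySub_eq_zero hab hT hM
  · refine (isResolventPencil_quasiPeriodic hT).isMultipleEigenvalue h0 h1 hz₁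
      (quasiPeriodicNum_ne_zero hab hB.2 h0 (mt adjugate_fin_two_eq_zero_iff.1 hM)) fun h hh => ?_
    obtain ⟨c, hc⟩ := (hT 0 h).1 hh
    exact eq_zero_of_isQuasiPeriodicSolution_zero A B hab hB.1 hc

theorem det_sub_scalar_fin_two {R : Type*} [CommRing R] (X : Matrix (Fin 2) (Fin 2) R) (w : R) :
    (X - Matrix.scalar (Fin 2) w).det = w ^ 2 - X.trace * w + X.det := by
  simp [Matrix.det_fin_two, Matrix.trace_fin_two]
  ring

end Planar

theorem memLp_top_of_boundedVariationOn {μ : Measure ℝ} {s : Set ℝ} (hs : MeasurableSet s)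
    {f : ℝ → ℂ} (hf : BoundedVariationOn f s) : MemLp f ∞ (μ.restrict s) := by
  obtain rfl | ⟨a, ha⟩ := s.eq_empty_or_nonempty
  · simp
  have aemeasurable_real {u : ℝ → ℝ} (hu : BoundedVariationOn u s) :
      AEMeasurable u (μ.restrict s) := by
    obtain ⟨v, w, hv, hw, rfl⟩ := hu.locallyBoundedVariationOn.exists_monotoneOn_sub_monotoneOn
    exact (aemeasurable_restrict_of_monotoneOn hs hv).sub
      (aemeasurable_restrict_of_monotoneOn hs hw)
  have hre := aemeasurable_real (Complex.reCLM.lipschitz.comp_boundedVariationOn hf)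
  have him := aemeasurable_real (Complex.imCLM.lipschitz.comp_boundedVariationOn hf)
  refine memLp_top_of_bound (aemeasurable_of_re_im hre him).aestronglyMeasurable
    ((eVariationOn f s).toReal + ‖f a‖) (ae_restrict_of_forall_mem hs fun x hx => ?_)
  exact (norm_le_norm_sub_add _ _).trans
    (add_le_add_left ((dist_eq_norm _ _).symm.trans_le (hf.dist_le hx ha)) _)

/-! ### The Dirac system -/

section Dirac

/-- The matrix `J`, as an operator. -/
noncomputable def jMat : EuclideanSpace ℂ (Fin 2) →L[ℂ] EuclideanSpace ℂ (Fin 2) :=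
  Matrix.toEuclideanCLM (𝕜 := ℂ) !![0, 1; -1, 0]

/-- The matrix potential `Q(x)`, as an operator. -/
noncomputable def potential (p q : ℝ → ℂ) (x : ℝ) :
    EuclideanSpace ℂ (Fin 2) →L[ℂ] EuclideanSpace ℂ (Fin 2) :=
  Matrix.toEuclideanCLM (𝕜 := ℂ) !![p x, q x; q x, -p x]

theorem jMat_jMat (c : EuclideanSpace ℂ (Fin 2)) : jMat (jMat c) = -c := by
  ext i
  fin_cases i <;> simp [jMat, Matrix.ofLp_toEuclideanCLM, Matrix.mulVec, dotProduct]

theorem inner_jMat_left (x y : EuclideanSpace ℂ (Fin 2)) :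
    inner ℂ (jMat x) y = -inner ℂ x (jMat y) := by
  simp [jMat, Matrix.ofLp_toEuclideanCLM, Matrix.mulVec, dotProduct, PiLp.inner_apply]

theorem diracExpr_eq (p q : ℝ → ℂ) (x : ℝ) (y v : EuclideanSpace ℂ (Fin 2)) :
    diracExpr p q x y v = jMat v + potential p q x y := by
  rw [diracExpr, WithLp.toLp_add]
  rfl

theorem eq_diracExpr_iff (p q : ℝ → ℂ) (x : ℝ) (y v h : EuclideanSpace ℂ (Fin 2)) :
    h = diracExpr p q x y v ↔ v = jMat (potential p q x y) - jMat h := by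
  rw [diracExpr_eq]
  constructor
  · rintro rfl
    rw [map_add, jMat_jMat]
    abel
  · rintro rfl
    rw [map_sub, jMat_jMat, jMat_jMat]
    abel

theorem potential_eq_smul_add_smul (p q : ℝ → ℂ) (x : ℝ) :
    potential p q x = p x • Matrix.toEuclideanCLM (𝕜 := ℂ) !![1, 0; 0, -1] +
      q x • Matrix.toEuclideanCLM (𝕜 := ℂ) !![0, 1; 1, 0] := by
  have hQ : !![p x, q x; q x, -p x] = p x • !![1, 0; 0, -1] + q x • !![0, 1; 1, 0] := by
    ext i j
    fin_cases i <;> fin_cases j <;> simp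
  rw [potential, hQ, map_add, map_smul, map_smul]

theorem memLp_jMat_comp_potential {μ : Measure ℝ} {r : ℝ≥0∞} {p q : ℝ → ℂ} (hp : MemLp p r μ)
    (hq : MemLp q r μ) : MemLp (fun x => jMat ∘L potential p q x) r μ := by
  have memLp_smul_const {u : ℝ → ℂ} (hu : MemLp u r μ)
      (X : EuclideanSpace ℂ (Fin 2) →L[ℂ] EuclideanSpace ℂ (Fin 2)) :
      MemLp (fun x => u x • X) r μ :=
    (ContinuousLinearMap.toSpanSingleton ℂ X).comp_memLp' hu
  have hsum : (fun x => jMat ∘L potential p q x) =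
      (fun x => p x • jMat ∘L Matrix.toEuclideanCLM (𝕜 := ℂ) !![1, 0; 0, -1]) +
        fun x => q x • jMat ∘L Matrix.toEuclideanCLM (𝕜 := ℂ) !![0, 1; 1, 0] := by
    ext1 x
    rw [potential_eq_smul_add_smul, ContinuousLinearMap.comp_add, ContinuousLinearMap.comp_smul,
      ContinuousLinearMap.comp_smul]
    rfl
  rw [hsum]
  exact MemLp.add (ε := EuclideanSpace ℂ (Fin 2) →L[ℂ] EuclideanSpace ℂ (Fin 2))
    (memLp_smul_const hp _) (memLp_smul_const hq _)

theorem trace_jMat_comp_potential_sub (p q : ℝ → ℂ) (x : ℝ) (z : ℂ) :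
    ((Matrix.toEuclideanCLM (𝕜 := ℂ)).symm (jMat ∘L potential p q x - z • jMat)).trace = 0 := by
  have h : jMat ∘L potential p q x - z • jMat = Matrix.toEuclideanCLM (𝕜 := ℂ)
      (!![0, 1; -1, 0] * !![p x, q x; q x, -p x] - z • !![0, 1; -1, 0]) := by
    rw [map_sub, map_mul, map_smul]
    rfl
  rw [h, StarAlgEquiv.symm_apply_apply]
  simp [Matrix.trace_fin_two]

variable {p q : ℝ → ℂ} (hp : MemLp p ∞ (volume.restrict (Icc 0 Real.pi)))
  (hq : MemLp q ∞ (volume.restrict (Icc 0 Real.pi)))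

/-- The coefficient `J Q` of the system `y' = J (Q - z) y`, which is the equation `l(y) = z y`. -/
noncomputable def diracCoeff : LInftyEnd 0 Real.pi (EuclideanSpace ℂ (Fin 2)) :=
  (memLp_jMat_comp_potential hp hq).toLp

/-- The coefficient `J` of the spectral parameter in the system `y' = J (Q - z) y`. -/
noncomputable def diracWeight : LInftyEnd 0 Real.pi (EuclideanSpace ℂ (Fin 2)) :=
  Lp.const ∞ _ jMat

/-- The discriminant: the trace of the monodromy matrix of the system `y' = J (Q - z) y`. -/
noncomputable def discriminant (z : ℂ) : ℂ :=
  (monodromySub (diracCoeff hp hq) diracWeight 0 z).trace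

theorem coeFn_diracCoeff : diracCoeff hp hq =ᵐ[volume.restrict (Icc 0 Real.pi)]
    fun x => jMat ∘L potential p q x :=
  MemLp.coeFn_toLp _

theorem bijective_mulOp_diracWeight :
    Function.Bijective (mulOp 0 Real.pi (EuclideanSpace ℂ (Fin 2)) diracWeight) :=
  bijective_mulOp_const jMat_jMat

theorem differentiable_discriminant : Differentiable ℂ (discriminant hp hq) := by
  have h := differentiable_monodromySub_apply (diracCoeff hp hq) diracWeight 0
  unfold discriminant
  simp only [Matrix.trace_fin_two]
  fun_prop

theorem det_monodromySub_diracCoeff_zero (z : ℂ) :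
    (monodromySub (diracCoeff hp hq) diracWeight 0 z).det = 1 := by
  refine det_monodromy_eq_one Real.pi_pos.le ?_
  filter_upwards [coeFn_diracCoeff hp hq,
    Lp.coeFn_const ∞ (volume.restrict (Icc 0 Real.pi)) jMat] with x hA hB
  rw [hA, diracWeight, hB, Function.const_apply, trace_jMat_comp_potential_sub]

/-- The Floquet multiplier `exp(iπt)`. -/
noncomputable def multiplier (t : ℝ) : ℂ := Complex.exp (Complex.I * Real.pi * t)

theorem norm_multiplier (t : ℝ) : ‖multiplier t‖ = 1 := by
  rw [multiplier, Complex.norm_exp]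
  simp

theorem multiplier_ne_zero (t : ℝ) : multiplier t ≠ 0 := Complex.exp_ne_zero _

theorem continuous_multiplier : Continuous multiplier := by
  unfold multiplier
  fun_prop

theorem multiplier_sq_add_one (t : ℝ) :
    multiplier t ^ 2 + 1 = multiplier t * (2 * Real.cos (Real.pi * t) : ℝ) := by
  have hm : multiplier t = Complex.exp (Real.pi * t * Complex.I) := by
    rw [multiplier, mul_assoc, mul_comm]
  have hinv :
      Complex.exp (Real.pi * t * Complex.I) * Complex.exp (-(Real.pi * t) * Complex.I) = 1 := by
    rw [neg_mul, Complex.exp_neg, mul_inv_cancel₀ (Complex.exp_ne_zero _)]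
  push_cast
  rw [Complex.two_cos, hm, mul_add, hinv, sq]

theorem det_monodromySub_diracCoeff (t : ℝ) (z : ℂ) :
    (monodromySub (diracCoeff hp hq) diracWeight (multiplier t) z).det =
      -multiplier t * (discriminant hp hq z - (2 * Real.cos (Real.pi * t) : ℝ)) := by
  have hsub : monodromySub (diracCoeff hp hq) diracWeight (multiplier t) z =
      monodromySub (diracCoeff hp hq) diracWeight 0 z - Matrix.scalar (Fin 2) (multiplier t) := by
    ext i j
    simp [monodromySub_apply, Matrix.one_apply, Matrix.diagonal_apply]
  rw [hsub, det_sub_scalar_fin_two, det_monodromySub_diracCoeff_zero, discriminant]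
  linear_combination multiplier_sq_add_one t

theorem det_monodromySub_diracCoeff_eq_zero_iff {t : ℝ} {z : ℂ} :
    (monodromySub (diracCoeff hp hq) diracWeight (multiplier t) z).det = 0 ↔
      discriminant hp hq z = (2 * Real.cos (Real.pi * t) : ℝ) := by
  rw [det_monodromySub_diracCoeff, mul_eq_zero, neg_eq_zero, or_iff_right (multiplier_ne_zero t),
    sub_eq_zero]

theorem deriv_det_monodromySub_diracCoeff (t : ℝ) (z : ℂ) :
    deriv (fun z => (monodromySub (diracCoeff hp hq) diracWeight (multiplier t) z).det) z =
      -multiplier t * deriv (discriminant hp hq) z := by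
  simp only [det_monodromySub_diracCoeff]
  rw [deriv_const_mul _ ((differentiable_discriminant hp hq z).sub_const _), deriv_sub_const]

theorem deriv_det_monodromySub_diracCoeff_ne_zero {z : ℂ}
    (hd : deriv (discriminant hp hq) z ≠ 0) (t : ℝ) :
    deriv (fun z => (monodromySub (diracCoeff hp hq) diracWeight (multiplier t) z).det) z ≠ 0 := by
  rw [deriv_det_monodromySub_diracCoeff]
  exact mul_ne_zero (neg_ne_zero.2 (multiplier_ne_zero t)) hd

end Dirac

/-! ### Bloch eigenvalues -/

section Bloch

variable {p q : ℝ → ℂ} (hp : MemLp p ∞ (volume.restrict (Icc 0 Real.pi)))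
  (hq : MemLp q ∞ (volume.restrict (Icc 0 Real.pi)))

theorem coeFn_mulOp_diracCoeff_sub (f h : L2Period) :
    (mulOp 0 Real.pi _ (diracCoeff hp hq) f - mulOp 0 Real.pi _ diracWeight h : L2Period)
      =ᵐ[volume.restrict (Icc 0 Real.pi)] fun x => jMat (potential p q x (f x)) - jMat (h x) := by
  filter_upwards [Lp.coeFn_sub (mulOp 0 Real.pi _ (diracCoeff hp hq) f)
      (mulOp 0 Real.pi _ diracWeight h), coeFn_mulOp (diracCoeff hp hq) f,
    coeFn_mulOp_const (a := 0) (b := Real.pi) (J := jMat) h, coeFn_diracCoeff hp hq]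
    with x hsub hA hJ hcoeff
  rw [hsub, Pi.sub_apply, hA, diracWeight, hJ, hcoeff]
  rfl

theorem mem_blochOp_iff (t : ℝ) (f h : L2Period) : (f, h) ∈ blochOp p q t ↔
    ∃ c, IsQuasiPeriodicSolution (diracCoeff hp hq) diracWeight (multiplier t) c f h := by
  have hpi : Real.pi ∈ Icc 0 Real.pi := right_mem_Icc.2 Real.pi_pos.le
  have hgen := coeFn_mulOp_diracCoeff_sub hp hq f h
  unfold IsQuasiPeriodicSolution
  set u : L2Period := mulOp 0 Real.pi _ (diracCoeff hp hq) f - mulOp 0 Real.pi _ diracWeight h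
  constructor
  · rintro ⟨y, v, -, hy, hb, hf, hh⟩
    have huv : u =ᵐ[volume.restrict (Icc 0 Real.pi)] v := by
      filter_upwards [hgen, hf, hh] with x hux hfx hhx
      rw [hux, hfx, (eq_diracExpr_iff p q x _ _ _).1 hhx]
    refine ⟨y 0, Lp.ext ?_, ?_⟩
    · filter_upwards [hf, coeFn_const_add_volterra (y 0) u, ae_restrict_mem measurableSet_Icc]
        with x hfx hcx hx
      rw [hcx, intervalIntegral_congr_ae_Icc huv hx, ← hy x hx]
      exact hfx
    · rw [integralIcc_apply, setIntegral_Icc_eq_intervalIntegral Real.pi_pos.le,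
        intervalIntegral_congr_ae_Icc huv hpi, sub_smul, one_smul]
      exact eq_sub_of_add_eq' ((hy _ hpi).symm.trans hb)
  · rintro ⟨c, hf, hc⟩
    have hprim := coeFn_const_add_volterra c u
    rw [← hf] at hprim
    rw [integralIcc_apply, setIntegral_Icc_eq_intervalIntegral Real.pi_pos.le] at hc
    refine ⟨fun x => c + ∫ s in (0 : ℝ)..x, u s, u,
      intervalIntegrable_of_mem_Icc (integrableOn_coeFn u) hpi, fun x _ => by simp, ?_, hprim, ?_⟩
    · simp only [intervalIntegral.integral_same, add_zero, hc, sub_smul, one_smul, add_sub_cancel]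
      rfl
    · filter_upwards [hgen, hprim] with x hux hfx
      rw [eq_diracExpr_iff, hux, ← hfx]

theorem isResolventPencil_blochOp (t : ℝ) : IsResolventPencil (blochOp p q t)
    (quasiPeriodicNum (diracCoeff hp hq) diracWeight (multiplier t))
    (fun z => (monodromySub (diracCoeff hp hq) diracWeight (multiplier t) z).det) :=
  isResolventPencil_quasiPeriodic (mem_blochOp_iff hp hq t)

theorem isEigenvalue_blochOp_iff {t : ℝ} {z : ℂ} : IsEigenvalue (blochOp p q t) z ↔
    discriminant hp hq z = (2 * Real.cos (Real.pi * t) : ℝ) :=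
  (isEigenvalue_iff_det_monodromySub_eq_zero Real.pi_pos (mem_blochOp_iff hp hq t)).trans
    (det_monodromySub_diracCoeff_eq_zero_iff hp hq)

theorem exists_discriminant_ne (t : ℝ) :
    ∃ z, discriminant hp hq z ≠ (2 * Real.cos (Real.pi * t) : ℝ) := by
  let C := ‖mulOp 0 Real.pi _ diracWeight ∘L mulOp 0 Real.pi _ (diracCoeff hp hq)‖
  refine ⟨((C + 1 : ℝ) : ℂ) * Complex.I, fun h => ?_⟩
  obtain ⟨f, hf, hT⟩ := (isEigenvalue_blochOp_iff hp hq).2 h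
  obtain ⟨c, hc⟩ := (mem_blochOp_iff hp hq t _ _).1 hT
  have him : (((C + 1 : ℝ) : ℂ) * Complex.I).im ≤ C := im_le_of_isQuasiPeriodicSolution
    Real.pi_pos.le inner_jMat_left jMat_jMat (norm_multiplier t) hf hc
  rw [Complex.im_ofReal_mul, Complex.I_im, mul_one] at him
  exact (lt_add_one C).not_ge him

theorem isMultipleEigenvalue_of_deriv_discriminant_eq_zero {t : ℝ} {z : ℂ}
    (hz : discriminant hp hq z = (2 * Real.cos (Real.pi * t) : ℝ))
    (hd : deriv (discriminant hp hq) z = 0) : IsMultipleEigenvalue (blochOp p q t) z := by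
  obtain ⟨z₁, hz₁⟩ := exists_discriminant_ne hp hq t
  refine isMultipleEigenvalue_of_deriv_det_eq_zero Real.pi_pos bijective_mulOp_diracWeight
    (mem_blochOp_iff hp hq t) (mt (det_monodromySub_diracCoeff_eq_zero_iff hp hq).1 hz₁)
    ((det_monodromySub_diracCoeff_eq_zero_iff hp hq).2 hz) ?_
  rw [deriv_det_monodromySub_diracCoeff, hd, mul_zero]

theorem rootKer_blochOp_one_le_span_singleton {t : ℝ} {z : ℂ}
    (hd : deriv (discriminant hp hq) z ≠ 0) {Ψ : L2Period}
    (hΨ : IsEigenvector (blochOp p q t) z Ψ) : rootKer (blochOp p q t) z 1 ≤ ℂ ∙ Ψ :=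
  rootKer_one_le_span_singleton (mem_blochOp_iff hp hq t) (monodromySub_ne_zero_of_deriv_det_ne_zero
    (deriv_det_monodromySub_diracCoeff_ne_zero hp hq hd t)) hΨ

theorem algMultiplicity_blochOp_le_one {z : ℂ} (hd : deriv (discriminant hp hq) z ≠ 0) (t : ℝ) :
    algMultiplicity (blochOp p q t) z ≤ 1 := by
  have P := isResolventPencil_blochOp hp hq t
  by_cases h0 : (monodromySub (diracCoeff hp hq) diracWeight (multiplier t) z).det = 0
  · obtain ⟨Ψ, hΨ⟩ := (isEigenvalue_iff_det_monodromySub_eq_zero Real.pi_pos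
      (mem_blochOp_iff hp hq t)).2 h0
    exact P.algMultiplicity_le_one h0 (deriv_det_monodromySub_diracCoeff_ne_zero hp hq hd t)
      (rootKer_blochOp_one_le_span_singleton hp hq hd hΨ)
  · rw [P.algMultiplicity_eq_zero h0]
    exact zero_le_one

/-- The norm of the residue at a simple eigenvalue `z` of the resolvent of `L_t(Q)`, that is, of the
spectral projection. Where the derivative of the discriminant vanishes its value is `0`. -/
noncomputable def residueNorm (t : ℝ) (z : ℂ) : ℝ :=
  ‖quasiPeriodicNum (diracCoeff hp hq) diracWeight (multiplier t) z‖ /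
    ‖deriv (discriminant hp hq) z‖

theorem one_div_norm_inner_eq_residueNorm {t : ℝ} {z : ℂ}
    (hd : deriv (discriminant hp hq) z ≠ 0) {Ψ Ψs : L2Period}
    (hΨ : IsEigenvector (blochOp p q t) z Ψ) (hn : ‖Ψ‖ = 1)
    (hΨs : IsEigenvector (blochOp p q t).adjoint (starRingEnd ℂ z) Ψs) (hns : ‖Ψs‖ = 1) :
    1 / ‖inner ℂ Ψs Ψ‖ = residueNorm hp hq t z := by
  have P := isResolventPencil_blochOp hp hq t
  rw [P.one_div_norm_inner_eq (P.den_eq_zero ⟨Ψ, hΨ⟩)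
    (deriv_det_monodromySub_diracCoeff_ne_zero hp hq hd t) hn hΨs.2 hns
    (rootKer_blochOp_one_le_span_singleton hp hq hd hΨ), deriv_det_monodromySub_diracCoeff,
    norm_mul, norm_neg, norm_multiplier, one_mul, residueNorm]

end Bloch

/-! ### Spectral singularities -/

theorem IsContour.norm_windingNumber_le_one {γ : ℝ → ℂ} (hγ : IsContour γ) {z : ℂ}
    (hz : z ∉ γ '' Icc 0 1) : ‖windingNumber γ z‖ ≤ 1 := by
  rcases hγ.positive z hz with h | h <;> simp [h]

theorem exists_ball_injOn {f : ℂ → ℂ} (hf : Differentiable ℂ f) {z : ℂ} (hd : deriv f z ≠ 0) :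
    ∃ r > 0, InjOn f (Metric.ball z r) ∧ ∀ w ∈ Metric.closedBall z r, deriv f w ≠ 0 := by
  have hs := (hf.analyticAt z).hasStrictDerivAt.hasStrictFDerivAt_equiv hd
  have hsource : (hs.toOpenPartialHomeomorph f).source ∈ 𝓝 z :=
    (hs.toOpenPartialHomeomorph f).open_source.mem_nhds hs.mem_toOpenPartialHomeomorph_source
  have hderiv : ∀ᶠ w in 𝓝 z, deriv f w ≠ 0 :=
    (hf.analyticAt z).deriv.continuousAt.eventually_ne hd
  obtain ⟨r, hr, h⟩ := Metric.nhds_basis_closedBall.mem_iff.1 (inter_mem hsource hderiv)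
  exact ⟨r, hr, (hs.toOpenPartialHomeomorph f).injOn.mono fun w hw =>
    (h (Metric.ball_subset_closedBall hw)).1, fun w hw => (h hw).2⟩

theorem exists_mem_Ioc_two_mul_cos_eq {x : ℝ} (hx : x ∈ Icc (-2) 2) :
    ∃ t ∈ Ioc (-1 : ℝ) 1, 2 * Real.cos (Real.pi * t) = x := by
  have hpi := Real.pi_pos
  have hx2 : x / 2 ∈ Icc (-1) 1 := by constructor <;> linarith [hx.1, hx.2]
  obtain ⟨θ, hθ, hθx⟩ := Real.surjOn_cos hx2
  refine ⟨θ / Real.pi, ⟨by linarith [div_nonneg hθ.1 hpi.le], (div_le_one hpi).2 hθ.2⟩, ?_⟩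
  rw [mul_div_cancel₀ _ hpi.ne', hθx]
  ring

theorem periodic_blochOp (p q : ℝ → ℂ) : Function.Periodic (blochOp p q) 2 := by
  intro t
  have h : Complex.exp (Complex.I * Real.pi * (t + 2 : ℝ)) =
      Complex.exp (Complex.I * Real.pi * t) := by
    rw [← Complex.exp_periodic (Complex.I * Real.pi * t)]
    push_cast
    ring_nf
  simp only [blochOp, h]

section SpectralSingularity

variable {p q : ℝ → ℂ} (hp : MemLp p ∞ (volume.restrict (Icc 0 Real.pi)))
  (hq : MemLp q ∞ (volume.restrict (Icc 0 Real.pi)))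

theorem continuous_deriv_discriminant : Continuous (deriv (discriminant hp hq)) :=
  (differentiable_discriminant hp hq).contDiff.continuous_deriv (n := 1) le_rfl

theorem continuous_quasiPeriodicNum_multiplier : Continuous fun x : ℝ × ℂ =>
    quasiPeriodicNum (diracCoeff hp hq) diracWeight (multiplier x.1) x.2 := by
  have hcomp := (continuous_quasiPeriodicNum (diracCoeff hp hq) diracWeight).comp
    ((continuous_multiplier.comp continuous_fst).prodMk continuous_snd)
  exact hcomp

theorem continuousAt_residueNorm {x : ℝ × ℂ} (hd : deriv (discriminant hp hq) x.2 ≠ 0) :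
    ContinuousAt (fun x : ℝ × ℂ => residueNorm hp hq x.1 x.2) x :=
  (continuous_quasiPeriodicNum_multiplier hp hq).norm.continuousAt.div
    ((continuous_deriv_discriminant hp hq).comp continuous_snd).norm.continuousAt
    (norm_ne_zero_iff.2 hd)

theorem residueNorm_nonneg (t : ℝ) (z : ℂ) : 0 ≤ residueNorm hp hq t z := by
  unfold residueNorm
  positivity

theorem mem_opResolventSet_blochOp_iff {t : ℝ} {z : ℂ} : z ∈ opResolventSet (blochOp p q t) ↔
    discriminant hp hq z ≠ (2 * Real.cos (Real.pi * t) : ℝ) := by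
  refine ⟨fun h hz => ((isEigenvalue_blochOp_iff hp hq).2 hz).notMem_opResolventSet h,
    fun hz => ⟨_, (isResolventPencil_blochOp hp hq t).isResolventAt ?_⟩⟩
  exact mt (det_monodromySub_diracCoeff_eq_zero_iff hp hq).1 hz

theorem contourProjection_eq_zero {t : ℝ} {γ : ℝ → ℂ} (hγ : IsContour γ) {c : ℂ} {r : ℝ}
    (hball : MapsTo γ (Icc 0 1) (Metric.ball c r))
    (hD : ∀ z ∈ Metric.ball c r, discriminant hp hq z ≠ (2 * Real.cos (Real.pi * t) : ℝ)) :
    contourProjection p q t γ = 0 :=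
  (isResolventPencil_blochOp hp hq t).integral_opResolvent_eq_zero hγ.piecewiseC1 hγ.continuousOn
    hγ.closed hball fun z hz => mt (det_monodromySub_diracCoeff_eq_zero_iff hp hq).1 (hD z hz)

theorem norm_contourProjection {t : ℝ} {γ : ℝ → ℂ} (hγ : IsContour γ) {c : ℂ} {r : ℝ}
    (hball : MapsTo γ (Icc 0 1) (Metric.ball c r))
    (hinj : InjOn (discriminant hp hq) (Metric.ball c r)) {z : ℂ} (hz : z ∈ Metric.ball c r)
    (hd : deriv (discriminant hp hq) z ≠ 0)
    (hzt : discriminant hp hq z = (2 * Real.cos (Real.pi * t) : ℝ)) (hzγ : z ∉ γ '' Icc 0 1) :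
    ‖contourProjection p q t γ‖ =
      2 * Real.pi * ‖windingNumber γ z‖ * residueNorm hp hq t z := by
  have hint : contourProjection p q t γ = _ :=
    (isResolventPencil_blochOp hp hq t).integral_opResolvent hγ.piecewiseC1 hγ.continuousOn
    hγ.closed hball hz ((det_monodromySub_diracCoeff_eq_zero_iff hp hq).2 hzt)
    (deriv_det_monodromySub_diracCoeff_ne_zero hp hq hd t)
    (fun w hw h => hinj hw hz
      (((det_monodromySub_diracCoeff_eq_zero_iff hp hq).1 h).trans hzt.symm))
    (fun s hs h => hzγ ⟨s, hs, h⟩)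
  have htwoPi : ‖(2 * Real.pi * Complex.I : ℂ)‖ = 2 * Real.pi := by
    simp [abs_of_pos Real.pi_pos]
  rw [hint, norm_smul, norm_smul, norm_mul, htwoPi, norm_inv,
    deriv_det_monodromySub_diracCoeff, norm_mul, norm_neg, norm_multiplier, residueNorm]
  ring

theorem norm_contourProjection_le {t : ℝ} {γ : ℝ → ℂ} (hγ : IsContour γ) {c : ℂ} {r C : ℝ}
    (hball : MapsTo γ (Icc 0 1) (Metric.ball c r))
    (hinj : InjOn (discriminant hp hq) (Metric.ball c r))
    (hd : ∀ z ∈ Metric.ball c r, deriv (discriminant hp hq) z ≠ 0)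
    (hres : ∀ s ∈ Icc (0 : ℝ) 1, γ s ∈ opResolventSet (blochOp p q t)) (hC₀ : 0 ≤ C)
    (hC : ∀ z ∈ Metric.ball c r, residueNorm hp hq t z ≤ C) :
    ‖contourProjection p q t γ‖ ≤ 2 * Real.pi * C := by
  by_cases hz : ∃ z ∈ Metric.ball c r, discriminant hp hq z = (2 * Real.cos (Real.pi * t) : ℝ)
  · obtain ⟨z, hz, hzt⟩ := hz
    have hzγ : z ∉ γ '' Icc 0 1 := by
      rintro ⟨s, hs, rfl⟩
      exact (mem_opResolventSet_blochOp_iff hp hq).1 (hres s hs) hzt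
    rw [norm_contourProjection hp hq hγ hball hinj hz (hd z hz) hzt hzγ]
    exact mul_le_mul
      (mul_le_of_le_one_right Real.two_pi_pos.le (hγ.norm_windingNumber_le_one hzγ)) (hC z hz)
      (residueNorm_nonneg hp hq t z) Real.two_pi_pos.le
  · push Not at hz
    rw [contourProjection_eq_zero hp hq hγ hball hz, norm_zero]
    positivity

theorem deriv_discriminant_eq_zero_of_isSpectralSingularity {lam : ℂ}
    (h : IsSpectralSingularity p q lam) : deriv (discriminant hp hq) lam = 0 := by
  by_contra hd
  obtain ⟨r, hr, hinj, hne⟩ := exists_ball_injOn (differentiable_discriminant hp hq) hd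
  obtain ⟨C, hC⟩ := (isCompact_Icc.prod (isCompact_closedBall lam r)).exists_bound_of_continuousOn
    (s := Icc (-1) 1 ×ˢ Metric.closedBall lam r)
    (fun x hx => (continuousAt_residueNorm hp hq (hne x.2 hx.2)).continuousWithinAt)
  have hbound : ∀ t ∈ Ioc (-1 : ℝ) 1, ∀ z ∈ Metric.ball lam r, residueNorm hp hq t z ≤ max C 0 :=
    fun t ht z hz => ((Real.le_norm_self _).trans (hC (t, z)
      ⟨Ioc_subset_Icc_self ht, Metric.ball_subset_closedBall hz⟩)).trans (le_max_left _ _)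
  obtain ⟨γ, hγ, hlim⟩ := h.2 r hr
  obtain ⟨n, hn⟩ := (hlim.eventually_const_lt
    (ENNReal.ofReal_lt_top (r := 2 * Real.pi * max C 0))).exists
  refine hn.not_ge (iSup_le fun t => iSup_le fun ht => iSup_le fun hres => ?_)
  rw [← ofReal_norm]
  exact ENNReal.ofReal_le_ofReal (norm_contourProjection_le hp hq (hγ n).1 (hγ n).2.1 hinj
    (fun z hz => hne z (Metric.ball_subset_closedBall hz)) hres (le_max_right _ _) (hbound t ht))

theorem exists_discriminant_eq_of_isSpectralSingularity {lam : ℂ}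
    (h : IsSpectralSingularity p q lam) :
    ∃ t ∈ Ioc (-1 : ℝ) 1, discriminant hp hq lam = (2 * Real.cos (Real.pi * t) : ℝ) := by
  by_contra! hne
  let K : Set ℂ := Complex.ofReal '' Icc (-2) 2
  have hK : IsClosed K := (isCompact_Icc.image Complex.continuous_ofReal).isClosed
  have hlam : discriminant hp hq lam ∉ K := by
    rintro ⟨x, hx, hxlam⟩
    obtain ⟨t, ht, rfl⟩ := exists_mem_Ioc_two_mul_cos_eq hx
    exact hne t ht hxlam.symm
  obtain ⟨r, hr, hball⟩ := Metric.mem_nhds_iff.1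
    ((differentiable_discriminant hp hq).continuous.continuousAt.preimage_mem_nhds
      (hK.isOpen_compl.mem_nhds hlam))
  have hD : ∀ t : ℝ, ∀ z ∈ Metric.ball lam r,
      discriminant hp hq z ≠ (2 * Real.cos (Real.pi * t) : ℝ) := by
    refine fun t z hz hzt => hball hz ⟨_, ?_, hzt.symm⟩
    constructor <;> linarith [Real.neg_one_le_cos (Real.pi * t), Real.cos_le_one (Real.pi * t)]
  obtain ⟨γ, hγ, hlim⟩ := h.2 r hr
  obtain ⟨n, hn⟩ := (hlim.eventually_const_lt ENNReal.zero_lt_top).exists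
  refine hn.not_ge (iSup_le fun t => iSup_le fun _ => iSup_le fun _ => ?_)
  rw [← ofReal_norm, contourProjection_eq_zero hp hq (hγ n).1 (hγ n).2.1 (hD t), norm_zero,
    ENNReal.ofReal_zero]

theorem isMultipleEigenvalue_of_isSpectralSingularity (hp : MemLp p ∞ (volume.restrict
    (Icc 0 Real.pi))) (hq : MemLp q ∞ (volume.restrict (Icc 0 Real.pi))) {lam : ℂ}
    (h : IsSpectralSingularity p q lam) :
    ∃ t ∈ Ioc (-1 : ℝ) 1, IsMultipleEigenvalue (blochOp p q t) lam := by
  obtain ⟨t, ht, hlam⟩ := exists_discriminant_eq_of_isSpectralSingularity hp hq h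
  exact ⟨t, ht, isMultipleEigenvalue_of_deriv_discriminant_eq_zero hp hq hlam
    (deriv_discriminant_eq_zero_of_isSpectralSingularity hp hq h)⟩

theorem enclosesAtMostOne_circlePath {c : ℂ} {r : ℝ} (hr : 0 ≤ r)
    (hinj : InjOn (discriminant hp hq) (Metric.ball c r))
    (hd : ∀ w ∈ Metric.ball c r, deriv (discriminant hp hq) w ≠ 0) (t : ℝ) :
    EnclosesAtMostOne p q t (circlePath c r) := by
  refine ⟨fun w w' hw hw' he he' => hinj (hw.mem_ball hr) (hw'.mem_ball hr) ?_,
    fun w hw => algMultiplicity_blochOp_le_one hp hq (hd w (hw.mem_ball hr)) t⟩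
  exact ((isEigenvalue_blochOp_iff hp hq).1 he).trans ((isEigenvalue_blochOp_iff hp hq).1 he').symm

theorem exists_isContour_norm_contourProjection_eq {lam z : ℂ} {ε : ℝ}
    (hz : z ∈ Metric.ball lam ε) (hd : deriv (discriminant hp hq) z ≠ 0) :
    ∃ γ, IsContour γ ∧ (∀ s ∈ Icc (0 : ℝ) 1, γ s ∈ Metric.ball lam ε) ∧
      (∀ t, EnclosesAtMostOne p q t γ) ∧
      ∀ t, IsEigenvalue (blochOp p q t) z →
        (∀ s ∈ Icc (0 : ℝ) 1, γ s ∈ opResolventSet (blochOp p q t)) ∧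
        ‖contourProjection p q t γ‖ = 2 * Real.pi * residueNorm hp hq t z := by
  obtain ⟨r, hr, hinj, hne⟩ := exists_ball_injOn (differentiable_discriminant hp hq) hd
  obtain ⟨r', hr', hsub⟩ := Metric.isOpen_iff.1 Metric.isOpen_ball z hz
  obtain ⟨ρ, hρ, hρmin⟩ := exists_between (lt_min hr hr')
  have hρr : ρ < r := hρmin.trans_le (min_le_left _ _)
  have hsphere := circlePath_mem_sphere z hρ.le
  have hball : MapsTo (circlePath z ρ) (Icc 0 1) (Metric.ball z r) :=
    fun s _ => Metric.sphere_subset_closedBall.trans (Metric.closedBall_subset_ball hρr) (hsphere s)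
  have hzγ : z ∉ circlePath z ρ '' Icc 0 1 := by
    rintro ⟨s, -, hs⟩
    have hdist := hsphere s
    rw [hs, Metric.mem_sphere, dist_self] at hdist
    exact hρ.ne hdist
  refine ⟨circlePath z ρ, isContour_circlePath z hρ, fun s _ => hsub <|
    Metric.sphere_subset_closedBall.trans
      (Metric.closedBall_subset_ball (hρmin.trans_le (min_le_right _ _))) (hsphere s),
    enclosesAtMostOne_circlePath hp hq hρ.le (hinj.mono (Metric.ball_subset_ball hρr.le))
      fun w hw => hne w (Metric.ball_subset_closedBall.trans
        (Metric.closedBall_subset_closedBall hρr.le) hw), fun t ht => ?_⟩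
  rw [isEigenvalue_blochOp_iff hp hq] at ht
  refine ⟨fun s hs => (mem_opResolventSet_blochOp_iff hp hq).2 fun hst => hzγ ⟨s, hs, ?_⟩, ?_⟩
  · exact hinj (hball hs) (Metric.mem_ball_self hr) (hst.trans ht.symm)
  · rw [norm_contourProjection hp hq (isContour_circlePath z hρ) hball hinj
      (Metric.mem_ball_self hr) hd ht hzγ,
      windingNumber_circlePath_of_mem_ball (Metric.mem_ball_self hρ), norm_one, mul_one]

theorem isSpectralSingularity_of_forall_exists_le_residueNorm {lam : ℂ}
    (hspec : lam ∈ opSpectrum (diracOp p q))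
    (h : ∀ ε > 0, ∀ n : ℕ, ∃ t : ℝ, ∃ z ∈ Metric.ball lam ε, IsEigenvalue (blochOp p q t) z ∧
      deriv (discriminant hp hq) z ≠ 0 ∧ n ≤ residueNorm hp hq t z) :
    IsSpectralSingularity p q lam := by
  refine ⟨hspec, fun ε hε => ?_⟩
  choose t z hz ht hd hn using h ε hε
  choose γ hγ hball hone hnorm using
    fun n => exists_isContour_norm_contourProjection_eq hp hq (hz n) (hd n)
  refine ⟨γ, fun n => ⟨hγ n, hball n, fun t _ => hone n t⟩,
    tendsto_nhds_top_mono ENNReal.tendsto_nat_nhds_top (Eventually.of_forall fun n => ?_)⟩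
  obtain ⟨hres, hproj⟩ := hnorm n (t n) (ht n)
  obtain ⟨t', ht', hper⟩ := (periodic_blochOp p q).exists_mem_Ioc two_pos (t n) (-1)
  rw [show (-1 : ℝ) + 2 = 1 by norm_num] at ht'
  refine le_iSup_of_le t' (le_iSup_of_le ht' (le_iSup_of_le (hper ▸ hres) ?_))
  rw [contourProjection, ← hper, ← contourProjection, ← ofReal_norm, hproj]
  refine (ENNReal.ofReal_natCast n).symm.trans_le ?_
  refine ENNReal.ofReal_le_ofReal ((hn n).trans
    (le_mul_of_one_le_left (residueNorm_nonneg hp hq _ _) ?_))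
  linarith [Real.pi_gt_three]

end SpectralSingularity

/-! ### Essential spectral singularities -/

theorem eventually_deriv_pow_mul {g : ℂ → ℂ} {z₀ : ℂ} (hg : AnalyticAt ℂ g z₀) (m : ℕ) :
    ∀ᶠ z in 𝓝 z₀, deriv (fun w => (w - z₀) ^ (m + 1) * g w) z =
      (z - z₀) ^ m * ((m + 1) * g z + (z - z₀) * deriv g z) := by
  filter_upwards [hg.eventually_analyticAt] with z hgz
  refine ((((hasDerivAt_id z).sub_const z₀).pow (m + 1)).mul
    hgz.differentiableAt.hasDerivAt).deriv.trans ?_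
  simp only [id_eq, Pi.pow_apply, add_tsub_cancel_right, Nat.cast_add, Nat.cast_one]
  ring

/-- Łojasiewicz' inequality. -/
theorem exists_norm_sub_rpow_isBigO_deriv {f : ℂ → ℂ} {z₀ : ℂ} (hf : AnalyticAt ℂ f z₀) :
    ∃ r ∈ Ico (0 : ℝ) 1, (fun z => ‖f z - f z₀‖ ^ r) =O[𝓝 z₀] deriv f := by
  by_cases hconst : ∀ᶠ z in 𝓝 z₀, f z - f z₀ = 0
  · refine ⟨1 / 2, by norm_num, (Asymptotics.isBigO_zero _ _).congr' ?_ EventuallyEq.rfl⟩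
    filter_upwards [hconst] with z hz
    rw [hz, norm_zero, Real.zero_rpow (by norm_num)]
  obtain ⟨n, g, hg, hg₀, hfg⟩ :=
    (hf.fun_sub analyticAt_const).exists_eventuallyEq_pow_smul_nonzero_iff.2 hconst
  obtain ⟨m, rfl⟩ : ∃ m, n = m + 1 := Nat.exists_eq_succ_of_ne_zero <| by
    rintro rfl
    exact hg₀ (by simpa using hfg.self_of_nhds.symm)
  let k : ℂ → ℂ := fun z => (m + 1) * g z + (z - z₀) * deriv g z
  have hk : ContinuousAt k z₀ := by
    have := hg.continuousAt
    have := hg.deriv.continuousAt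
    fun_prop
  have hk₀ : k z₀ ≠ 0 := by simpa [k, hg₀] using Nat.cast_add_one_ne_zero m
  have hderiv : deriv f =ᶠ[𝓝 z₀] fun z => (z - z₀) ^ m * k z := by
    have hfg' : f =ᶠ[𝓝 z₀] fun z => f z₀ + (z - z₀) ^ (m + 1) * g z := by
      filter_upwards [hfg] with z hz
      rw [← smul_eq_mul, ← hz, add_sub_cancel]
    filter_upwards [hfg'.deriv, eventually_deriv_pow_mul hg m] with z hz hz'
    rw [hz, deriv_const_add, hz']
  have hpow : (fun z => (z - z₀) ^ m) =O[𝓝 z₀] deriv f := by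
    have hone : (fun _ => (1 : ℂ)) =O[𝓝 z₀] k := (Asymptotics.isBigO_const_const 1 hk₀ _).trans
      ((Asymptotics.isEquivalent_const_iff_tendsto hk₀).2 hk.tendsto).isBigO_symm
    have hmul := (Asymptotics.isBigO_refl (fun z => (z - z₀) ^ m) (𝓝 z₀)).mul hone
    exact hmul.congr' (.of_eq (by simp)) hderiv.symm
  have hsub : (fun z => f z - f z₀) =O[𝓝 z₀] fun z => (z - z₀) ^ (m + 1) := by
    have hmul := (Asymptotics.isBigO_refl (fun z => (z - z₀) ^ (m + 1)) (𝓝 z₀)).mul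
      (hg.continuousAt.tendsto.isBigO_one ℂ)
    exact hmul.congr' (EventuallyEq.symm hfg) (.of_eq (by simp))
  refine ⟨m / (m + 1), ⟨by positivity, (div_lt_one (by positivity)).2 (lt_add_one _)⟩, ?_⟩
  refine ((hsub.norm_norm.rpow (by positivity)
    (Eventually.of_forall fun z => norm_nonneg _)).congr_right fun z => ?_).trans hpow.norm_left
  rw [norm_pow, ← Real.rpow_natCast, ← Real.rpow_mul (norm_nonneg _), Nat.cast_add, Nat.cast_one,
    mul_div_cancel₀ _ (by positivity), Real.rpow_natCast, norm_pow]

theorem eventually_cos_ne (t₀ : ℝ) :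
    ∀ᶠ t in 𝓝[≠] t₀, Real.cos (Real.pi * t) ≠ Real.cos (Real.pi * t₀) := by
  by_contra h
  have hfreq : ∃ᶠ t in 𝓝[≠] t₀, Real.cos (Real.pi * t) = Real.cos (Real.pi * t₀) :=
    (not_eventually.1 h).mono fun t => not_not.1
  have han : AnalyticOnNhd ℝ (fun t : ℝ => Real.cos (Real.pi * t)) univ :=
    fun t _ => Real.analyticAt_cos.comp (analyticAt_const.mul analyticAt_id)
  have heq := han.eqOn_of_preconnected_of_frequently_eq analyticOnNhd_const isPreconnected_univ
    (mem_univ t₀) hfreq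
  have h01 := (heq (mem_univ 0)).trans (heq (mem_univ 1)).symm
  norm_num at h01

theorem integrableAtFilter_abs_sub_rpow {r : ℝ} (hr : -1 < r) (t₀ : ℝ) :
    IntegrableAtFilter (fun t => |t - t₀| ^ r) (𝓝 t₀) := by
  have hpos : IntervalIntegrable (fun t : ℝ => |t| ^ r) volume 0 1 := by
    refine (intervalIntegral.intervalIntegrable_rpow' hr).congr fun t ht => ?_
    rw [uIoc_of_le zero_le_one] at ht
    rw [abs_of_pos ht.1]
  have hneg : IntervalIntegrable (fun t : ℝ => |t| ^ r) volume (-1) 0 := by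
    have := (IntervalIntegrable.iff_comp_neg (f := fun t : ℝ => |t| ^ r)).1 hpos
    simpa using this.symm
  have hsub := (hneg.trans hpos).comp_sub_right t₀
  rw [intervalIntegrable_iff_integrableOn_Ioo_of_le (by linarith)] at hsub
  exact ⟨_, Ioo_mem_nhds (by linarith) (by linarith), hsub⟩

instance isMeasurablyGenerated_nhdsNE {α : Type*} [TopologicalSpace α] [MeasurableSpace α]
    [OpensMeasurableSpace α] [MeasurableSingletonClass α] (x : α) :
    (𝓝[≠] x).IsMeasurablyGenerated :=
  (measurableSet_singleton x).compl.nhdsWithin_isMeasurablyGenerated x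

theorem stronglyMeasurableAtFilter_of_eventually_continuousAt {α β : Type*} [TopologicalSpace α]
    [MeasurableSpace α] [OpensMeasurableSpace α] [SecondCountableTopology α] [TopologicalSpace β]
    [TopologicalSpace.PseudoMetrizableSpace β]
    {f : α → β} {l : Filter α} [l.IsMeasurablyGenerated] {μ : Measure α}
    (h : ∀ᶠ x in l, ContinuousAt f x) : StronglyMeasurableAtFilter f l μ := by
  obtain ⟨s, hs, hsm, hcont⟩ := h.exists_measurable_mem
  exact ⟨s, hs, ContinuousOn.aestronglyMeasurable
    (fun x hx => (hcont x hx).continuousWithinAt) hsm⟩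

section EssentialSpectralSingularity

variable {p q : ℝ → ℂ} (hp : MemLp p ∞ (volume.restrict (Icc 0 Real.pi)))
  (hq : MemLp q ∞ (volume.restrict (Icc 0 Real.pi)))

/-- A branch `μ` of eigenvalues of `L_t(Q)`, continuous near `t₀` with `μ(t₀) = lam`, along which
the norm of the spectral projection is not integrable at `t₀`. -/
structure IsEssentialBranch (lam : ℂ) (t₀ : ℝ) (μ : ℝ → ℂ) : Prop where
  apply_eq : μ t₀ = lam
  eventually_continuousAt : ∀ᶠ t in 𝓝 t₀, ContinuousAt μ t
  eventually_discriminant_eq :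
    ∀ᶠ t in 𝓝 t₀, discriminant hp hq (μ t) = (2 * Real.cos (Real.pi * t) : ℝ)
  not_integrableAtFilter :
    ¬ IntegrableAtFilter (fun t => residueNorm hp hq t (μ t)) (𝓝[≠] t₀)

theorem exists_abs_cos_sub_rpow_isBigO_deriv_discriminant {μ : ℝ → ℂ} {t₀ : ℝ}
    (hμ : ContinuousAt μ t₀)
    (hD : ∀ᶠ t in 𝓝 t₀, discriminant hp hq (μ t) = (2 * Real.cos (Real.pi * t) : ℝ)) :
    ∃ r ∈ Ico (0 : ℝ) 1, (fun t => |2 * Real.cos (Real.pi * t) - 2 * Real.cos (Real.pi * t₀)| ^ r)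
      =O[𝓝 t₀] fun t => deriv (discriminant hp hq) (μ t) := by
  obtain ⟨r, hr, hO⟩ := exists_norm_sub_rpow_isBigO_deriv
    ((differentiable_discriminant hp hq).analyticAt (μ t₀))
  refine ⟨r, hr, (hO.comp_tendsto hμ.tendsto).congr' ?_ EventuallyEq.rfl⟩
  filter_upwards [hD] with t ht
  rw [Function.comp_apply, ht, hD.self_of_nhds, ← Complex.ofReal_sub, Complex.norm_real,
    Real.norm_eq_abs]

theorem eventually_deriv_discriminant_ne_zero {μ : ℝ → ℂ} {t₀ : ℝ} (hμ : ContinuousAt μ t₀)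
    (hD : ∀ᶠ t in 𝓝 t₀, discriminant hp hq (μ t) = (2 * Real.cos (Real.pi * t) : ℝ)) :
    ∀ᶠ t in 𝓝[≠] t₀, deriv (discriminant hp hq) (μ t) ≠ 0 := by
  obtain ⟨r, -, hO⟩ := exists_abs_cos_sub_rpow_isBigO_deriv_discriminant hp hq hμ hD
  filter_upwards [(hO.mono nhdsWithin_le_nhds).eq_zero_imp, eventually_cos_ne t₀] with t ht hcos h
  refine (Real.rpow_pos_of_pos (abs_pos.2 ?_) r).ne' (ht h)
  rw [← mul_sub]
  exact mul_ne_zero two_ne_zero (sub_ne_zero.2 hcos)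

theorem IsEssentialSpectralSingularity.exists_isEssentialBranch {lam : ℂ}
    (h : IsEssentialSpectralSingularity p q lam) :
    ∃ t₀ ∈ Ioc (-1 : ℝ) 1, ∃ μ, IsEssentialBranch hp hq lam t₀ μ := by
  obtain ⟨t₀, ht₀, μ, Ψ, Ψs, hμ, ⟨δ, hδ, hcont, hdata⟩, hint⟩ := h
  have hI : Ioo (t₀ - δ) (t₀ + δ) ∈ 𝓝 t₀ := Ioo_mem_nhds (by linarith) (by linarith)
  have hD : ∀ᶠ t in 𝓝 t₀, discriminant hp hq (μ t) = (2 * Real.cos (Real.pi * t) : ℝ) := by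
    filter_upwards [hI] with t ht
    exact (isEigenvalue_blochOp_iff hp hq).1 ⟨_, (hdata t ht).1⟩
  have hμc : ∀ᶠ t in 𝓝 t₀, ContinuousAt μ t := by
    filter_upwards [hI] with t ht
    exact hcont.continuousAt (isOpen_Ioo.mem_nhds ht)
  have heq : ∀ᶠ t in 𝓝[≠] t₀, 1 / ‖inner ℂ (Ψs t) (Ψ t)‖ = residueNorm hp hq t (μ t) := by
    filter_upwards [eventually_deriv_discriminant_ne_zero hp hq hμc.self_of_nhds hD,
      mem_nhdsWithin_of_mem_nhds hI] with t hd ht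
    obtain ⟨hΨ, hn, hΨs, hns⟩ := hdata t ht
    exact one_div_norm_inner_eq_residueNorm hp hq hd hΨ hn hΨs hns
  refine ⟨t₀, ht₀, μ, hμ, hμc, hD, ?_⟩
  rintro ⟨s, hs, hints⟩
  obtain ⟨ε, hε, hball⟩ := Metric.mem_nhdsWithin_iff.1 (inter_mem hs heq)
  rw [Real.ball_eq_Ioo] at hball
  have hmeas : MeasurableSet (Ioo (t₀ - ε) (t₀ + ε) ∩ {t₀}ᶜ) :=
    measurableSet_Ioo.inter (measurableSet_singleton t₀).compl
  refine hint ε hε (IntegrableOn.congr_set_ae ((hints.mono_set fun t ht => (hball ht).1).congr_fun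
    (fun t ht => (hball ht).2.symm) hmeas) ?_)
  exact (inter_ae_eq_left_of_ae_eq_univ
    (eventuallyEq_univ.2 (compl_mem_ae_iff.2 (measure_singleton t₀)))).symm

namespace IsEssentialBranch

variable {hp hq} {lam : ℂ} {t₀ : ℝ} {μ : ℝ → ℂ}

theorem discriminant_eq (h : IsEssentialBranch hp hq lam t₀ μ) :
    discriminant hp hq lam = (2 * Real.cos (Real.pi * t₀) : ℝ) := by
  rw [← h.apply_eq]
  exact h.eventually_discriminant_eq.self_of_nhds

theorem continuousAt (h : IsEssentialBranch hp hq lam t₀ μ) : ContinuousAt μ t₀ :=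
  h.eventually_continuousAt.self_of_nhds

theorem eventually_deriv_discriminant_ne_zero (h : IsEssentialBranch hp hq lam t₀ μ) :
    ∀ᶠ t in 𝓝[≠] t₀, deriv (discriminant hp hq) (μ t) ≠ 0 :=
  _root_.eventually_deriv_discriminant_ne_zero hp hq h.continuousAt h.eventually_discriminant_eq

theorem stronglyMeasurableAtFilter (h : IsEssentialBranch hp hq lam t₀ μ) :
    StronglyMeasurableAtFilter (fun t => residueNorm hp hq t (μ t)) (𝓝[≠] t₀) := by
  refine stronglyMeasurableAtFilter_of_eventually_continuousAt ?_
  filter_upwards [h.eventually_deriv_discriminant_ne_zero,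
    h.eventually_continuousAt.filter_mono nhdsWithin_le_nhds] with t hd hμ
  exact (continuousAt_residueNorm hp hq (x := (t, μ t)) hd).comp₂ continuousAt_id hμ

theorem not_isBoundedUnder (h : IsEssentialBranch hp hq lam t₀ μ) :
    ¬ (𝓝[≠] t₀).IsBoundedUnder (· ≤ ·) fun t => ‖residueNorm hp hq t (μ t)‖ := fun hb =>
  h.not_integrableAtFilter (Measure.FiniteAtFilter.integrableAtFilter h.stronglyMeasurableAtFilter
    ((volume.finiteAt_nhds t₀).filter_mono nhdsWithin_le_nhds) hb)

theorem deriv_discriminant_eq_zero (h : IsEssentialBranch hp hq lam t₀ μ) :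
    deriv (discriminant hp hq) lam = 0 := by
  by_contra hd
  rw [← h.apply_eq] at hd
  have hcont : ContinuousAt (fun t => residueNorm hp hq t (μ t)) t₀ :=
    (continuousAt_residueNorm hp hq (x := (t₀, μ t₀)) hd).comp₂ continuousAt_id h.continuousAt
  exact h.not_isBoundedUnder
    (hcont.tendsto.mono_left nhdsWithin_le_nhds).norm.isBoundedUnder_le

/-- If `cos πt` is not critical at `t₀`, Łojasiewicz' inequality bounds the residue norm by
`|t - t₀| ^ (-r)` with `r < 1`, which is integrable. -/
theorem sin_eq_zero (h : IsEssentialBranch hp hq lam t₀ μ) : Real.sin (Real.pi * t₀) = 0 := by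
  by_contra hs
  obtain ⟨r, hr, hO⟩ := exists_abs_cos_sub_rpow_isBigO_deriv_discriminant hp hq h.continuousAt
    h.eventually_discriminant_eq
  have hcos : HasDerivAt (fun t : ℝ => 2 * Real.cos (Real.pi * t))
      (2 * (-Real.sin (Real.pi * t₀) * (Real.pi * 1))) t₀ :=
    (((hasDerivAt_id t₀).const_mul Real.pi).cos).const_mul 2
  have hlin : (fun t => |t - t₀| ^ r) =O[𝓝[≠] t₀] fun t => deriv (discriminant hp hq) (μ t) := by
    refine Asymptotics.IsBigO.mono (.trans ?_ hO) nhdsWithin_le_nhds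
    have hrev := (hcos.isTheta_sub (by simp [hs, Real.pi_ne_zero])).isBigO_symm.comp_tendsto
      (tendsto_id.prodMk tendsto_const_pure)
    exact hrev.abs_abs.rpow hr.1 (Eventually.of_forall fun t => abs_nonneg _)
  have hnum : (fun t => quasiPeriodicNum (diracCoeff hp hq) diracWeight (multiplier t) (μ t))
      =O[𝓝[≠] t₀] fun _ => (1 : ℝ) :=
    (((continuous_quasiPeriodicNum_multiplier hp hq).continuousAt.comp
      (continuousAt_id.prodMk h.continuousAt)).tendsto.mono_left nhdsWithin_le_nhds).isBigO_one ℝ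
  have hbound : (fun t => residueNorm hp hq t (μ t)) =O[𝓝[≠] t₀] fun t => |t - t₀| ^ (-r) := by
    have hinv := hlin.inv_rev <| eventually_mem_nhdsWithin.mono fun t ht h0 =>
      absurd h0 (Real.rpow_pos_of_pos (abs_pos.2 (sub_ne_zero.2 ht)) r).ne'
    refine (hnum.norm_left.mul hinv.norm_left).congr (fun t => ?_) fun t => ?_
    · rw [residueNorm, norm_inv, div_eq_mul_inv]
    · rw [one_mul, Real.rpow_neg (abs_nonneg _)]
  exact h.not_integrableAtFilter (hbound.integrableAtFilter h.stronglyMeasurableAtFilter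
    ((integrableAtFilter_abs_sub_rpow (neg_lt_neg hr.2) t₀).filter_mono nhdsWithin_le_nhds))

theorem eq_zero_or_eq_one (h : IsEssentialBranch hp hq lam t₀ μ) (ht₀ : t₀ ∈ Ioc (-1) 1) :
    t₀ = 0 ∨ t₀ = 1 := by
  obtain ⟨n, hn⟩ := Real.sin_eq_zero_iff.1 h.sin_eq_zero
  obtain rfl : (n : ℝ) = t₀ := mul_right_cancel₀ Real.pi_ne_zero (hn.trans (mul_comm _ _))
  have hgt : -1 < n := by exact_mod_cast ht₀.1
  have hle : n ≤ 1 := by exact_mod_cast ht₀.2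
  interval_cases n <;> simp

theorem isMultipleEigenvalue (h : IsEssentialBranch hp hq lam t₀ μ) :
    IsMultipleEigenvalue (blochOp p q t₀) lam :=
  isMultipleEigenvalue_of_deriv_discriminant_eq_zero hp hq h.discriminant_eq
    h.deriv_discriminant_eq_zero

theorem exists_le_residueNorm (h : IsEssentialBranch hp hq lam t₀ μ) {ε : ℝ} (hε : 0 < ε) (C : ℝ) :
    ∃ t : ℝ, ∃ z ∈ Metric.ball lam ε, IsEigenvalue (blochOp p q t) z ∧
      deriv (discriminant hp hq) z ≠ 0 ∧ C ≤ residueNorm hp hq t z := by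
  have hfreq : ∃ᶠ t in 𝓝[≠] t₀, C ≤ residueNorm hp hq t (μ t) := fun hev =>
    h.not_isBoundedUnder ⟨C, eventually_map.2 <| hev.mono fun t ht => by
      rw [Real.norm_of_nonneg (residueNorm_nonneg hp hq _ _)]
      exact (not_le.1 ht).le⟩
  have hball : ∀ᶠ t in 𝓝 t₀, μ t ∈ Metric.ball lam ε :=
    h.continuousAt.preimage_mem_nhds (h.apply_eq.symm ▸ Metric.ball_mem_nhds lam hε)
  obtain ⟨t, hC, ⟨hz, hD⟩, hd⟩ := (hfreq.and_eventually
    (((hball.and h.eventually_discriminant_eq).filter_mono nhdsWithin_le_nhds).and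
      h.eventually_deriv_discriminant_ne_zero)).exists
  exact ⟨t, μ t, hz, (isEigenvalue_blochOp_iff hp hq).2 hD, hd, hC⟩

end IsEssentialBranch

end EssentialSpectralSingularity

/-! ### The spectrum of the operator on the line -/

theorem mem_opSpectrum_of_forall_exists_norm_le {H : Type*} [NormedAddCommGroup H]
    [InnerProductSpace ℂ H] {T : Submodule ℂ (H × H)} {z : ℂ}
    (h : ∀ ε > 0, ∃ f g : H, (f, g + z • f) ∈ T ∧ f ≠ 0 ∧ ‖g‖ ≤ ε * ‖f‖) : z ∈ opSpectrum T := by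
  rintro ⟨R, hR⟩
  obtain ⟨f, g, hfg, hf, hle⟩ := h (‖R‖ + 1)⁻¹ (by positivity)
  have hlt : ‖f‖ < ‖f‖ := calc
    ‖f‖ = ‖R g‖ := by rw [(hR f g).2 hfg]
    _ ≤ ‖R‖ * ‖g‖ := R.le_opNorm g
    _ ≤ ‖R‖ * ((‖R‖ + 1)⁻¹ * ‖f‖) := by gcongr
    _ = ‖R‖ / (‖R‖ + 1) * ‖f‖ := by ring
    _ < ‖f‖ := mul_lt_of_lt_one_left (norm_pos_iff.2 hf)
      ((div_lt_one (by positivity)).2 (lt_add_one _))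
  exact hlt.false

/-- A positive square integrable function whose logarithmic derivative is bounded by `ε`. -/
noncomputable def cutoff (ε x : ℝ) : ℝ := (1 + (ε * x) ^ 2)⁻¹

theorem cutoff_pos (ε x : ℝ) : 0 < cutoff ε x := by
  unfold cutoff
  positivity

theorem cutoff_le_one (ε x : ℝ) : cutoff ε x ≤ 1 :=
  inv_le_one_of_one_le₀ (le_add_of_nonneg_right (sq_nonneg _))

theorem contDiff_cutoff (ε : ℝ) : ContDiff ℝ 1 (cutoff ε) :=
  ContDiff.inv (by fun_prop) fun x => by positivity

theorem deriv_cutoff (ε x : ℝ) : deriv (cutoff ε) x = -(2 * ε * (ε * x)) * cutoff ε x ^ 2 := by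
  have hden : HasDerivAt (fun x => 1 + (ε * x) ^ 2) (2 * ε * (ε * x)) x := by
    refine ((((hasDerivAt_id' x).const_mul ε).fun_pow 2).const_add 1).congr_deriv ?_
    push_cast
    ring
  refine (hden.fun_inv (by positivity)).deriv.trans ?_
  rw [cutoff, inv_pow, div_eq_mul_inv]

theorem abs_deriv_cutoff_le {ε : ℝ} (hε : 0 ≤ ε) (x : ℝ) :
    |deriv (cutoff ε) x| ≤ ε * cutoff ε x := by
  have hsq : 2 * |ε * x| ≤ 1 + (ε * x) ^ 2 := by
    rw [← sq_abs (ε * x)]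
    linarith [sq_nonneg (|ε * x| - 1)]
  calc |deriv (cutoff ε) x| = ε * (2 * |ε * x|) * cutoff ε x ^ 2 := by
        rw [deriv_cutoff, abs_mul, abs_neg, abs_mul, abs_mul, abs_two, abs_of_nonneg hε, abs_sq]
        ring
    _ ≤ ε * (1 + (ε * x) ^ 2) * cutoff ε x ^ 2 := by gcongr
    _ = ε * cutoff ε x := by
        unfold cutoff
        field_simp

theorem memLp_cutoff {ε : ℝ} (hε : ε ≠ 0) : MemLp (cutoff ε) 2 := by
  have hcont := (contDiff_cutoff ε).continuous
  rw [memLp_two_iff_integrable_sq hcont.aestronglyMeasurable]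
  have hint : Integrable (cutoff ε) := integrable_inv_one_add_sq.comp_mul_left' hε
  refine hint.mono (hcont.pow 2).aestronglyMeasurable (Eventually.of_forall fun x => ?_)
  rw [norm_pow, sq, Real.norm_of_nonneg (cutoff_pos ε x).le]
  exact mul_le_of_le_one_left (cutoff_pos ε x).le (cutoff_le_one ε x)

theorem smul_eq_add_integral_of_contDiff {E : Type*} [NormedAddCommGroup E] [NormedSpace ℝ E]
    [CompleteSpace E] {φ : ℝ → ℝ} (hφ : ContDiff ℝ 1 φ) {Y V : ℝ → E} {x : ℝ}
    (hV : IntervalIntegrable V volume 0 x) (hY : ∀ s, Y s = Y 0 + ∫ r in (0 : ℝ)..s, V r) :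
    φ x • Y x = φ 0 • Y 0 + ∫ s in (0 : ℝ)..x, (φ s • V s + deriv φ s • Y s) := by
  have hφ' := hφ.continuous_deriv le_rfl
  have hprim : ∀ s, φ 0 + ∫ r in (0 : ℝ)..s, deriv φ r = φ s := fun s => by
    rw [intervalIntegral.integral_deriv_eq_sub (fun r _ => hφ.differentiable one_ne_zero r)
      (hφ'.intervalIntegrable _ _), add_sub_cancel]
  have key := integral_bilin_primitive (ContinuousLinearMap.lsmul ℝ ℝ)
    (hφ'.intervalIntegrable 0 x) hV (φ 0) (Y 0)
  simp only [hprim, ← hY, ContinuousLinearMap.lsmul_apply] at key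
  rw [key, add_sub_cancel]

theorem norm_jMat (c : EuclideanSpace ℂ (Fin 2)) : ‖jMat c‖ = ‖c‖ := by
  rw [← sq_eq_sq₀ (norm_nonneg _) (norm_nonneg _), norm_sq_eq_re_inner (𝕜 := ℂ),
    norm_sq_eq_re_inner (𝕜 := ℂ), inner_jMat_left, jMat_jMat, inner_neg_right, neg_neg]

/-- A nontrivial solution `Y`, with derivative `V`, of `J y' + Q y = lam y` that is bounded on the
line. -/
structure IsBoundedSolution (p q : ℝ → ℂ) (lam : ℂ) (Y V : ℝ → EuclideanSpace ℂ (Fin 2)) :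
    Prop where
  intervalIntegrable : ∀ a b, IntervalIntegrable V volume a b
  eq_add_integral : ∀ x, Y x = Y 0 + ∫ s in (0 : ℝ)..x, V s
  smul_ae_eq : ∀ᵐ x, lam • Y x = diracExpr p q x (Y x) (V x)
  exists_norm_le : ∃ B, ∀ x, ‖Y x‖ ≤ B
  not_ae_eq_zero : ¬ Y =ᵐ[volume] 0

namespace IsBoundedSolution

variable {p q : ℝ → ℂ} {lam : ℂ} {Y V : ℝ → EuclideanSpace ℂ (Fin 2)}

theorem continuous (h : IsBoundedSolution p q lam Y V) : Continuous Y := by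
  rw [funext h.eq_add_integral]
  exact continuous_const.add (intervalIntegral.continuous_primitive h.intervalIntegrable 0)

theorem memLp_smul (h : IsBoundedSolution p q lam Y V) {φ : ℝ → ℝ} (hφ : MemLp φ 2) :
    MemLp (fun x => φ x • Y x) 2 := by
  obtain ⟨B, hB⟩ := h.exists_norm_le
  exact (memLp_top_of_bound h.continuous.aestronglyMeasurable B (Eventually.of_forall hB)).smul hφ

theorem mem_diracOp (h : IsBoundedSolution p q lam Y V) {φ : ℝ → ℝ} (hφ : ContDiff ℝ 1 φ)
    (hφ₂ : MemLp (fun x => φ x • Y x) 2 volume)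
    (hφ'₂ : MemLp (fun x => deriv φ x • jMat (Y x)) 2 volume) :
    (hφ₂.toLp, hφ'₂.toLp + lam • hφ₂.toLp) ∈ diracOp p q := by
  refine ⟨fun x => φ x • Y x, fun s => φ s • V s + deriv φ s • Y s, ?_,
    fun x => smul_eq_add_integral_of_contDiff hφ (h.intervalIntegrable 0 x) h.eq_add_integral,
    hφ₂.coeFn_toLp, ?_⟩
  · refine fun x => ⟨Icc (x - 1) (x + 1), Icc_mem_nhds (by linarith) (by linarith), ?_⟩
    rw [← intervalIntegrable_iff_integrableOn_Icc_of_le (by linarith)]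
    exact ((h.intervalIntegrable _ _).continuousOn_smul hφ.continuous.continuousOn).add
      (((hφ.continuous_deriv le_rfl).smul h.continuous).intervalIntegrable _ _)
  · filter_upwards [Lp.coeFn_add hφ'₂.toLp (lam • hφ₂.toLp), hφ'₂.coeFn_toLp,
      Lp.coeFn_smul lam hφ₂.toLp, hφ₂.coeFn_toLp, h.smul_ae_eq] with x hadd hJ hsmul hY heq
    rw [hadd, Pi.add_apply, hJ, hsmul, Pi.smul_apply, hY, smul_comm lam, heq, diracExpr_eq,
      diracExpr_eq, map_add, jMat.map_smul_of_tower, jMat.map_smul_of_tower,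
      (potential p q x).map_smul_of_tower, smul_add]
    abel

theorem mem_opSpectrum (h : IsBoundedSolution p q lam Y V) : lam ∈ opSpectrum (diracOp p q) := by
  refine mem_opSpectrum_of_forall_exists_norm_le fun ε hε => ?_
  have hφ := contDiff_cutoff ε
  have hφ₂ := h.memLp_smul (memLp_cutoff hε.ne')
  have hle : ∀ x, ‖deriv (cutoff ε) x • jMat (Y x)‖ ≤ ε * ‖cutoff ε x • Y x‖ := fun x => by
    rw [norm_smul, norm_smul, norm_jMat, ← mul_assoc, Real.norm_eq_abs,
      Real.norm_of_nonneg (cutoff_pos ε x).le]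
    exact mul_le_mul_of_nonneg_right (abs_deriv_cutoff_le hε.le x) (norm_nonneg _)
  have hφ'₂ : MemLp (fun x => deriv (cutoff ε) x • jMat (Y x)) 2 := hφ₂.of_le_mul
    ((hφ.continuous_deriv le_rfl).smul
      (jMat.continuous.comp h.continuous)).aestronglyMeasurable (Eventually.of_forall hle)
  refine ⟨hφ₂.toLp, hφ'₂.toLp, h.mem_diracOp hφ hφ₂ hφ'₂, fun h0 => h.not_ae_eq_zero ?_, ?_⟩
  · filter_upwards [hφ₂.coeFn_toLp, (Lp.eq_zero_iff_ae_eq_zero).1 h0] with x hx hx₀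
    exact (smul_eq_zero.1 (hx.symm.trans hx₀)).resolve_left (cutoff_pos ε x).ne'
  · refine Lp.norm_le_mul_norm_of_ae_le_mul ?_
    filter_upwards [hφ'₂.coeFn_toLp, hφ₂.coeFn_toLp] with x hJ hY
    rw [hJ, hY]
    exact hle x

end IsBoundedSolution

section QuasiPeriodic

variable {E : Type*} [NormedAddCommGroup E] [NormedSpace ℂ E] {T : ℝ} {w : ℂ}

theorem exists_eqOn_Ico_forall_add_eq_smul (hT : 0 < T) (hw : w ≠ 0) (v : ℝ → E) :
    ∃ V : ℝ → E, EqOn V v (Ico 0 T) ∧ ∀ x, V (x + T) = w • V x := by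
  refine ⟨fun x => w ^ toIcoDiv hT 0 x • v (toIcoMod hT 0 x), fun x hx => ?_, fun x => ?_⟩
  · have hx' : x ∈ Ico 0 (0 + T) := by rwa [zero_add]
    have hdiv : toIcoDiv hT 0 x = 0 :=
      toIcoDiv_eq_of_sub_zsmul_mem_Ico hT (by rwa [zero_smul, sub_zero])
    simp only [hdiv, zpow_zero, one_smul, (toIcoMod_eq_self hT).2 hx']
  · simp only [toIcoDiv_add_right, toIcoMod_add_right, zpow_add_one₀ hw, smul_smul, mul_comm w]

theorem intervalIntegrable_of_add_eq_smul (hT : T ≠ 0) (hw : w ≠ 0) {V : ℝ → E}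
    (hV : ∀ x, V (x + T) = w • V x) (hint : IntervalIntegrable V volume 0 T) (a b : ℝ) :
    IntervalIntegrable V volume a b := by
  let e : ℂ → ℝ → ℂ := fun c x => Complex.exp (c * x)
  have he : ∀ c, Continuous (e c) := fun c => by fun_prop
  let c := Complex.log w / T
  have hper : Function.Periodic (fun x => e (-c) x • V x) T := fun x => by
    have hcT : Complex.exp (-c * T) = w⁻¹ := by
      rw [neg_mul, div_mul_cancel₀ _ (Complex.ofReal_ne_zero.2 hT), Complex.exp_neg,
        Complex.exp_log hw]
    simp only [e, hV, Complex.ofReal_add, mul_add, Complex.exp_add, hcT, smul_smul,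
      inv_mul_cancel_right₀ hw]
  have hpint := hper.intervalIntegrable₀ hT (hint.continuousOn_smul (he (-c)).continuousOn) a b
  refine (hpint.continuousOn_smul (he c).continuousOn).congr fun x _ => ?_
  simp only [e, smul_smul, ← Complex.exp_add, neg_mul, add_neg_cancel, Complex.exp_zero, one_smul]

theorem add_integral_add_eq_smul {V : ℝ → E} (hV : ∀ x, V (x + T) = w • V x)
    (hint : ∀ a b, IntervalIntegrable V volume a b) {c : E}
    (hc : c + ∫ s in (0 : ℝ)..T, V s = w • c) (x : ℝ) :
    c + ∫ s in (0 : ℝ)..(x + T), V s = w • (c + ∫ s in (0 : ℝ)..x, V s) := by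
  have hshift : ∫ s in T..(x + T), V s = w • ∫ s in (0 : ℝ)..x, V s := by
    have hcomp := intervalIntegral.integral_comp_add_right (a := 0) (b := x) V T
    rw [zero_add] at hcomp
    simp only [← hcomp, hV, intervalIntegral.integral_smul]
  rw [← intervalIntegral.integral_add_adjacent_intervals (hint 0 T) (hint _ _), ← add_assoc, hc,
    hshift, smul_add]

theorem exists_norm_le_of_add_eq_smul (hT : T ≠ 0) (hw : ‖w‖ = 1) {Y : ℝ → E}
    (hc : Continuous Y) (hY : ∀ x, Y (x + T) = w • Y x) : ∃ B, ∀ x, ‖Y x‖ ≤ B := by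
  have hper : Function.Periodic (fun x => ‖Y x‖) T := fun x => by
    simp only [hY, norm_smul, hw, one_mul]
  obtain ⟨B, hB⟩ := (hper.isBounded_of_continuous hT hc.norm).exists_norm_le
  exact ⟨B, fun x => (norm_norm (Y x)).symm.trans_le (hB _ (mem_range_self x))⟩

theorem ae_of_periodic {P : ℝ → Prop} (hT : 0 < T) (hP : Function.Periodic P T)
    (h : ∀ᵐ x ∂volume.restrict (Icc 0 T), P x) : ∀ᵐ x, P x := by
  rw [ae_restrict_iff' measurableSet_Icc] at h
  have htrans (k : ℤ) : ∀ᵐ x : ℝ, x - k • T ∈ Icc 0 T → P (x - k • T) :=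
    (measurePreserving_sub_right volume (k • T)).quasiMeasurePreserving.ae h
  filter_upwards [ae_all_iff.2 htrans] with x hx
  exact (hP.sub_zsmul_eq _).mp
    (hx (toIcoDiv hT 0 x) (Ico_subset_Icc_self (toIcoMod_mem_Ico' hT x)))

end QuasiPeriodic

theorem diracExpr_add_pi {p q : ℝ → ℂ} (hpp : Function.Periodic p Real.pi)
    (hqp : Function.Periodic q Real.pi) (x : ℝ) (y v : EuclideanSpace ℂ (Fin 2)) :
    diracExpr p q (x + Real.pi) y v = diracExpr p q x y v := by
  rw [diracExpr, diracExpr, hpp, hqp]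

theorem exists_isBoundedSolution_of_isEigenvalue {p q : ℝ → ℂ} (hpp : Function.Periodic p Real.pi)
    (hqp : Function.Periodic q Real.pi) {lam : ℂ} {t : ℝ}
    (h : IsEigenvalue (blochOp p q t) lam) : ∃ Y V, IsBoundedSolution p q lam Y V := by
  obtain ⟨f, hf, y, v, hv, hy, hb, hfy, hfv⟩ := h
  have hw := multiplier_ne_zero t
  obtain ⟨V, hVv, hV⟩ := exists_eqOn_Ico_forall_add_eq_smul Real.pi_pos hw v
  have hVv' : V =ᵐ[volume.restrict (Icc 0 Real.pi)] v := by
    rw [← Measure.restrict_congr_set Ico_ae_eq_Icc]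
    exact ae_restrict_of_forall_mem measurableSet_Ico hVv
  have hVint := intervalIntegrable_of_add_eq_smul Real.pi_ne_zero hw hV <|
    hv.congr_ae (by
      rw [uIoc_of_le Real.pi_pos.le]
      exact ae_restrict_of_ae_restrict_of_subset Ioc_subset_Icc_self hVv'.symm)
  let Y : ℝ → EuclideanSpace ℂ (Fin 2) := fun x => y 0 + ∫ s in (0 : ℝ)..x, V s
  have hYy : EqOn Y y (Icc 0 Real.pi) := fun x hx => by
    simp only [Y, hy x hx, intervalIntegral_congr_ae_Icc hVv' hx]
  have hYper : ∀ x, Y (x + Real.pi) = multiplier t • Y x :=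
    add_integral_add_eq_smul hV hVint ((hYy (right_mem_Icc.2 Real.pi_pos.le)).trans hb)
  have hYc : Continuous Y := continuous_const.add (intervalIntegral.continuous_primitive hVint 0)
  refine ⟨Y, V, hVint, fun x => ?_, ?_,
    exists_norm_le_of_add_eq_smul Real.pi_ne_zero (norm_multiplier t) hYc hYper, fun h0 => hf ?_⟩
  · simp only [Y, intervalIntegral.integral_same, add_zero]
  · refine ae_of_periodic Real.pi_pos (fun x => propext ?_) ?_
    · rw [hYper, hV, diracExpr_smul, smul_comm lam, diracExpr_add_pi hpp hqp]
      exact (smul_right_injective _ hw).eq_iff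
    · filter_upwards [hVv', hfy, hfv, Lp.coeFn_smul lam f, ae_restrict_mem measurableSet_Icc]
        with x hVx hfx hgx hsmul hx
      rw [hYy hx, hVx, ← hgx, hsmul, Pi.smul_apply, hfx]
  · rw [Lp.eq_zero_iff_ae_eq_zero]
    filter_upwards [ae_restrict_of_ae h0, hfy, ae_restrict_mem measurableSet_Icc] with x h0x hfx hx
    rw [hfx, ← hYy hx, h0x]

theorem corollary1_general (p q : ℝ → ℂ)
    (hp : Function.Periodic p Real.pi) (hq : Function.Periodic q Real.pi)
    (hpb : MemLp p ∞ (volume.restrict (Icc 0 Real.pi)))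
    (hqb : MemLp q ∞ (volume.restrict (Icc 0 Real.pi))) :
    {lam : ℂ | IsSpectralSingularity p q lam} ⊆
        {lam : ℂ | ∃ t ∈ Ioc (-1 : ℝ) 1, IsMultipleEigenvalue (blochOp p q t) lam} ∧
      {lam : ℂ | IsEssentialSpectralSingularity p q lam} ⊆
        {lam : ℂ | IsSpectralSingularity p q lam} ∧
      ∀ lam : ℂ, IsEssentialSpectralSingularity p q lam →
        IsMultipleEigenvalue (blochOp p q 0) lam ∨ IsMultipleEigenvalue (blochOp p q 1) lam := by
  refine ⟨fun lam h => isMultipleEigenvalue_of_isSpectralSingularity hpb hqb h, fun lam h => ?_,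
    fun lam h => ?_⟩
  · obtain ⟨t₀, -, μ, hμ⟩ := h.exists_isEssentialBranch hpb hqb
    obtain ⟨Y, V, hY⟩ := exists_isBoundedSolution_of_isEigenvalue hp hq
      ((isEigenvalue_blochOp_iff hpb hqb).2 hμ.discriminant_eq)
    exact isSpectralSingularity_of_forall_exists_le_residueNorm hpb hqb hY.mem_opSpectrum
      fun ε hε n => hμ.exists_le_residueNorm hε n
  · obtain ⟨t₀, ht₀, μ, hμ⟩ := h.exists_isEssentialBranch hpb hqb
    rcases hμ.eq_zero_or_eq_one ht₀ with rfl | rfl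
    · exact .inl hμ.isMultipleEigenvalue
    · exact .inr hμ.isMultipleEigenvalue

theorem corollary1 (p q : ℝ → ℂ)
    (hp : Function.Periodic p Real.pi) (hq : Function.Periodic q Real.pi)
    (hpBV : BoundedVariationOn p (Icc 0 Real.pi))
    (hqBV : BoundedVariationOn q (Icc 0 Real.pi)) :
    {lam : ℂ | IsSpectralSingularity p q lam} ⊆
        {lam : ℂ | ∃ t ∈ Ioc (-1 : ℝ) 1, IsMultipleEigenvalue (blochOp p q t) lam} ∧
      {lam : ℂ | IsEssentialSpectralSingularity p q lam} ⊆
        {lam : ℂ | IsSpectralSingularity p q lam} ∧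
      ∀ lam : ℂ, IsEssentialSpectralSingularity p q lam →
        IsMultipleEigenvalue (blochOp p q 0) lam ∨ IsMultipleEigenvalue (blochOp p q 1) lam :=
  corollary1_general p q hp hq (memLp_top_of_boundedVariationOn measurableSet_Icc hpBV)
    (memLp_top_of_boundedVariationOn measurableSet_Icc hqBV)
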